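/- Let $V$ be a finite non-empty vertex set and $E$ a finite set of directed edges (loops and multiple edges allowed); the edge $e$ goes from $i(e)$ to $t(e)$. For each $e\in E$ let $\psi_e(\xi)=T_e\xi+t_e$ be an affine map of $\mathbb{R}^2$ with $t_e\in\mathbb{R}^2$ and $$T_e=\begin{pmatrix}\pm a_e&0\\0&\pm b_e\end{pmatrix}\quad\text{or}\quad T_e=\begin{pmatrix}0&\pm a_e\\\pm b_e&0\end{pmatrix},\qquad 0<a_e,b_e<1 .$$ A word $w=w_1\cdots w_k\in E^k$, $k\ge1$, is admissible if $t(w_{j-1})=i(w_j)$ for $1<j\le k$; it goes from $i(w)=i(w_1)$ to $t(w)=t(w_k)$, written $i(w)\xrightarrow{w}t(w)$. Assume that the graph is strongly connected (for all $v,v'\in V$ there is an admissible word from $v$ to $v'$), and that the rectangular open set condition (ROSC) holds: for every $v\in V$ the sets $\psi_e((0,1)^2)$ with $i(e)=v$ are pairwise disjoint subsets of $(0,1)^2$. Let $(p_e)_{e\in E}$ be positive numbers with $\sum_{i(e)=v}p_e=1$ for all $v\in V$, and let $\{\mu_v\}_{v\in V}$ be the associated graph-directed self-affine measures, that is, Borel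 probability measures on $\mathbb{R}^2$ with $$\mu_v=\sum_{e:\,i(e)=v}p_e\,\mu_{t(e)}\circ\psi_e^{-1}\qquad(v\in V).$$ For a compactly supported Borel probability measure $\nu$ on $\mathbb{R}^n$, $q\ge0$ and $\delta>0$ put $\mathcal D^q_\delta(\nu)=\sum_Q\nu(Q)^q$, the sum over the closed cubes $Q$ of the $\delta$-mesh of $\mathbb{R}^n$ with $\nu(Q)>0$. The $L^q$-spectrum $\tau_\nu(q)$ is said to exist if the upper and lower limits of $\log\mathcal D^q_\delta(\nu)/(-\log\delta)$ as $\delta\to0+$ coincide, and it is then their common value. Let $\pi_x,\pi_y$ be the coordinate projections of $\mathbb{R}^2$. For an admissible word $w=w_1\cdots w_k$ put $p_w=p_{w_1}\cdots p_{w_k}$, $T_w=T_{w_1}\cdots T_{w_k}$ and $\psi_w=\psi_{w_1}\circ\cdots\circ\psi_{w_k}$, let $\alpha_1(w)\ge\alpha_2(w)$ be the singular values of $T_w$, and let $c_w,d_w$ be the width and the height of the rectangle $\psi_w([0,1]^2)$. Let $\pi_w=\pi_x$ if $c_w\ge d_w$ and $T_w$ is diagonal or if $c_w<d_w$ and $T_w$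 is anti-diagonal, and $\pi_w=\pi_y$ otherwise. For $s\in\mathbb{R}$ and $q\ge0$ put $$\tau_w(q)=\tau_{\mu_{t(w)}\circ\pi_w^{-1}}(q),\qquad \varphi^{s,q}(w)=p_w^q\,\alpha_1(w)^{\tau_w(q)}\,\alpha_2(w)^{s-\tau_w(q)},$$ let $A^{s,q}_k$ be the $V\times V$ matrix with entries $A^{s,q}_k(v,v')=\sum_{w\in E^k:\,v\xrightarrow{w}v'}\varphi^{s,q}(w)$ (the sum over admissible words), and let $P(s,q)=\lim_{k\to\infty}\|A^{s,q}_k\|^{1/k}$, where $\|A\|=\sum_{v,v'}|A(v,v')|$. Then for every $q\ge0$: (i) the $L^q$-spectra at $q$ of $\mu_v\circ\pi_x^{-1}$ and $\mu_v\circ\pi_y^{-1}$ exist and are finite for all $v\in V$, and the limit defining $P(s,q)$ exists and is finite for all $s\in\mathbb{R}$, so that $P(\cdot,q)$ is well defined; (ii) there is exactly one real number $\gamma(q)$ with $P(\gamma(q),q)=1$; (iii) for every $v\in V$ the $L^q$-spectrum $\tau_{\mu_v}(q)$ exists and equals $\gamma(q)$. -/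

import Mathlib

open MeasureTheory Filter Topology

noncomputable section

/-! ### `L^q`-spectra of measures on `ℝⁿ` -/

/-- The closed cube of the `δ`-mesh of `ℝⁿ` with index `k ∈ ℤⁿ`. -/
def meshCube {n : ℕ} (δ : ℝ) (k : Fin n → ℤ) : Set (Fin n → ℝ) :=
  {x | ∀ i, (k i : ℝ) * δ ≤ x i ∧ x i ≤ ((k i : ℝ) + 1) * δ}

open Classical in
/-- `D_δ^q(ν) = ∑_Q ν(Q)^q` over the closed cubes `Q` of the `δ`-mesh. Cubes of measure zero
contribute `0`, also for `q = 0`. The sum has finitely many non-zero terms when the finite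
measure `ν` is compactly supported. -/
def meshMoment {n : ℕ} (ν : Measure (Fin n → ℝ)) (q δ : ℝ) : ℝ :=
  ∑' k : Fin n → ℤ, if ν (meshCube δ k) = 0 then 0 else (ν (meshCube δ k)).toReal ^ q

/-- The upper `L^q`-spectrum, an extended real. -/
def upperLqSpectrum {n : ℕ} (ν : Measure (Fin n → ℝ)) (q : ℝ) : EReal :=
  limsup (fun δ : ℝ => ((Real.log (meshMoment ν q δ) / (-Real.log δ) : ℝ) : EReal)) (𝓝[>] 0)

/-- The lower `L^q`-spectrum, an extended real. -/
def lowerLqSpectrum {n : ℕ} (ν : Measure (Fin n → ℝ)) (q : ℝ) : EReal :=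
  liminf (fun δ : ℝ => ((Real.log (meshMoment ν q δ) / (-Real.log δ) : ℝ) : EReal)) (𝓝[>] 0)

/-- The `L^q`-spectrum of `ν` exists at `q` and equals the real number `τ`. -/
def HasLqSpectrum {n : ℕ} (ν : Measure (Fin n → ℝ)) (q τ : ℝ) : Prop :=
  lowerLqSpectrum ν q = (τ : EReal) ∧ upperLqSpectrum ν q = (τ : EReal)

/-- The value of the `L^q`-spectrum; meaningful when `HasLqSpectrum ν q τ` for some `τ`, and then
equal to `τ`. -/
def lqSpectrum {n : ℕ} (ν : Measure (Fin n → ℝ)) (q : ℝ) : ℝ :=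
  (upperLqSpectrum ν q).toReal

/-! ### Planar box-like self-affine GIFS -/

/-- `T` is `diag(±a, ±b)` with `0 < a, b < 1`. -/
def IsBoxDiagonal (T : Matrix (Fin 2) (Fin 2) ℝ) : Prop :=
  ∃ a b : ℝ, 0 < |a| ∧ |a| < 1 ∧ 0 < |b| ∧ |b| < 1 ∧ T = !![a, 0; 0, b]

/-- `T` is anti-diagonal with entries `±a, ±b`, where `0 < a, b < 1`. -/
def IsBoxAntiDiagonal (T : Matrix (Fin 2) (Fin 2) ℝ) : Prop :=
  ∃ a b : ℝ, 0 < |a| ∧ |a| < 1 ∧ 0 < |b| ∧ |b| < 1 ∧ T = !![0, a; b, 0]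

/-- A directed multigraph with vertices `V` and edges `E` (loops and multiple edges allowed),
with an affine map `ξ ↦ T_e ξ + t_e` of the plane on each edge `e`, where `T_e` is a contracting
non-singular diagonal or anti-diagonal matrix. -/
structure BoxLikeGIFS (V E : Type*) where
  /-- initial vertex -/
  src : E → V
  /-- terminal vertex -/
  tgt : E → V
  /-- linear part -/
  lin : E → Matrix (Fin 2) (Fin 2) ℝ
  /-- translation part -/
  trans : E → (Fin 2 → ℝ)
  boxLike : ∀ e, IsBoxDiagonal (lin e) ∨ IsBoxAntiDiagonal (lin e)

namespace BoxLikeGIFS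

variable {V E : Type*} (G : BoxLikeGIFS V E)

/-- The affine map `ψ_e`. -/
def psi (e : E) : (Fin 2 → ℝ) → (Fin 2 → ℝ) :=
  fun ξ => (G.lin e).mulVec ξ + G.trans e

/-- The word `w` is admissible and leads from `v` to `v'`. The empty word leads from each vertex
to itself. -/
def IsPath : V → List E → V → Prop
  | v, [], v' => v = v'
  | v, e :: w, v' => G.src e = v ∧ IsPath (G.tgt e) w v'

/-- Any two vertices, equal or not, are joined by an admissible word of length at least one. -/
def StronglyConnected : Prop :=
  ∀ v v' : V, ∃ w : List E, w ≠ [] ∧ G.IsPath v w v'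

/-- The rectangular open set condition. -/
def ROSC : Prop :=
  ∀ v : V,
    (⋃ e ∈ {e : E | G.src e = v}, G.psi e '' Set.univ.pi (fun _ => Set.Ioo (0 : ℝ) 1)) ⊆
      Set.univ.pi (fun _ => Set.Ioo (0 : ℝ) 1) ∧
    {e : E | G.src e = v}.PairwiseDisjoint
      (fun e => G.psi e '' Set.univ.pi (fun _ => Set.Ioo (0 : ℝ) 1))

open Classical in
/-- A positive vector with `∑_{i(e) = v} p_e = 1` for every vertex `v`. -/
def IsProbVector [Fintype E] (p : E → ℝ) : Prop :=
  (∀ e, 0 < p e) ∧ ∀ v : V, ∑ e with G.src e = v, p e = 1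

open Classical in
/-- Borel probability measures on the plane with
`μ_v = ∑_{i(e) = v} p_e · μ_{t(e)} ∘ ψ_e⁻¹` for every vertex `v`. -/
def IsSelfAffineFamily [Fintype E] (p : E → ℝ) (μ : V → Measure (Fin 2 → ℝ)) : Prop :=
  (∀ v, IsProbabilityMeasure (μ v)) ∧
    ∀ v, μ v = ∑ e with G.src e = v, ENNReal.ofReal (p e) • (μ (G.tgt e)).map (G.psi e)

/-- `T_w = T_{w_1} ⋯ T_{w_k}`. -/
def linWord (w : List E) : Matrix (Fin 2) (Fin 2) ℝ := (w.map G.lin).prod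

/-- `ψ_w = ψ_{w_1} ∘ ⋯ ∘ ψ_{w_k}`. -/
def psiWord : List E → (Fin 2 → ℝ) → (Fin 2 → ℝ)
  | [] => id
  | e :: w => G.psi e ∘ psiWord w

/-- The length of the side of the rectangle `ψ_w([0,1]²)` parallel to the `i`-th axis:
`i = 0` gives the width `c_w`, `i = 1` the height `d_w`. -/
def sideLength (i : Fin 2) (w : List E) : ℝ :=
  Metric.diam ((fun ξ : Fin 2 → ℝ => ξ i) '' (G.psiWord w '' Set.Icc 0 1))

open Classical in
/-- The coordinate selected by `π_w`: the one that `T_w` maps to the direction of the longest side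
of `ψ_w([0,1]²)`, with ties resolved in favour of the width. -/
def projIndex (w : List E) : Fin 2 :=
  if (G.linWord w).IsDiag then
    if G.sideLength 1 w ≤ G.sideLength 0 w then 0 else 1
  else
    if G.sideLength 1 w ≤ G.sideLength 0 w then 1 else 0

/-- The singular values of `T_w` in decreasing order: `i = 0` gives `α₁(w)`, `i = 1` gives
`α₂(w)`. -/
def alpha (i : ℕ) (w : List E) : ℝ :=
  (Matrix.toEuclideanLin (G.linWord w)).singularValues i

end BoxLikeGIFS

/-- The projection of a measure on the plane to the `i`-th axis, as a measure on `ℝ¹`: `i = 0`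
gives `μ^x`, `i = 1` gives `μ^y`. -/
def projMeasure (i : Fin 2) (μ : Measure (Fin 2 → ℝ)) : Measure (Fin 1 → ℝ) :=
  μ.map (fun ξ _ => ξ i)

namespace BoxLikeGIFS

variable {V E : Type*} (G : BoxLikeGIFS V E)

/-- `τ_w(q)`, for a word `w` with terminal vertex `v'`. -/
def tauWord (μ : V → Measure (Fin 2 → ℝ)) (q : ℝ) (w : List E) (v' : V) : ℝ :=
  lqSpectrum (projMeasure (G.projIndex w) (μ v')) q

/-- The modified singular value function `φ^{s,q}(w)`, for a word `w` with terminal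
vertex `v'`. -/
def phi (p : E → ℝ) (μ : V → Measure (Fin 2 → ℝ)) (s q : ℝ) (w : List E) (v' : V) : ℝ :=
  (w.map p).prod ^ q * G.alpha 0 w ^ G.tauWord μ q w v' * G.alpha 1 w ^ (s - G.tauWord μ q w v')

open Classical in
/-- The modified singular value function matrix `A_k^{s,q}`. Its `(v, v')` entry is the sum of
`φ^{s,q}(w)` over the admissible words `w` of length `k` from `v` to `v'`. -/
def svMatrix [Fintype E] (p : E → ℝ) (μ : V → Measure (Fin 2 → ℝ)) (s q : ℝ) (k : ℕ) :
    Matrix V V ℝ :=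
  Matrix.of fun v v' =>
    ∑ w : Fin k → E with G.IsPath v (List.ofFn w) v', G.phi p μ s q (List.ofFn w) v'

/-- `‖A_k^{s,q}‖^{1/k}`, where `‖A‖ = ∑ |a_{ij}|`. -/
def pressureSeq [Fintype V] [Fintype E] (p : E → ℝ) (μ : V → Measure (Fin 2 → ℝ)) (s q : ℝ)
    (k : ℕ) : ℝ :=
  (∑ v, ∑ v', |G.svMatrix p μ s q k v v'|) ^ (1 / (k : ℝ))

/-- The pressure `P(s, q) = lim_k ‖A_k^{s,q}‖^{1/k}`. -/
def pressure [Fintype V] [Fintype E] (p : E → ℝ) (μ : V → Measure (Fin 2 → ℝ)) (s q : ℝ) : ℝ :=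
  limUnder atTop (G.pressureSeq p μ s q)

end BoxLikeGIFS

end

/-! Fix a scale δ and cut `μ_v` along the words `w` at which the shorter side α₂(w) of the rectangle
ψ_w([0,1]²) first drops below δ. By the ROSC these rectangles have disjoint interiors, and their
sides are at least a constant times δ. A mesh square therefore meets boundedly many of them, and the
moment of `μ_v` at scale δ is comparable to the sum of the moments of the pieces
(`exists_mom_comparable_sum_stopSet`). Across its shorter side a piece is invisible at scale δ, so
its moment is p_w^q times the moment of a projection of μ_{t(w)} at scale α₂/α₁
(`mom_psiWord_comparable`). Up to a subexponential factor this is p_w^q (α₁/α₂)^{τ_w}, which is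
δ^{-s} φ^{s,q}(w) because α₂ is comparable to δ. Hence, for every s, the logarithm of the moment
plus s log δ equals the logarithm of the sum of φ^{s,q} over the stopping words, with an arbitrarily
small relative error (`exists_mom_le_sum_svf`).

The projections may overlap, and their spectra need another argument. Cut along the words whose side
parallel to the axis drops below δ. At scale δε every piece looks like a projection at scale ε, and
strong connectedness makes all the projections that occur comparable
(`exists_mom_coordMap_comparable`). Jensen's inequality then makes the moments submultiplicative in
the scale for q ≥ 1 and supermultiplicative for q ≤ 1, up to constants (`exists_mom_coordMap_mul`),
and Fekete's lemma gives the limit.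

For the pressure, φ^{s,q}(w) is rewritten as p_w^q times a product of powers of both sides times a
power of α₂ (`phi_eq_svf`). Everything but the last factor is multiplicative along paths, and α₂ is
supermultiplicative, so φ is submultiplicative or supermultiplicative according to the sign of the
last exponent. The logarithmic growth rate exists, and its slopes in s lie between two negative
constants, which gives the unique zero γ (`exists_log_pressure`). For s > γ the sum over all words
converges and bounds the stopping sums; for s < γ the stopping sums are bounded below at some vertex
(`exists_le_sum_stopSet`). One vertex suffices because the moments of all `μ_v` are comparable. -/

open scoped ENNReal

/-! ### Inequalities for sums of `q`-th powers -/

/-- The power `x ↦ x ^ q` with the convention `0 ^ q = 0` also for `q = 0`. -/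
noncomputable def qpow (q : ℝ) (x : ℝ≥0∞) : ℝ≥0∞ := open Classical in if x = 0 then 0 else x ^ q

@[simp] lemma qpow_zero_right (q : ℝ) : qpow q 0 = 0 := by simp [qpow]

lemma qpow_of_ne_zero {q : ℝ} {x : ℝ≥0∞} (hx : x ≠ 0) : qpow q x = x ^ q := by simp [qpow, hx]

lemma qpow_mono {q : ℝ} (hq : 0 ≤ q) {x y : ℝ≥0∞} (h : x ≤ y) : qpow q x ≤ qpow q y := by
  by_cases hx : x = 0
  · simp [hx]
  · have hy : y ≠ 0 := fun hy => hx (by simpa [hy] using h)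
    rw [qpow_of_ne_zero hx, qpow_of_ne_zero hy]
    exact ENNReal.rpow_le_rpow h hq

lemma qpow_mul {q : ℝ} (hq : 0 ≤ q) {c : ℝ≥0∞} (hc : c ≠ 0) (x : ℝ≥0∞) :
    qpow q (c * x) = c ^ q * qpow q x := by
  by_cases hx : x = 0
  · simp [hx]
  · rw [qpow_of_ne_zero hx, qpow_of_ne_zero (mul_ne_zero hc hx), ENNReal.mul_rpow_of_nonneg _ _ hq]

lemma qpow_ne_top {q : ℝ} (hq : 0 ≤ q) {x : ℝ≥0∞} (hx : x ≠ ∞) : qpow q x ≠ ∞ := by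
  by_cases h : x = 0
  · simp [h]
  · rw [qpow_of_ne_zero h]
    exact ENNReal.rpow_ne_top_of_nonneg hq hx

lemma qpow_ne_zero {q : ℝ} (hq : 0 ≤ q) {x : ℝ≥0∞} (hx : x ≠ 0) : qpow q x ≠ 0 := by
  rw [qpow_of_ne_zero hx]
  exact fun h => (ENNReal.rpow_eq_zero_iff.1 h).elim (fun h => hx h.1) (fun h => by linarith [h.2])

lemma qpow_of_pos {q : ℝ} (hq : 0 < q) (x : ℝ≥0∞) : qpow q x = x ^ q := by
  by_cases h : x = 0
  · simp [h, hq]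
  · exact qpow_of_ne_zero h

/-- Every term is replaced by the largest one. This needs no convexity and covers all `q ≥ 0` at
once. -/
lemma qpow_sum_le {κ : Type*} {q : ℝ} (hq : 0 ≤ q) (T : Finset κ) (h : κ → ℝ≥0∞) {N : ℕ}
    (hN : T.card ≤ N) : qpow q (∑ b ∈ T, h b) ≤ (N : ℝ≥0∞) ^ q * ∑ b ∈ T, qpow q (h b) := by
  rcases T.eq_empty_or_nonempty with rfl | hT
  · simp
  obtain ⟨b, hb, hmax⟩ := T.exists_max_image h hT
  have hN0 : (N : ℝ≥0∞) ≠ 0 := by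
    have := hT.card_pos
    exact_mod_cast (by omega : N ≠ 0)
  calc qpow q (∑ b ∈ T, h b) ≤ qpow q (N * h b) := by
        refine qpow_mono hq ((Finset.sum_le_card_nsmul T h (h b) hmax).trans ?_)
        rw [nsmul_eq_mul]
        gcongr
    _ = (N : ℝ≥0∞) ^ q * qpow q (h b) := qpow_mul hq hN0 _
    _ ≤ _ := by
        gcongr
        exact Finset.single_le_sum (f := fun b => qpow q (h b)) (fun _ _ => zero_le) hb

lemma sum_qpow_le {κ : Type*} {q : ℝ} (hq : 0 ≤ q) (T : Finset κ) (h : κ → ℝ≥0∞) {N : ℕ}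
    (hN : T.card ≤ N) : ∑ b ∈ T, qpow q (h b) ≤ (N : ℝ≥0∞) * qpow q (∑ b ∈ T, h b) := by
  refine (Finset.sum_le_card_nsmul T _ (qpow q (∑ b ∈ T, h b)) fun b hb => ?_).trans ?_
  · exact qpow_mono hq (Finset.single_le_sum (fun _ _ => zero_le) hb)
  · rw [nsmul_eq_mul]
    gcongr

lemma tsum_eq_sum_of_support {κ : Type*} {T : Finset κ} {h : κ → ℝ≥0∞}
    (hT : ∀ b, h b ≠ 0 → b ∈ T) : ∑' b, h b = ∑ b ∈ T, h b :=
  tsum_eq_sum fun b hb => by_contra fun h0 => hb (hT b h0)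

lemma qpow_tsum_le {κ : Type*} {q : ℝ} (hq : 0 ≤ q) {T : Finset κ} {h : κ → ℝ≥0∞} {N : ℕ}
    (hN : T.card ≤ N) (hT : ∀ b, h b ≠ 0 → b ∈ T) :
    qpow q (∑' b, h b) ≤ (N : ℝ≥0∞) ^ q * ∑' b, qpow q (h b) := by
  rw [tsum_eq_sum_of_support hT]
  refine (qpow_sum_le hq T h hN).trans ?_
  gcongr
  exact ENNReal.sum_le_tsum T

lemma tsum_qpow_le {κ : Type*} {q : ℝ} (hq : 0 ≤ q) {T : Finset κ} {h : κ → ℝ≥0∞} {N : ℕ}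
    (hN : T.card ≤ N) (hT : ∀ b, h b ≠ 0 → b ∈ T) :
    ∑' b, qpow q (h b) ≤ (N : ℝ≥0∞) * qpow q (∑' b, h b) := by
  rw [tsum_eq_sum_of_support hT, tsum_eq_sum_of_support (T := T)]
  · exact sum_qpow_le hq T h hN
  · exact fun b hb => hT b fun h0 => hb (by simp [h0])

open Classical in
/-- If each `f a` is at most the sum of the `h b` with `R a b`, and the relation `R` is bounded on
both sides, then the `q`-th moment of `f` is at most a constant times that of `h`. -/
lemma tsum_qpow_le_of_rel {ι κ : Type*} {q : ℝ} (hq : 0 ≤ q) (R : ι → κ → Prop) {N M : ℕ}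
    (hN : ∀ a, ∃ T : Finset κ, T.card ≤ N ∧ ∀ b, R a b → b ∈ T)
    (hM : ∀ b, ∃ T : Finset ι, T.card ≤ M ∧ ∀ a, R a b → a ∈ T)
    {f : ι → ℝ≥0∞} {h : κ → ℝ≥0∞} (hf : ∀ a, f a ≤ ∑' b, if R a b then h b else 0) :
    ∑' a, qpow q (f a) ≤ (N : ℝ≥0∞) ^ q * M * ∑' b, qpow q (h b) := by
  have h1 : ∀ a, qpow q (f a) ≤ ∑' b, (N : ℝ≥0∞) ^ q * if R a b then qpow q (h b) else 0 := by
    intro a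
    obtain ⟨T, hT, hTR⟩ := hN a
    refine (qpow_mono hq (hf a)).trans ((qpow_tsum_le hq hT ?_).trans ?_)
    · exact fun b hb => hTR b (by_contra fun h0 => hb (by simp [h0]))
    · rw [ENNReal.tsum_mul_left]
      gcongr with b
      split_ifs <;> simp
  calc ∑' a, qpow q (f a) ≤ ∑' a, ∑' b, (N : ℝ≥0∞) ^ q * if R a b then qpow q (h b) else 0 :=
        ENNReal.tsum_le_tsum h1
    _ = ∑' b, ∑' a, (N : ℝ≥0∞) ^ q * if R a b then qpow q (h b) else 0 := ENNReal.tsum_comm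
    _ ≤ ∑' b, (N : ℝ≥0∞) ^ q * M * qpow q (h b) := by
        refine ENNReal.tsum_le_tsum fun b => ?_
        rw [ENNReal.tsum_mul_left, mul_assoc]
        gcongr
        obtain ⟨T, hT, hTR⟩ := hM b
        rw [tsum_eq_sum_of_support (T := T)]
        · refine (Finset.sum_le_card_nsmul T _ (qpow q (h b)) fun a _ => ?_).trans ?_
          · split_ifs <;> simp
          · rw [nsmul_eq_mul]
            gcongr
        · exact fun a ha => hTR a (by_contra fun h0 => ha (by simp [h0]))
    _ = _ := ENNReal.tsum_mul_left

/-- Jensen's inequality for the convex power with the normalised weights `p w / P`, followed by an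
interchange of the two sums. -/
lemma tsum_qpow_weighted_le {ω κ : Type*} {q : ℝ} (hq : 1 ≤ q) (s : Finset ω) {p : ω → ℝ≥0∞}
    (hp : ∑ w ∈ s, p w ≠ ∞) {x : ω → κ → ℝ≥0∞} {T : ℝ≥0∞}
    (hT : ∀ w ∈ s, ∑' k, qpow q (x w k) ≤ T) :
    ∑' k, qpow q (∑ w ∈ s, p w * x w k) ≤ qpow q (∑ w ∈ s, p w) * T := by
  have hq0 : 0 < q := by linarith
  set P := ∑ w ∈ s, p w with hP
  by_cases hP0 : P = 0
  · have : ∀ k, ∑ w ∈ s, p w * x w k = 0 := fun k =>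
      Finset.sum_eq_zero fun w hw => by simp [(Finset.sum_eq_zero_iff.1 hP0) w hw]
    simp [this]
  have hsum : ∑ w ∈ s, p w / P = 1 := by
    simp_rw [div_eq_mul_inv]
    rw [← Finset.sum_mul, ENNReal.mul_inv_cancel hP0 hp]
  have key : ∀ k, qpow q (∑ w ∈ s, p w * x w k) ≤ P ^ q * ∑ w ∈ s, p w / P * qpow q (x w k) := by
    intro k
    have h1 : ∑ w ∈ s, p w * x w k = P * ∑ w ∈ s, p w / P * x w k := by
      rw [Finset.mul_sum]
      refine Finset.sum_congr rfl fun w _ => ?_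
      rw [← mul_assoc, ENNReal.mul_div_cancel hP0 hp]
    rw [h1, qpow_mul hq0.le hP0]
    gcongr
    simp_rw [qpow_of_pos hq0]
    exact ENNReal.rpow_arith_mean_le_arith_mean_rpow s _ _ hsum hq
  calc ∑' k, qpow q (∑ w ∈ s, p w * x w k)
      ≤ ∑' k, P ^ q * ∑ w ∈ s, p w / P * qpow q (x w k) := ENNReal.tsum_le_tsum key
    _ = P ^ q * ∑ w ∈ s, p w / P * ∑' k, qpow q (x w k) := by
        rw [ENNReal.tsum_mul_left, Summable.tsum_finsetSum fun _ _ => ENNReal.summable]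
        simp_rw [ENNReal.tsum_mul_left]
    _ ≤ P ^ q * ∑ w ∈ s, p w / P * T := by
        gcongr with w hw
        exact hT w hw
    _ = qpow q P * T := by rw [← Finset.sum_mul, hsum, one_mul, qpow_of_ne_zero hP0]

lemma sum_mul_qpow_le {ω : Type*} {q : ℝ} (hq : 0 ≤ q) (hq1 : q ≤ 1) (s : Finset ω)
    {l x : ω → ℝ≥0∞} (hl : ∑ w ∈ s, l w = 1) :
    ∑ w ∈ s, l w * qpow q (x w) ≤ qpow q (∑ w ∈ s, l w * x w) := by
  -- For `q = 0` the power is the indicator of a non-zero argument, and the weights of the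
  -- non-vanishing terms add up to at most `1`.
  rcases hq.eq_or_lt with rfl | hq0
  · by_cases h0 : ∑ w ∈ s, l w * x w = 0
    · rw [h0, qpow_zero_right, nonpos_iff_eq_zero]
      refine Finset.sum_eq_zero fun w hw => ?_
      rcases mul_eq_zero.1 (Finset.sum_eq_zero_iff.1 h0 w hw) with h | h <;> simp [h]
    · rw [qpow_of_ne_zero h0, ENNReal.rpow_zero, ← hl]
      refine Finset.sum_le_sum fun w _ => ?_
      by_cases hx : x w = 0
      · simp [hx]
      · simp [qpow_of_ne_zero hx]
  · simp_rw [qpow_of_pos hq0]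
    have h := ENNReal.rpow_arith_mean_le_arith_mean_rpow s l (fun w => x w ^ q) hl
      ((one_le_div hq0).2 hq1)
    simp_rw [← ENNReal.rpow_mul, mul_one_div_cancel hq0.ne', ENNReal.rpow_one] at h
    have h2 := ENNReal.rpow_le_rpow h hq0.le
    rwa [← ENNReal.rpow_mul, one_div_mul_cancel hq0.ne', ENNReal.rpow_one] at h2

/-- The concave counterpart of `tsum_qpow_weighted_le`, by `sum_mul_qpow_le`. -/
lemma le_tsum_qpow_weighted {ω κ : Type*} {q : ℝ} (hq : 0 ≤ q) (hq1 : q ≤ 1) (s : Finset ω)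
    {p : ω → ℝ≥0∞} (hp : ∑ w ∈ s, p w ≠ ∞) {x : ω → κ → ℝ≥0∞} {T : ℝ≥0∞}
    (hT : ∀ w ∈ s, T ≤ ∑' k, qpow q (x w k)) :
    qpow q (∑ w ∈ s, p w) * T ≤ ∑' k, qpow q (∑ w ∈ s, p w * x w k) := by
  set P := ∑ w ∈ s, p w with hP
  by_cases hP0 : P = 0
  · simp [hP0]
  have hsum : ∑ w ∈ s, p w / P = 1 := by
    simp_rw [div_eq_mul_inv]
    rw [← Finset.sum_mul, ENNReal.mul_inv_cancel hP0 hp]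
  have key : ∀ k, P ^ q * ∑ w ∈ s, p w / P * qpow q (x w k) ≤ qpow q (∑ w ∈ s, p w * x w k) := by
    intro k
    have h1 : ∑ w ∈ s, p w * x w k = P * ∑ w ∈ s, p w / P * x w k := by
      rw [Finset.mul_sum]
      refine Finset.sum_congr rfl fun w _ => ?_
      rw [← mul_assoc, ENNReal.mul_div_cancel hP0 hp]
    rw [h1, qpow_mul hq hP0]
    gcongr
    exact sum_mul_qpow_le hq hq1 s hsum
  calc qpow q P * T = P ^ q * ∑ w ∈ s, p w / P * T := by
        rw [← Finset.sum_mul, hsum, one_mul, qpow_of_ne_zero hP0]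
    _ ≤ P ^ q * ∑ w ∈ s, p w / P * ∑' k, qpow q (x w k) := by
        gcongr with w hw
        exact hT w hw
    _ = ∑' k, P ^ q * ∑ w ∈ s, p w / P * qpow q (x w k) := by
        rw [ENNReal.tsum_mul_left, Summable.tsum_finsetSum fun _ _ => ENNReal.summable]
        simp_rw [ENNReal.tsum_mul_left]
    _ ≤ _ := ENNReal.tsum_le_tsum key

/-! ### Mesh cubes -/

/-- The index of a cube of the `δ`-mesh that contains `x`. -/
noncomputable def meshCell {n : ℕ} (δ : ℝ) (x : Fin n → ℝ) : Fin n → ℤ := fun i => ⌊x i / δ⌋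

/-- The indices at sup-distance at most `C` from `k`. -/
noncomputable def nearIndices {n : ℕ} (C : ℕ) (k : Fin n → ℤ) : Finset (Fin n → ℤ) :=
  Fintype.piFinset fun i => Finset.Icc (k i - C) (k i + C)

lemma mem_nearIndices {n C : ℕ} {k l : Fin n → ℤ} :
    l ∈ nearIndices C k ↔ ∀ i, k i - C ≤ l i ∧ l i ≤ k i + C := by
  simp [nearIndices, Fintype.mem_piFinset]

lemma mem_nearIndices_comm {n C : ℕ} {k l : Fin n → ℤ} :
    l ∈ nearIndices C k ↔ k ∈ nearIndices C l := by
  simp only [mem_nearIndices]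
  exact forall_congr' fun i => by omega

lemma card_nearIndices {n : ℕ} (C : ℕ) (k : Fin n → ℤ) :
    (nearIndices C k).card = (2 * C + 1) ^ n := by
  have : ∀ i, (Finset.Icc (k i - C) (k i + C)).card = 2 * C + 1 := fun i => by
    rw [Int.card_Icc]
    omega
  simp [nearIndices, Fintype.card_piFinset, this]

lemma mem_meshCube_meshCell {n : ℕ} {δ : ℝ} (hδ : 0 < δ) (x : Fin n → ℝ) :
    x ∈ meshCube δ (meshCell δ x) := fun _ =>
  ⟨(le_div_iff₀ hδ).1 (Int.floor_le _), ((div_lt_iff₀ hδ).1 (Int.lt_floor_add_one _)).le⟩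

lemma measurableSet_meshCube {n : ℕ} (δ : ℝ) (k : Fin n → ℤ) : MeasurableSet (meshCube δ k) := by
  have : meshCube δ k = Set.univ.pi fun i => Set.Icc ((k i : ℝ) * δ) (((k i : ℝ) + 1) * δ) := by
    ext x
    simp only [meshCube, Set.mem_ofPred_eq, Set.mem_univ_pi, Set.mem_Icc]
  rw [this]
  exact MeasurableSet.univ_pi fun _ => measurableSet_Icc

lemma dist_le_of_mem_meshCube {n : ℕ} {δ : ℝ} (hδ : 0 < δ) {k : Fin n → ℤ} {x y : Fin n → ℝ}
    (hx : x ∈ meshCube δ k) (hy : y ∈ meshCube δ k) : dist x y ≤ δ := by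
  refine (dist_pi_le_iff hδ.le).2 fun i => ?_
  rw [Real.dist_eq, abs_le]
  constructor <;> linarith [(hx i).1, (hx i).2, (hy i).1, (hy i).2]

/-- The extra `1` in `C + 1` accounts for the unknown positions of the two points inside their
closed cubes. -/
lemma mem_nearIndices_of_dist_le {n C : ℕ} {δ : ℝ} (hδ : 0 < δ) {k l : Fin n → ℤ}
    {x y : Fin n → ℝ} (hx : x ∈ meshCube δ k) (hy : y ∈ meshCube δ l) (h : dist x y ≤ C * δ) :
    l ∈ nearIndices (C + 1) k := by
  rw [mem_nearIndices]
  intro i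
  have h1 := (abs_le.1 ((Real.dist_eq _ _).symm.trans_le ((dist_le_pi_dist x y i).trans h)))
  have h2 := hx i
  have h3 := hy i
  constructor
  · have : (k i : ℝ) * δ ≤ (l i + 1 + C) * δ := by linarith
    have := le_of_mul_le_mul_right this hδ
    have : k i ≤ l i + 1 + C := by exact_mod_cast this
    push_cast
    omega
  · have : (l i : ℝ) * δ ≤ (k i + 1 + C) * δ := by linarith
    have := le_of_mul_le_mul_right this hδ
    have : l i ≤ k i + 1 + C := by exact_mod_cast this
    push_cast
    omega

/-! ### Moments of the image of a measure -/

/-- The sum `∑_Q μ(F⁻¹ Q)^q` over the closed cubes of the `δ`-mesh, as an extended non-negative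
real. -/
noncomputable def mom {Ω : Type*} [MeasurableSpace Ω] {n : ℕ} (q : ℝ) (μ : Measure Ω)
    (F : Ω → Fin n → ℝ) (δ : ℝ) : ℝ≥0∞ :=
  ∑' k : Fin n → ℤ, qpow q (μ (F ⁻¹' meshCube δ k))

/-- The constant in the comparison of moments. -/
noncomputable def momConst (q : ℝ) (C n m : ℕ) : ℝ≥0∞ :=
  (((2 * (C + 1) + 1) ^ m : ℕ) : ℝ≥0∞) ^ q * ((2 * (C + 1) + 1) ^ n : ℕ)

lemma momConst_ne_top {q : ℝ} (hq : 0 ≤ q) (C n m : ℕ) : momConst q C n m ≠ ∞ :=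
  ENNReal.mul_ne_top (ENNReal.rpow_ne_top_of_nonneg hq (ENNReal.natCast_ne_top _))
    (ENNReal.natCast_ne_top _)

section mom

variable {Ω : Type*} [MeasurableSpace Ω] {n m : ℕ} {q : ℝ} {μ : Measure Ω}

lemma meshMoment_map [IsFiniteMeasure μ] (hq : 0 ≤ q) {F : Ω → Fin n → ℝ} (hF : Measurable F)
    (δ : ℝ) : meshMoment (μ.map F) q δ = (mom q μ F δ).toReal := by
  rw [mom, ENNReal.tsum_toReal_eq fun k => qpow_ne_top hq (measure_ne_top _ _)]
  refine tsum_congr fun k => ?_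
  rw [Measure.map_apply hF (measurableSet_meshCube _ _)]
  split_ifs with h
  · simp [h]
  · rw [qpow_of_ne_zero h, ENNReal.toReal_rpow]

/-- The moments of the images of `μ` under maps `F` and `F'` are comparable if sets of `F`-size
`δ` have `F'`-size at most `C δ'` and conversely. -/
lemma mom_le_of_dist_le (hq : 0 ≤ q) {K : Set Ω} (hK : μ Kᶜ = 0) {F : Ω → Fin n → ℝ}
    {F' : Ω → Fin m → ℝ} {δ δ' : ℝ} (hδ : 0 < δ) (hδ' : 0 < δ') {C : ℕ}
    (h : ∀ x ∈ K, ∀ y ∈ K, dist (F x) (F y) ≤ δ → dist (F' x) (F' y) ≤ C * δ')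
    (h' : ∀ x ∈ K, ∀ y ∈ K, dist (F' x) (F' y) ≤ δ' → dist (F x) (F y) ≤ C * δ) :
    mom q μ F δ ≤ momConst q C n m * mom q μ F' δ' := by
  classical
  refine tsum_qpow_le_of_rel hq
    (fun k l => ∃ x ∈ K, F x ∈ meshCube δ k ∧ F' x ∈ meshCube δ' l) ?_ ?_ ?_
  · intro k
    -- One point of `K` over the cube serves as a reference: every related cube lies near the cell
    -- of its image under `F'`.
    by_cases hk : ∃ x ∈ K, F x ∈ meshCube δ k
    · obtain ⟨x, hxK, hx⟩ := hk
      refine ⟨nearIndices (C + 1) (meshCell δ' (F' x)), (card_nearIndices _ _).le, ?_⟩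
      rintro l ⟨y, hyK, hy, hyl⟩
      exact mem_nearIndices_of_dist_le hδ' (mem_meshCube_meshCell hδ' _) hyl
        (h x hxK y hyK (dist_le_of_mem_meshCube hδ hx hy))
    · exact ⟨∅, by simp, fun l ⟨y, hyK, hy, _⟩ => (hk ⟨y, hyK, hy⟩).elim⟩
  · intro l
    by_cases hl : ∃ x ∈ K, F' x ∈ meshCube δ' l
    · obtain ⟨x, hxK, hx⟩ := hl
      refine ⟨nearIndices (C + 1) (meshCell δ (F x)), (card_nearIndices _ _).le, ?_⟩
      rintro k ⟨y, hyK, hyk, hy⟩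
      exact mem_nearIndices_of_dist_le hδ (mem_meshCube_meshCell hδ _) hyk
        (h' x hxK y hyK (dist_le_of_mem_meshCube hδ' hx hy))
    · exact ⟨∅, by simp, fun k ⟨y, hyK, _, hy⟩ => (hl ⟨y, hyK, hy⟩).elim⟩
  · intro k
    set R : (Fin m → ℤ) → Prop := fun l => ∃ x ∈ K, F x ∈ meshCube δ k ∧ F' x ∈ meshCube δ' l
    calc μ (F ⁻¹' meshCube δ k)
        ≤ μ (Kᶜ ∪ ⋃ l, if R l then F' ⁻¹' meshCube δ' l else ∅) := by
          refine measure_mono fun x hx => ?_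
          by_cases hxK : x ∈ K
          · refine Or.inr (Set.mem_iUnion.2 ⟨meshCell δ' (F' x), ?_⟩)
            have := mem_meshCube_meshCell hδ' (F' x)
            rw [if_pos ⟨x, hxK, hx, this⟩]
            exact this
          · exact Or.inl hxK
      _ ≤ μ Kᶜ + ∑' l, μ (if R l then F' ⁻¹' meshCube δ' l else ∅) :=
          (measure_union_le _ _).trans (by gcongr; exact measure_iUnion_le _)
      _ = _ := by
          rw [hK, zero_add]
          refine tsum_congr fun l => ?_
          split_ifs <;> simp

lemma mom_ne_zero [IsProbabilityMeasure μ] (hq : 0 ≤ q) (F : Ω → Fin n → ℝ) {δ : ℝ}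
    (hδ : 0 < δ) : mom q μ F δ ≠ 0 := by
  intro h
  rw [mom, ENNReal.tsum_eq_zero] at h
  have h0 : ∀ k : Fin n → ℤ, μ (F ⁻¹' meshCube δ k) = 0 := fun k =>
    by_contra fun hk => qpow_ne_zero hq hk (h k)
  have h1 : μ Set.univ = 0 := by
    refine measure_mono_null (fun x _ => ?_) (measure_iUnion_null h0)
    exact Set.mem_iUnion.2 ⟨_, mem_meshCube_meshCell hδ (F x)⟩
  simp at h1

lemma mom_ne_top [IsFiniteMeasure μ] (hq : 0 ≤ q) {K : Set Ω} (hK : μ Kᶜ = 0)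
    {F : Ω → Fin n → ℝ} {δ : ℝ} (hδ : 0 < δ) {B : ℝ}
    (hB : ∀ x ∈ K, ∀ y ∈ K, dist (F x) (F y) ≤ B) : mom q μ F δ ≠ ∞ := by
  rcases K.eq_empty_or_nonempty with rfl | ⟨x, hx⟩
  · have h0 : ∀ s, μ s = 0 := fun s => measure_mono_null (by simp) hK
    simp [mom, h0]
  obtain ⟨C, hC⟩ := exists_nat_ge (B / δ)
  rw [mom, tsum_eq_sum_of_support (T := nearIndices (C + 1) (meshCell δ (F x)))]
  · exact ENNReal.sum_ne_top.2 fun k _ => qpow_ne_top hq (measure_ne_top _ _)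
  · intro k hk
    have : μ (F ⁻¹' meshCube δ k) ≠ 0 := fun h => hk (by simp [h])
    have h2 : ∃ y ∈ K, F y ∈ meshCube δ k := by
      by_contra! h3
      exact this (measure_mono_null (fun y hy hyK => h3 y hyK hy) hK)
    obtain ⟨y, hyK, hy⟩ := h2
    exact mem_nearIndices_of_dist_le hδ (mem_meshCube_meshCell hδ _) hy
      ((hB x hx y hyK).trans ((div_le_iff₀ hδ).1 hC))

/-- Comparison of the moments at two scales of bounded ratio. -/
lemma mom_le_of_scale (hq : 0 ≤ q) (F : Ω → Fin n → ℝ) {δ δ' : ℝ} (hδ : 0 < δ) (hδ' : 0 < δ')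
    {C : ℕ} (h : δ ≤ C * δ') (h' : δ' ≤ C * δ) :
    mom q μ F δ ≤ momConst q C n n * mom q μ F δ' :=
  mom_le_of_dist_le hq (K := Set.univ) (by simp) hδ hδ' (fun _ _ _ _ hd => hd.trans h)
    (fun _ _ _ _ hd => hd.trans h')

end mom

/-! ### Limits -/

lemma hasLqSpectrum_of_tendsto {n : ℕ} {ν : Measure (Fin n → ℝ)} {q τ : ℝ}
    (h : Tendsto (fun δ : ℝ => Real.log (meshMoment ν q δ) / (-Real.log δ)) (𝓝[>] 0) (𝓝 τ)) :
    HasLqSpectrum ν q τ := by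
  have h' := (continuous_coe_real_ereal.tendsto τ).comp h
  exact ⟨h'.liminf_eq, h'.limsup_eq⟩

lemma lqSpectrum_eq_of_tendsto {n : ℕ} {ν : Measure (Fin n → ℝ)} {q τ : ℝ}
    (h : Tendsto (fun δ : ℝ => Real.log (meshMoment ν q δ) / (-Real.log δ)) (𝓝[>] 0) (𝓝 τ)) :
    lqSpectrum ν q = τ := by
  rw [lqSpectrum, (hasLqSpectrum_of_tendsto h).2, EReal.toReal_coe]

/-- Fekete's lemma for sequences that are subadditive or superadditive up to a constant. -/
lemma exists_tendsto_div_of_almost_additive {x : ℕ → ℝ} {C : ℝ}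
    (hstep : ∀ n, |x (n + 1) - x n| ≤ C)
    (h : (∀ m n, x (m + n) ≤ x m + x n + C) ∨ ∀ m n, x m + x n - C ≤ x (m + n)) :
    ∃ L, Tendsto (fun n : ℕ => x n / n) atTop (𝓝 L) := by
  have hC : 0 ≤ C := (abs_nonneg _).trans (hstep 0)
  have key : ∀ y : ℕ → ℝ, (∀ n, |y (n + 1) - y n| ≤ C) → (∀ m n, y (m + n) ≤ y m + y n + C) →
      ∃ L, Tendsto (fun n : ℕ => y n / n) atTop (𝓝 L) := by
    intro y hs hy
    -- Adding the constant to the sequence absorbs the error and gives exact subadditivity; after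
    -- division by `n` the shift disappears.
    have hsub : Subadditive fun n => y n + C := fun m n => by linarith [hy m n]
    -- Bounded increments keep `y n / n` bounded below, so the limit is finite.
    have hlow : ∀ n : ℕ, y 0 - n * C ≤ y n := by
      intro n
      induction n with
      | zero => simp
      | succ n ih =>
        push_cast
        linarith [(abs_le.1 (hs n)).1]
    have hbdd : BddBelow (Set.range fun n : ℕ => (y n + C) / n) := by
      refine ⟨-|y 0| - C, ?_⟩
      rintro _ ⟨n, rfl⟩
      rcases n.eq_zero_or_pos with rfl | hn
      · simp only [Nat.cast_zero, div_zero]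
        linarith [abs_nonneg (y 0)]
      · have h1 : (1 : ℝ) ≤ n := by exact_mod_cast hn
        dsimp only
        rw [le_div_iff₀ (by linarith)]
        have h2 := hlow n
        have h3 : |y 0| ≤ |y 0| * n := le_mul_of_one_le_right (abs_nonneg _) h1
        linarith [neg_abs_le (y 0)]
    refine ⟨hsub.lim - 0, ?_⟩
    have h1 := (hsub.tendsto_lim hbdd).sub (tendsto_const_div_atTop_nhds_zero_nat C)
    refine h1.congr fun n => ?_
    ring
  rcases h with h | h
  · exact key x hstep h
  · obtain ⟨L, hL⟩ := key (fun n => -x n)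
      (fun n => by rw [← abs_neg]; convert hstep n using 2; ring)
      (fun m n => by linarith [h m n])
    refine ⟨-L, hL.neg.congr fun n => ?_⟩
    ring

/-- A positive function of the scale that changes by a bounded factor between scales of bounded
ratio. -/
def ScaleRegular (D : ℝ → ℝ) : Prop :=
  (∀ δ, 0 < δ → 0 < D δ) ∧
    ∀ C : ℕ, ∃ B : ℝ, ∀ δ δ' : ℝ, 0 < δ → 0 < δ' → δ ≤ C * δ' → δ' ≤ C * δ → D δ ≤ B * D δ'

lemma tendsto_neg_log_nhdsGT_zero : Tendsto (fun δ : ℝ => -Real.log δ) (𝓝[>] 0) atTop :=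
  tendsto_neg_atBot_atTop.comp Real.tendsto_log_nhdsGT_zero

lemma ScaleRegular.exists_abs_log_sub_le {D : ℝ → ℝ} (hD : ScaleRegular D) (C : ℕ) :
    ∃ B : ℝ, ∀ δ δ' : ℝ, 0 < δ → 0 < δ' → δ ≤ C * δ' → δ' ≤ C * δ →
      |Real.log (D δ) - Real.log (D δ')| ≤ B := by
  obtain ⟨B, hB⟩ := hD.2 C
  have key : ∀ δ δ' : ℝ, 0 < δ → 0 < δ' → δ ≤ C * δ' → δ' ≤ C * δ →
      Real.log (D δ) - Real.log (D δ') ≤ Real.log B := by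
    intro δ δ' h h' h1 h2
    have h3 := hB δ δ' h h' h1 h2
    have hp := hD.1 δ h
    have hp' := hD.1 δ' h'
    have hB0 : 0 < B := pos_of_mul_pos_left (hp.trans_le h3) hp'.le
    have := Real.log_le_log hp h3
    rw [Real.log_mul hB0.ne' hp'.ne'] at this
    linarith
  refine ⟨Real.log B, fun δ δ' h h' h1 h2 => abs_le.2 ⟨?_, key δ δ' h h' h1 h2⟩⟩
  linarith [key δ' δ h' h h2 h1]

/-- With `X δ = log₂ (1 / δ)`, a scale `δ < 1` is within a factor `2` of `(1 / 2) ^ ⌊X δ⌋₊`. The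
logarithms of `D` at the two scales differ by a bounded amount, and `⌊X δ⌋₊ / X δ` tends to `1`. -/
lemma ScaleRegular.tendsto_of_dyadic {D : ℝ → ℝ} (hD : ScaleRegular D) {L : ℝ}
    (h : Tendsto (fun n : ℕ => Real.log (D ((1 / 2) ^ n)) / n) atTop (𝓝 L)) :
    Tendsto (fun δ : ℝ => Real.log (D δ) / (-Real.log δ)) (𝓝[>] 0) (𝓝 (L / Real.log 2)) := by
  obtain ⟨B, hB⟩ := hD.exists_abs_log_sub_le 2
  have hl2 : 0 < Real.log 2 := Real.log_pos (by norm_num)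
  set X : ℝ → ℝ := fun δ => -Real.log δ / Real.log 2 with hX
  have hXlim : Tendsto X (𝓝[>] 0) atTop := tendsto_neg_log_nhdsGT_zero.atTop_div_const hl2
  have hfl : Tendsto (fun δ => ⌊X δ⌋₊) (𝓝[>] 0) atTop := tendsto_nat_floor_atTop.comp hXlim
  have hrat : Tendsto (fun δ => (⌊X δ⌋₊ : ℝ) / X δ) (𝓝[>] 0) (𝓝 1) :=
    (tendsto_nat_floor_div_atTop (R := ℝ)).comp hXlim
  have hmain : Tendsto (fun δ => Real.log (D ((1 / 2) ^ ⌊X δ⌋₊)) / (⌊X δ⌋₊ : ℝ) *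
      ((⌊X δ⌋₊ : ℝ) / X δ) / Real.log 2) (𝓝[>] 0) (𝓝 (L * 1 / Real.log 2)) :=
    ((h.comp hfl).mul hrat).div_const _
  have herr : Tendsto (fun δ => (Real.log (D δ) - Real.log (D ((1 / 2) ^ ⌊X δ⌋₊))) /
      (-Real.log δ)) (𝓝[>] 0) (𝓝 0) := by
    refine squeeze_zero_norm' ?_ (tendsto_neg_log_nhdsGT_zero.const_div_atTop B)
    filter_upwards [Ioo_mem_nhdsGT (zero_lt_one : (0 : ℝ) < 1)] with δ hδ
    have hlog : 0 < -Real.log δ := by linarith [Real.log_neg hδ.1 hδ.2]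
    have hXpos : 0 ≤ X δ := (div_pos hlog hl2).le
    rw [Real.norm_eq_abs, abs_div, abs_of_pos hlog]
    have hlogpow : Real.log ((1 / 2 : ℝ) ^ ⌊X δ⌋₊) = -(⌊X δ⌋₊ * Real.log 2) := by
      rw [Real.log_pow, one_div, Real.log_inv]
      ring
    have hXmul : X δ * Real.log 2 = -Real.log δ := div_mul_cancel₀ _ hl2.ne'
    have hfloor1 := mul_le_mul_of_nonneg_right (Nat.floor_le hXpos) hl2.le
    have hfloor2 := mul_le_mul_of_nonneg_right (Nat.lt_floor_add_one (X δ)).le hl2.le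
    gcongr
    refine hB _ _ hδ.1 (by positivity) ?_ ?_
    · have : Real.log δ ≤ Real.log ((1 / 2 : ℝ) ^ ⌊X δ⌋₊) := by rw [hlogpow]; linarith
      have := (Real.log_le_log_iff hδ.1 (by positivity)).1 this
      have h0 : (0 : ℝ) < (1 / 2) ^ ⌊X δ⌋₊ := by positivity
      push_cast
      linarith
    · rw [← Real.log_le_log_iff (by positivity) (by have := hδ.1; positivity), hlogpow]
      push_cast
      rw [Real.log_mul (by norm_num) hδ.1.ne']
      linarith
  have hsum := hmain.add herr
  rw [mul_one, add_zero] at hsum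
  refine hsum.congr' ?_
  filter_upwards [Ioo_mem_nhdsGT (zero_lt_one : (0 : ℝ) < 1),
    hfl.eventually_gt_atTop 0] with δ hδ hn
  have hlog : 0 < -Real.log δ := by linarith [Real.log_neg hδ.1 hδ.2]
  have hn' : (⌊X δ⌋₊ : ℝ) ≠ 0 := by exact_mod_cast hn.ne'
  have hXmul : X δ * Real.log 2 = -Real.log δ := div_mul_cancel₀ _ hl2.ne'
  have hX0 : X δ ≠ 0 := (div_pos hlog hl2).ne'
  rw [div_mul_div_cancel₀ hn', div_div, hXmul, ← add_div]
  congr 1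
  ring

/-- The limit controls `δ < δ₀` only; on `[δ₀, 1]` regularity compares `D δ` with `D 1`. A bound on
all of `(0, 1]` is needed since the ratios α₂/α₁ at which the projections are evaluated need not be
small. -/
lemma ScaleRegular.exists_abs_log_add_le {D : ℝ → ℝ} (hD : ScaleRegular D) {τ : ℝ}
    (h : Tendsto (fun δ : ℝ => Real.log (D δ) / (-Real.log δ)) (𝓝[>] 0) (𝓝 τ)) {η : ℝ}
    (hη : 0 < η) : ∃ c : ℝ, ∀ δ, 0 < δ → δ ≤ 1 →
      |Real.log (D δ) + τ * Real.log δ| ≤ c + η * (-Real.log δ) := by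
  have h1 := (Metric.tendsto_nhds.1 h η hη).and (Ioo_mem_nhdsGT (zero_lt_one : (0 : ℝ) < 1))
  obtain ⟨δ₀, hδ₀, hsub⟩ := (mem_nhdsGT_iff_exists_Ioo_subset).1 h1
  have hδ₀ : 0 < δ₀ := hδ₀
  obtain ⟨C, hC⟩ := exists_nat_ge (max 1 (1 / δ₀))
  have hC1 : (1 : ℝ) ≤ C := (le_max_left _ _).trans hC
  have hC2 : 1 ≤ C * δ₀ := (div_le_iff₀ hδ₀).1 ((le_max_right _ _).trans hC)
  obtain ⟨B, hB⟩ := hD.exists_abs_log_sub_le C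
  have hB0 : 0 ≤ B := (abs_nonneg _).trans (hB 1 1 one_pos one_pos (by linarith) (by linarith))
  refine ⟨B + |Real.log (D 1)| + |τ| * |Real.log δ₀|, fun δ hδ hδ1 => ?_⟩
  have hlog : 0 ≤ -Real.log δ := by linarith [Real.log_nonpos hδ.le hδ1]
  rcases lt_or_ge δ δ₀ with hlt | hge
  · obtain ⟨h2, h3⟩ := hsub ⟨hδ, hlt⟩
    have hlog' : 0 < -Real.log δ := by linarith [Real.log_neg hδ h3.2]
    have h4 : Real.log (D δ) + τ * Real.log δ =
        (Real.log (D δ) / (-Real.log δ) - τ) * (-Real.log δ) := by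
      rw [sub_mul, div_mul_cancel₀ _ hlog'.ne']
      ring
    rw [h4, abs_mul, abs_of_pos hlog', ← Real.dist_eq]
    have := mul_le_mul_of_nonneg_right h2.le hlog
    have : 0 ≤ B + |Real.log (D 1)| + |τ| * |Real.log δ₀| := by positivity
    linarith
  · have h2 := hB δ 1 hδ one_pos (by linarith) (by nlinarith)
    have h3 : |Real.log δ| ≤ |Real.log δ₀| := by
      have := Real.log_le_log hδ₀ hge
      rw [abs_of_nonpos (by linarith), abs_of_nonpos (by linarith)]
      linarith
    have h4 : |τ * Real.log δ| ≤ |τ| * |Real.log δ₀| := by rw [abs_mul]; gcongr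
    have h5 := abs_add_le (Real.log (D δ)) (τ * Real.log δ)
    have h6 := abs_sub_abs_le_abs_sub (Real.log (D δ)) (Real.log (D 1))
    have := mul_nonneg hη.le hlog
    linarith

lemma tendsto_log_div_of_abs_le {D : ℝ → ℝ} {τ : ℝ}
    (h : ∀ η > 0, ∃ c : ℝ, ∀ δ, 0 < δ → δ ≤ 1 →
      |Real.log (D δ) + τ * Real.log δ| ≤ c + η * (-Real.log δ)) :
    Tendsto (fun δ : ℝ => Real.log (D δ) / (-Real.log δ)) (𝓝[>] 0) (𝓝 τ) := by
  refine Metric.tendsto_nhds.2 fun η hη => ?_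
  obtain ⟨c, hc⟩ := h (η / 2) (by linarith)
  filter_upwards [Ioo_mem_nhdsGT (zero_lt_one : (0 : ℝ) < 1),
    tendsto_neg_log_nhdsGT_zero.eventually_gt_atTop (2 * c / η)] with δ hδ hbig
  have hlog' : 0 < -Real.log δ := by linarith [Real.log_neg hδ.1 hδ.2]
  have h4 : Real.log (D δ) / (-Real.log δ) - τ =
      (Real.log (D δ) + τ * Real.log δ) / (-Real.log δ) := by
    rw [eq_div_iff hlog'.ne', sub_mul, div_mul_cancel₀ _ hlog'.ne']
    ring
  rw [Real.dist_eq, h4, abs_div, abs_of_pos hlog', div_lt_iff₀ hlog']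
  have := hc δ hδ.1 hδ.2.le
  rw [div_lt_iff₀ hη] at hbig
  linarith

namespace BoxLikeGIFS

variable {V E : Type*} (G : BoxLikeGIFS V E)

/-! ### Words and paths -/

/-- The terminal vertex of a word that starts at `v`. -/
def finish : V → List E → V
  | v, [] => v
  | _, e :: w => finish (G.tgt e) w

/-- The word `w` is admissible and starts at `v`. -/
def Adm : V → List E → Prop
  | _, [] => True
  | v, e :: w => G.src e = v ∧ Adm (G.tgt e) w

lemma isPath_iff {v v' : V} {w : List E} : G.IsPath v w v' ↔ G.Adm v w ∧ G.finish v w = v' := by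
  induction w generalizing v with
  | nil => simp [IsPath, Adm, finish]
  | cons e w ih => simp [IsPath, Adm, finish, ih, and_assoc]

@[simp] lemma finish_nil (v : V) : G.finish v [] = v := rfl

@[simp] lemma adm_nil (v : V) : G.Adm v [] := trivial

lemma finish_append (v : V) (u w : List E) :
    G.finish v (u ++ w) = G.finish (G.finish v u) w := by
  induction u generalizing v with
  | nil => rfl
  | cons e u ih => exact ih _

lemma adm_append {v : V} {u w : List E} :
    G.Adm v (u ++ w) ↔ G.Adm v u ∧ G.Adm (G.finish v u) w := by
  induction u generalizing v with
  | nil => simp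
  | cons e u ih => simp [Adm, finish, ih, and_assoc]

lemma adm_singleton {v : V} {e : E} : G.Adm v [e] ↔ G.src e = v := by simp [Adm]

@[simp] lemma finish_singleton (v : V) (e : E) : G.finish v [e] = G.tgt e := rfl

section Fintype

variable [Fintype E]

open Classical in
/-- The edges that start at `v`. -/
noncomputable def outEdges (v : V) : Finset E := {e | G.src e = v}

@[simp] lemma mem_outEdges {v : V} {e : E} : e ∈ G.outEdges v ↔ G.src e = v := by
  simp [outEdges]

open Classical in
/-- The admissible words of length `n` that start at `v`. -/
noncomputable def paths (n : ℕ) (v : V) : Finset (List E) :=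
  {w ∈ (List.finite_length_eq E n).toFinset | G.Adm v w}

@[simp] lemma mem_paths {n : ℕ} {v : V} {w : List E} :
    w ∈ G.paths n v ↔ w.length = n ∧ G.Adm v w := by
  simp [paths]

lemma paths_zero (v : V) : G.paths 0 v = {[]} := by
  ext w
  simp only [mem_paths, List.length_eq_zero_iff, Finset.mem_singleton]
  exact ⟨fun h => h.1, fun h => ⟨h, h ▸ G.adm_nil v⟩⟩

lemma sum_paths_add {M : Type*} [AddCommMonoid M] (m n : ℕ) (v : V) (f : List E → M) :
    ∑ w ∈ G.paths (m + n) v, f w =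
      ∑ u ∈ G.paths m v, ∑ w ∈ G.paths n (G.finish v u), f (u ++ w) := by
  rw [Finset.sum_sigma']
  symm
  refine Finset.sum_bij' (fun x _ => x.1 ++ x.2) (fun w _ => ⟨w.take m, w.drop m⟩) ?_ ?_ ?_ ?_ ?_
  · rintro ⟨u, w⟩ h
    simp only [Finset.mem_sigma, mem_paths] at h
    simp [h, adm_append]
  · intro w h
    simp only [mem_paths] at h
    have h2 := h.2
    rw [← List.take_append_drop m w, adm_append] at h2
    simp [h, h2]
  · rintro ⟨u, w⟩ h
    simp only [Finset.mem_sigma, mem_paths] at h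
    simp [← h.1.1]
  · intro w _
    exact List.take_append_drop m w
  · intro _ _
    rfl

lemma sum_paths_one {M : Type*} [AddCommMonoid M] (v : V) (f : List E → M) :
    ∑ w ∈ G.paths 1 v, f w = ∑ e ∈ G.outEdges v, f [e] := by
  symm
  refine Finset.sum_bij (fun e _ => [e]) ?_ ?_ ?_ ?_
  · intro e he
    simpa [Adm] using he
  · simp
  · intro w hw
    rw [mem_paths, List.length_eq_one_iff] at hw
    obtain ⟨⟨e, rfl⟩, h⟩ := hw
    exact ⟨e, by simpa [Adm] using h, rfl⟩
  · intro _ _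
    rfl

lemma sum_paths_succ {M : Type*} [AddCommMonoid M] (n : ℕ) (v : V) (f : List E → M) :
    ∑ w ∈ G.paths (n + 1) v, f w =
      ∑ u ∈ G.paths n v, ∑ e ∈ G.outEdges (G.finish v u), f (u ++ [e]) := by
  rw [sum_paths_add]
  exact Finset.sum_congr rfl fun u _ => G.sum_paths_one _ _

lemma sum_paths_succ' {M : Type*} [AddCommMonoid M] (n : ℕ) (v : V) (f : List E → M) :
    ∑ w ∈ G.paths (n + 1) v, f w =
      ∑ e ∈ G.outEdges v, ∑ w ∈ G.paths n (G.tgt e), f (e :: w) := by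
  rw [add_comm, sum_paths_add, sum_paths_one]
  rfl

end Fintype

/-! ### Stopping words -/

/-- A function of words that is `1` at the empty word and decreases by a factor in `[a, b]` with
every letter. -/
structure IsScale (ρ : List E → ℝ) (a b : ℝ) : Prop where
  nil : ρ [] = 1
  pos : 0 < a
  lt_one : b < 1
  le_snoc : ∀ u e, a * ρ u ≤ ρ (u ++ [e])
  snoc_le : ∀ u e, ρ (u ++ [e]) ≤ b * ρ u

/-- `w` is a word from `v` at which `ρ` falls below `δ` for the first time. -/
def IsStop (ρ : List E → ℝ) (δ : ℝ) (v : V) (w : List E) : Prop :=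
  G.Adm v w ∧ ρ w < δ ∧ δ ≤ ρ w.dropLast

/-- `w` is a word from `v` with `δ ≤ ρ w`. -/
def IsLive (ρ : List E → ℝ) (δ : ℝ) (v : V) (w : List E) : Prop :=
  G.Adm v w ∧ δ ≤ ρ w

namespace IsScale

variable {G} {ρ : List E → ℝ} {a b : ℝ}

lemma rho_pos (hρ : IsScale ρ a b) (w : List E) : 0 < ρ w := by
  induction w using List.reverseRecOn with
  | nil => simp [hρ.nil]
  | append_singleton u e ih => exact (mul_pos hρ.pos ih).trans_le (hρ.le_snoc u e)

lemma b_nonneg (hρ : IsScale ρ a b) [Nonempty E] : 0 < b := by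
  obtain ⟨e⟩ := ‹Nonempty E›
  have h := hρ.snoc_le [] e
  rw [hρ.nil, mul_one] at h
  exact (hρ.rho_pos _).trans_le h

lemma snoc_lt (hρ : IsScale ρ a b) (u : List E) (e : E) : ρ (u ++ [e]) < ρ u :=
  (hρ.snoc_le u e).trans_lt (mul_lt_of_lt_one_left (hρ.rho_pos u) hρ.lt_one)

lemma le_pow (hρ : IsScale ρ a b) [Nonempty E] (w : List E) : ρ w ≤ b ^ w.length := by
  induction w using List.reverseRecOn with
  | nil => simp [hρ.nil]
  | append_singleton u e ih =>
    rw [List.length_append, List.length_singleton, pow_succ']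
    exact (hρ.snoc_le u e).trans (mul_le_mul_of_nonneg_left ih hρ.b_nonneg.le)

lemma pow_le (hρ : IsScale ρ a b) (w : List E) : a ^ w.length ≤ ρ w := by
  induction w using List.reverseRecOn with
  | nil => simp [hρ.nil]
  | append_singleton u e ih =>
    rw [List.length_append, List.length_singleton, pow_succ']
    exact (mul_le_mul_of_nonneg_left ih hρ.pos.le).trans (hρ.le_snoc u e)

lemma exists_length_bound (hρ : IsScale ρ a b) [Nonempty E] {δ : ℝ} (hδ : 0 < δ) :
    ∃ N : ℕ, ∀ u : List E, δ ≤ ρ u → u.length < N := by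
  obtain ⟨N, hN⟩ := exists_pow_lt_of_lt_one hδ hρ.lt_one
  refine ⟨N, fun u hu => lt_of_not_ge fun h => ?_⟩
  have := pow_le_pow_of_le_one hρ.b_nonneg.le hρ.lt_one.le h
  linarith [hρ.le_pow u]

lemma finite_live (hρ : IsScale ρ a b) [Finite E] [Nonempty E] {δ : ℝ} (hδ : 0 < δ) (v : V) :
    {w | G.IsLive ρ δ v w}.Finite := by
  obtain ⟨N, hN⟩ := hρ.exists_length_bound hδ
  exact (List.finite_length_lt E N).subset fun w hw => hN w hw.2

lemma finite_stopSet (hρ : IsScale ρ a b) [Finite E] [Nonempty E] {δ : ℝ} (hδ : 0 < δ) (v : V) :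
    {w | G.IsStop ρ δ v w}.Finite := by
  obtain ⟨N, hN⟩ := hρ.exists_length_bound hδ
  refine (List.finite_length_le E N).subset fun w hw => ?_
  have := hN _ hw.2.2
  rw [List.length_dropLast] at this
  simp only [Set.mem_ofPred_eq]
  omega

lemma le_of_isStop (hρ : IsScale ρ a b) {δ : ℝ} {v : V} {w : List E} (hδ1 : δ ≤ 1)
    (h : G.IsStop ρ δ v w) :
    a * δ ≤ ρ w := by
  induction w using List.reverseRecOn with
  | nil =>
    have := h.2.1
    rw [hρ.nil] at this
    linarith
  | append_singleton u e _ =>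
    have h2 := h.2.2
    rw [List.dropLast_concat] at h2
    exact (mul_le_mul_of_nonneg_left h2 hρ.pos.le).trans (hρ.le_snoc u e)

/-- The finite set of words from `v` at which `ρ` falls below `δ`. -/
noncomputable def stopSet (hρ : IsScale ρ a b) [Finite E] [Nonempty E] {δ : ℝ} (hδ : 0 < δ)
    (v : V) : Finset (List E) :=
  (hρ.finite_stopSet (G := G) hδ v).toFinset

variable [Fintype E] [Nonempty E] {δ : ℝ}

lemma mem_stopSet (hρ : IsScale ρ a b) (hδ : 0 < δ) (v : V) {w : List E} :
    w ∈ hρ.stopSet (G := G) hδ v ↔ G.IsStop ρ δ v w := by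
  simp [stopSet]

/-- Since `ρ` strictly decreases, the one-letter admissible extensions of live words are exactly the
non-empty live words and the stopping words, each obtained once. The empty word is live because `δ ≤
1`. -/
lemma sum_live_add (hρ : IsScale ρ a b) (hδ : 0 < δ) (v : V) {M : Type*} [AddCommMonoid M]
    (hδ1 : δ ≤ 1) (f : List E → M) :
    f [] + ∑ u ∈ (hρ.finite_live (G := G) hδ v).toFinset, ∑ e ∈ G.outEdges (G.finish v u),
      f (u ++ [e]) =
    ∑ u ∈ (hρ.finite_live (G := G) hδ v).toFinset, f u + ∑ w ∈ hρ.stopSet (G := G) hδ v, f w := by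
  classical
  set L := (hρ.finite_live (G := G) hδ v).toFinset with hL
  have hmem : ∀ u, u ∈ L ↔ G.IsLive ρ δ v u := fun u => by simp [hL]
  have hdisj : Disjoint (L.erase []) (hρ.stopSet (G := G) hδ v) := by
    rw [Finset.disjoint_left]
    intro w hw hs
    rw [mem_stopSet] at hs
    have := (hmem w).1 (Finset.mem_of_mem_erase hw)
    linarith [this.2, hs.2.1]
  have hnil : [] ∈ L := (hmem _).2 ⟨trivial, by rw [hρ.nil]; exact hδ1⟩
  rw [← Finset.add_sum_erase L f hnil, add_assoc, ← Finset.sum_union hdisj]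
  congr 1
  rw [Finset.sum_sigma']
  refine Finset.sum_bij (fun x _ => x.1 ++ [x.2]) ?_ ?_ ?_ ?_
  · rintro ⟨u, e⟩ h
    simp only [Finset.mem_sigma, hmem, mem_outEdges] at h
    have hadm : G.Adm v (u ++ [e]) := by
      rw [adm_append, adm_singleton]
      exact ⟨h.1.1, h.2⟩
    rw [Finset.mem_union, Finset.mem_erase, hmem, mem_stopSet]
    rcases le_or_gt δ (ρ (u ++ [e])) with h1 | h1
    · exact Or.inl ⟨by simp, hadm, h1⟩
    · exact Or.inr ⟨hadm, h1, by simpa using h.1.2⟩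
  · rintro ⟨u, e⟩ _ ⟨u', e'⟩ _ h
    have := List.append_inj' h rfl
    simp only [List.cons.injEq, and_true] at this
    rw [this.1, this.2]
  · intro w hw
    rw [Finset.mem_union, Finset.mem_erase, hmem, mem_stopSet] at hw
    induction w using List.reverseRecOn with
    | nil =>
      rcases hw with hw | hw
      · exact (hw.1 rfl).elim
      · have := hw.2.1
        rw [hρ.nil] at this
        linarith
    | append_singleton u e _ =>
      have hadm : G.Adm v (u ++ [e]) := hw.elim (fun h => h.2.1) (fun h => h.1)
      rw [adm_append, adm_singleton] at hadm
      refine ⟨⟨u, e⟩, ?_, rfl⟩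
      simp only [Finset.mem_sigma, hmem, mem_outEdges]
      refine ⟨⟨hadm.1, ?_⟩, hadm.2⟩
      rcases hw with hw | hw
      · exact hw.2.2.trans (hρ.snoc_lt u e).le
      · simpa using hw.2.2
  · intro _ _
    rfl

/-- A function that is additive along the tree of words is the sum of its values at the stopping
words. -/
lemma eq_sum_stopSet (hρ : IsScale ρ a b) (hδ : 0 < δ) (v : V) (hδ1 : δ ≤ 1) {f : List E → ℝ≥0∞}
    (hfin : ∀ u, f u ≠ ∞)
    (hf : ∀ u, G.Adm v u → f u = ∑ e ∈ G.outEdges (G.finish v u), f (u ++ [e])) :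
    f [] = ∑ w ∈ hρ.stopSet (G := G) hδ v, f w := by
  have h := hρ.sum_live_add (G := G) hδ v hδ1 f
  have h2 : ∑ u ∈ (hρ.finite_live (G := G) hδ v).toFinset, ∑ e ∈ G.outEdges (G.finish v u),
      f (u ++ [e]) = ∑ u ∈ (hρ.finite_live (G := G) hδ v).toFinset, f u :=
    Finset.sum_congr rfl fun u hu => (hf u ((Set.Finite.mem_toFinset _).1 hu).1).symm
  rw [h2, add_comm] at h
  -- The sum over the live words is finite and may be cancelled.
  exact (ENNReal.add_right_inj (ENNReal.sum_ne_top.2 fun u _ => hfin u)).1 h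

/-- A function that does not decrease when a live word is replaced by its extensions can be pushed
down the tree to the stopping words. All lower bounds for stopping sums rest on this. -/
lemma le_sum_stopSet (hρ : IsScale ρ a b) (hδ : 0 < δ) (v : V) (hδ1 : δ ≤ 1) {f : List E → ℝ}
    (hf : ∀ u, G.Adm v u → δ ≤ ρ u → f u ≤ ∑ e ∈ G.outEdges (G.finish v u), f (u ++ [e])) :
    f [] ≤ ∑ w ∈ hρ.stopSet (G := G) hδ v, f w := by
  have h := hρ.sum_live_add (G := G) hδ v hδ1 f
  have h2 : ∑ u ∈ (hρ.finite_live (G := G) hδ v).toFinset, f u ≤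
      ∑ u ∈ (hρ.finite_live (G := G) hδ v).toFinset, ∑ e ∈ G.outEdges (G.finish v u),
      f (u ++ [e]) := by
    refine Finset.sum_le_sum fun u hu => ?_
    rw [Set.Finite.mem_toFinset] at hu
    exact hf u hu.1 hu.2
  linarith

end IsScale

end BoxLikeGIFS

/-! ### Singular values of matrices with orthogonal columns -/

open Matrix in
-- The eigenvalues of the diagonal matrix are the `r i ^ 2`. Both inclusions between the set of the
-- `r i` and the set of singular values are used: one alone would allow a value to be taken twice.
lemma singularValues_eq_of_conjTranspose_mul {A : Matrix (Fin 2) (Fin 2) ℝ} {r : Fin 2 → ℝ}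
    (hr : ∀ i, 0 ≤ r i) (hA : Aᴴ * A = diagonal fun i => r i ^ 2) :
    (toEuclideanLin A).singularValues 0 = max (r 0) (r 1) ∧
      (toEuclideanLin A).singularValues 1 = min (r 0) (r 1) := by
  set T := toEuclideanLin A with hT
  have hTT : LinearMap.adjoint T ∘ₗ T = toLin (EuclideanSpace.basisFun (Fin 2) ℝ).toBasis
      (EuclideanSpace.basisFun (Fin 2) ℝ).toBasis (diagonal fun i => r i ^ 2) := by
    rw [hT, ← toEuclideanLin_conjTranspose_eq_adjoint, ← hA, toEuclideanLin_eq_toLin_orthonormal]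
    rw [Matrix.toLin_mul _ (EuclideanSpace.basisFun (Fin 2) ℝ).toBasis]
  have hfin : Module.finrank ℝ (EuclideanSpace ℝ (Fin 2)) = 2 := by simp
  have h1 : ∀ n < 2, ∃ i, r i = T.singularValues n := by
    intro n hn
    have h := T.hasEigenvalue_adjoint_comp_self_sq_singularValues (n := n) (by rw [hfin]; exact hn)
    rw [hTT, hasEigenvalue_toLin_diagonal_iff] at h
    obtain ⟨i, hi⟩ := h
    exact ⟨i, (sq_eq_sq₀ (hr i) (T.singularValues_nonneg n)).1 hi⟩
  have h2 : ∀ i, r i = T.singularValues 0 ∨ r i = T.singularValues 1 := by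
    intro i
    have h : Module.End.HasEigenvalue (LinearMap.adjoint T ∘ₗ T) (r i ^ 2) := by
      rw [hTT, hasEigenvalue_toLin_diagonal_iff]
      exact ⟨i, rfl⟩
    obtain ⟨j, hj⟩ := T.isSymmetric_adjoint_comp_self.exists_eigenvalues_eq hfin h
    have h3 : T.singularValues j ^ 2 = r i ^ 2 := by
      rw [T.sq_singularValues_fin hfin]
      exact hj
    have h4 := (sq_eq_sq₀ (T.singularValues_nonneg j) (hr i)).1 h3
    fin_cases j
    · exact Or.inl h4.symm
    · exact Or.inr h4.symm
  have hanti : T.singularValues 1 ≤ T.singularValues 0 := T.singularValues_antitone zero_le_one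
  obtain ⟨i, hi⟩ := h1 0 (by norm_num)
  obtain ⟨j, hj⟩ := h1 1 (by norm_num)
  have h30 := h2 0
  have h31 := h2 1
  rcases le_total (r 0) (r 1) with h | h
  · rw [max_eq_right h, min_eq_left h]
    fin_cases i <;> fin_cases j <;> simp at hi hj <;> constructor <;>
      rcases h30 with h30 | h30 <;> rcases h31 with h31 | h31 <;> linarith
  · rw [max_eq_left h, min_eq_right h]
    fin_cases i <;> fin_cases j <;> simp at hi hj <;> constructor <;>
      rcases h30 with h30 | h30 <;> rcases h31 with h31 | h31 <;> linarith

namespace BoxLikeGIFS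

variable {V E : Type*} (G : BoxLikeGIFS V E)

/-! ### Coordinates of the maps -/

open Classical in
/-- `0` if `T_e` is diagonal, `1` if it is anti-diagonal. -/
noncomputable def flip (e : E) : Fin 2 := if IsBoxDiagonal (G.lin e) then 0 else 1

/-- The non-zero entry of the `i`-th row of `T_e`. -/
noncomputable def ratio (e : E) (i : Fin 2) : ℝ := G.lin e i (i + G.flip e)

/-- Addition in `Fin 2` is addition modulo 2, so diagonal and anti-diagonal matrices obey one
formula and parities of words add up. -/
lemma lin_apply (e : E) (i j : Fin 2) :
    G.lin e i j = if j = i + G.flip e then G.ratio e i else 0 := by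
  by_cases h : IsBoxDiagonal (G.lin e)
  · have hf : G.flip e = 0 := by simp [flip, h]
    obtain ⟨a, b, -, -, -, -, hT⟩ := h
    fin_cases i <;> fin_cases j <;> simp [hf, ratio, hT]
  · have hf : G.flip e = 1 := by simp [flip, h]
    obtain ⟨a, b, -, -, -, -, hT⟩ := (G.boxLike e).resolve_left h
    fin_cases i <;> fin_cases j <;> simp [hf, ratio, hT]

lemma abs_ratio_pos (e : E) (i : Fin 2) : 0 < |G.ratio e i| := by
  by_cases h : IsBoxDiagonal (G.lin e)
  · have hf : G.flip e = 0 := by simp [flip, h]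
    obtain ⟨a, b, h1, h2, h3, h4, hT⟩ := h
    fin_cases i <;> simpa [hf, ratio, hT] using abs_pos.1 ‹_›
  · have hf : G.flip e = 1 := by simp [flip, h]
    obtain ⟨a, b, h1, h2, h3, h4, hT⟩ := (G.boxLike e).resolve_left h
    fin_cases i <;> simpa [hf, ratio, hT] using abs_pos.1 ‹_›

lemma abs_ratio_lt_one (e : E) (i : Fin 2) : |G.ratio e i| < 1 := by
  by_cases h : IsBoxDiagonal (G.lin e)
  · have hf : G.flip e = 0 := by simp [flip, h]
    obtain ⟨a, b, h1, h2, h3, h4, hT⟩ := h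
    fin_cases i <;> simpa [hf, ratio, hT]
  · have hf : G.flip e = 1 := by simp [flip, h]
    obtain ⟨a, b, h1, h2, h3, h4, hT⟩ := (G.boxLike e).resolve_left h
    fin_cases i <;> simpa [hf, ratio, hT]

lemma psi_apply (e : E) (ξ : Fin 2 → ℝ) (i : Fin 2) :
    G.psi e ξ i = G.ratio e i * ξ (i + G.flip e) + G.trans e i := by
  have : ∀ j, G.lin e i j * ξ j = if j = i + G.flip e then G.ratio e i * ξ j else 0 := fun j => by
    rw [lin_apply, ite_mul, zero_mul]
  simp only [psi, Pi.add_apply, Matrix.mulVec, dotProduct, this, Finset.sum_ite_eq',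
    Finset.mem_univ, if_true]

/-- The parity of the number of anti-diagonal factors of `T_w`. -/
noncomputable def flipWord (w : List E) : Fin 2 := (w.map G.flip).sum

/-- The coordinate on which the `i`-th coordinate of `ψ_w` depends. -/
noncomputable def idx (w : List E) (i : Fin 2) : Fin 2 := i + G.flipWord w

/-- The non-zero entry of the `i`-th row of `T_w`. -/
noncomputable def coef : List E → Fin 2 → ℝ
  | [], _ => 1
  | e :: w, i => G.ratio e i * coef w (i + G.flip e)

/-- The length of the side of `ψ_w([0,1]²)` parallel to the `i`-th axis. -/
noncomputable def side (w : List E) (i : Fin 2) : ℝ := |G.coef w i|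

@[simp] lemma idx_nil (i : Fin 2) : G.idx [] i = i := by simp [idx, flipWord]

lemma idx_cons (e : E) (w : List E) (i : Fin 2) : G.idx (e :: w) i = G.idx w (i + G.flip e) := by
  simp [idx, flipWord, add_assoc]

lemma idx_injective (w : List E) : Function.Injective (G.idx w) := add_left_injective _

lemma coef_append (u w : List E) (i : Fin 2) :
    G.coef (u ++ w) i = G.coef u i * G.coef w (G.idx u i) := by
  induction u generalizing i with
  | nil => simp [coef]
  | cons e u ih => simp [coef, ih, idx_cons, mul_assoc]

@[simp] lemma side_nil (i : Fin 2) : G.side [] i = 1 := by simp [side, coef]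

lemma side_append (u w : List E) (i : Fin 2) :
    G.side (u ++ w) i = G.side u i * G.side w (G.idx u i) := by
  simp [side, coef_append, abs_mul]

lemma side_singleton (e : E) (i : Fin 2) : G.side [e] i = |G.ratio e i| := by simp [side, coef]

lemma side_pos (w : List E) (i : Fin 2) : 0 < G.side w i := by
  induction w generalizing i with
  | nil => simp
  | cons e w ih =>
    rw [← List.singleton_append, side_append, side_singleton]
    exact mul_pos (G.abs_ratio_pos e i) (ih _)

lemma linWord_apply (w : List E) (i j : Fin 2) :
    G.linWord w i j = if j = G.idx w i then G.coef w i else 0 := by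
  induction w generalizing i with
  | nil => simp [linWord, coef, Matrix.one_apply, eq_comm]
  | cons e w ih =>
    have : G.linWord (e :: w) = G.lin e * G.linWord w := by simp [linWord]
    rw [this, Matrix.mul_apply, idx_cons]
    have h2 : ∀ k, G.lin e i k * G.linWord w k j =
        if k = i + G.flip e then G.ratio e i * G.linWord w k j else 0 := fun k => by
      rw [lin_apply, ite_mul, zero_mul]
    simp only [h2, Finset.sum_ite_eq', Finset.mem_univ, if_true]
    simp only [ih, coef, mul_ite, mul_zero]

lemma psiWord_append (u w : List E) : G.psiWord (u ++ w) = G.psiWord u ∘ G.psiWord w := by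
  induction u with
  | nil => rfl
  | cons e u ih => simp [psiWord, ih, Function.comp_assoc]

lemma psiWord_singleton (e : E) : G.psiWord [e] = G.psi e := by simp [psiWord]

lemma psiWord_sub (w : List E) (ξ η : Fin 2 → ℝ) (i : Fin 2) :
    G.psiWord w ξ i - G.psiWord w η i = G.coef w i * (ξ (G.idx w i) - η (G.idx w i)) := by
  induction w generalizing i with
  | nil => simp [psiWord, coef]
  | cons e w ih =>
    simp only [psiWord, Function.comp_apply, psi_apply, coef, idx_cons]
    rw [mul_assoc, ← ih]
    ring

lemma dist_psiWord (w : List E) (ξ η : Fin 2 → ℝ) (i : Fin 2) :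
    dist (G.psiWord w ξ i) (G.psiWord w η i) =
      G.side w i * dist (ξ (G.idx w i)) (η (G.idx w i)) := by
  rw [Real.dist_eq, psiWord_sub, abs_mul, Real.dist_eq, side]

lemma continuous_psi (e : E) : Continuous (G.psi e) := by
  refine continuous_pi fun i => ?_
  simp_rw [psi_apply]
  fun_prop

lemma continuous_psiWord (w : List E) : Continuous (G.psiWord w) := by
  induction w with
  | nil => exact continuous_id
  | cons e w ih => exact (G.continuous_psi e).comp ih

lemma sideLength_eq (i : Fin 2) (w : List E) : G.sideLength i w = G.side w i := by
  set S := (fun ξ : Fin 2 → ℝ => ξ i) '' (G.psiWord w '' Set.Icc 0 1) with hS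
  have hle : ∀ x ∈ S, ∀ y ∈ S, dist x y ≤ G.side w i := by
    rintro _ ⟨_, ⟨ξ, hξ, rfl⟩, rfl⟩ _ ⟨_, ⟨η, hη, rfl⟩, rfl⟩
    dsimp only
    rw [dist_psiWord]
    refine mul_le_of_le_one_right (G.side_pos w i).le ?_
    have := Real.dist_le_of_mem_Icc (x := ξ (G.idx w i)) (y := η (G.idx w i)) (x' := 0) (y' := 1)
      ⟨hξ.1 _, hξ.2 _⟩ ⟨hη.1 _, hη.2 _⟩
    simpa using this
  refine le_antisymm (Metric.diam_le_of_forall_dist_le (G.side_pos w i).le hle) ?_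
  have h0 : G.psiWord w 0 i ∈ S := ⟨_, ⟨0, ⟨le_rfl, zero_le_one⟩, rfl⟩, rfl⟩
  have h1 : G.psiWord w 1 i ∈ S := ⟨_, ⟨1, ⟨zero_le_one, le_rfl⟩, rfl⟩, rfl⟩
  have := Metric.dist_le_diam_of_mem (Metric.isBounded_iff.2 ⟨_, fun x hx y hy => hle x hx y hy⟩)
    h1 h0
  rw [dist_psiWord] at this
  have h2 : G.sideLength i w = Metric.diam S := rfl
  rw [h2]
  simpa using this

lemma isDiag_linWord_iff (w : List E) : (G.linWord w).IsDiag ↔ G.flipWord w = 0 := by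
  have hc : G.coef w 0 ≠ 0 := abs_pos.1 (G.side_pos w 0)
  constructor
  · intro h
    by_contra h0
    have h1 : G.idx w 0 = 1 := by
      rw [idx, zero_add]
      omega
    have : G.linWord w 0 1 = 0 := h (show (0 : Fin 2) ≠ 1 by decide)
    rw [linWord_apply, if_pos h1.symm] at this
    exact hc this
  · intro h i j hij
    rw [linWord_apply, if_neg]
    rw [idx, h, add_zero]
    exact hij.symm

/-- The direction of the longest side of `ψ_w([0,1]²)`. -/
noncomputable def longDir (w : List E) : Fin 2 :=
  open Classical in if G.side w 1 ≤ G.side w 0 then 0 else 1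

/-- The four cases in the definition of π_w amount to pulling the direction of the longest side back
through `T_w`. -/
lemma projIndex_eq (w : List E) : G.projIndex w = G.idx w (G.longDir w) := by
  simp only [projIndex, isDiag_linWord_iff, sideLength_eq, longDir, idx]
  by_cases h : G.flipWord w = 0
  · simp [h]
  · have h1 : G.flipWord w = 1 := by omega
    by_cases h2 : G.side w 1 ≤ G.side w 0 <;> simp [h1, h2]

/-- The length of the shortest side of `ψ_w([0,1]²)`. -/
noncomputable def short (w : List E) : ℝ := min (G.side w 0) (G.side w 1)

/-- The length of the longest side of `ψ_w([0,1]²)`. -/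
noncomputable def long (w : List E) : ℝ := max (G.side w 0) (G.side w 1)

lemma short_pos (w : List E) : 0 < G.short w := lt_min (G.side_pos w 0) (G.side_pos w 1)

lemma short_le_side (w : List E) (i : Fin 2) : G.short w ≤ G.side w i := by
  fin_cases i
  · exact min_le_left _ _
  · exact min_le_right _ _

lemma le_short_iff {w : List E} {x : ℝ} : x ≤ G.short w ↔ ∀ i, x ≤ G.side w i := by
  simp [short, Fin.forall_fin_two]

lemma side_longDir (w : List E) : G.side w (G.longDir w) = G.long w := by
  rw [long, longDir]
  split_ifs with h
  · rw [max_eq_left h]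
  · rw [max_eq_right (not_le.1 h).le]

lemma side_longDir_add_one (w : List E) : G.side w (G.longDir w + 1) = G.short w := by
  rw [short, longDir]
  split_ifs with h
  · rw [min_eq_right h]
    rfl
  · rw [min_eq_left (not_le.1 h).le]
    rfl

lemma short_le_long (w : List E) : G.short w ≤ G.long w := min_le_max

lemma side_le_long (w : List E) (i : Fin 2) : G.side w i ≤ G.long w := by
  fin_cases i
  · exact le_max_left _ _
  · exact le_max_right _ _

/-- The inequality can be strict, as the two factors may be short in different directions of the
product. It is the only source of non-multiplicativity in the singular value function. -/
lemma short_mul_le (u w : List E) : G.short u * G.short w ≤ G.short (u ++ w) := by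
  rw [le_short_iff]
  intro i
  rw [side_append]
  exact mul_le_mul (G.short_le_side u i) (G.short_le_side w _) (G.short_pos w).le
    (G.side_pos u i).le

/-- Every row and column of `T_w` has a single non-zero entry, so its columns are orthogonal with
the side lengths as norms. -/
lemma alpha_eq (w : List E) : G.alpha 0 w = G.long w ∧ G.alpha 1 w = G.short w := by
  have h := singularValues_eq_of_conjTranspose_mul (A := G.linWord w)
    (r := fun j => G.side w (j + G.flipWord w)) (fun j => (G.side_pos w _).le) ?_
  · rw [alpha, alpha, h.1, h.2, long, short]
    by_cases h : G.flipWord w = 0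
    · simp [h]
    · have h1 : G.flipWord w = 1 := by omega
      simp [h1, max_comm, min_comm]
  · ext j k
    rw [Matrix.mul_apply, Matrix.diagonal_apply]
    simp only [Matrix.conjTranspose_apply, linWord_apply, star_trivial, Fin.sum_univ_two, idx,
      side, sq_abs]
    by_cases h : G.flipWord w = 0
    · fin_cases j <;> fin_cases k <;> simp [h, sq]
    · have h1 : G.flipWord w = 1 := by omega
      fin_cases j <;> fin_cases k <;> simp [h1, sq]

lemma exists_ratio_bounds [Finite E] [Nonempty E] :
    ∃ a b : ℝ, 0 < a ∧ b < 1 ∧ ∀ e i, a ≤ |G.ratio e i| ∧ |G.ratio e i| ≤ b := by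
  obtain ⟨x, hx⟩ := Finite.exists_min fun x : E × Fin 2 => |G.ratio x.1 x.2|
  obtain ⟨y, hy⟩ := Finite.exists_max fun x : E × Fin 2 => |G.ratio x.1 x.2|
  exact ⟨_, _, G.abs_ratio_pos x.1 x.2, G.abs_ratio_lt_one y.1 y.2,
    fun e i => ⟨hx (e, i), hy (e, i)⟩⟩

lemma isScale_side {a b : ℝ} (ha : 0 < a) (hb : b < 1)
    (h : ∀ e i, a ≤ |G.ratio e i| ∧ |G.ratio e i| ≤ b) (i : Fin 2) :
    IsScale (fun w => G.side w i) a b where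
  nil := G.side_nil i
  pos := ha
  lt_one := hb
  le_snoc u e := by
    rw [side_append, side_singleton, mul_comm]
    exact mul_le_mul_of_nonneg_left (h e _).1 (G.side_pos u i).le
  snoc_le u e := by
    rw [side_append, side_singleton, mul_comm b]
    exact mul_le_mul_of_nonneg_left (h e _).2 (G.side_pos u i).le

lemma isScale_short {a b : ℝ} (ha : 0 < a) (hb : b < 1)
    (h : ∀ e i, a ≤ |G.ratio e i| ∧ |G.ratio e i| ≤ b) : IsScale G.short a b where
  nil := by simp [short]
  pos := ha
  lt_one := hb
  le_snoc u e := by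
    rw [le_short_iff]
    intro i
    exact (mul_le_mul_of_nonneg_left (G.short_le_side u i) ha.le).trans
      ((G.isScale_side ha hb h i).le_snoc u e)
  snoc_le u e := by
    -- The side in the direction in which `u` is shortest also shrinks by at least the factor `b`,
    -- and it bounds the new shortest side.
    rw [← G.side_longDir_add_one u]
    exact (G.short_le_side _ _).trans ((G.isScale_side ha hb h _).snoc_le u e)

end BoxLikeGIFS

/-! ### Consequences of the rectangular open set condition -/

namespace BoxLikeGIFS

lemma IsScale.append_le {E : Type*} {ρ : List E → ℝ} {a b : ℝ} (hρ : IsScale ρ a b)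
    (u w : List E) : ρ (u ++ w) ≤ ρ u := by
  induction w using List.reverseRecOn with
  | nil => simp
  | append_singleton w e ih =>
    rw [← List.append_assoc]
    exact (hρ.snoc_lt _ e).le.trans ih

variable {V E : Type*} {G : BoxLikeGIFS V E}

/-- A proper extension of a stopping word is already below `δ` before its last letter. -/
lemma IsStop.not_prefix {ρ : List E → ℝ} {a b : ℝ} (hρ : IsScale ρ a b) {δ : ℝ} {v v' : V}
    {u w : List E} (hu : G.IsStop ρ δ v u) (hw : G.IsStop ρ δ v' w) (hne : u ≠ w) : ¬ u <+: w := by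
  rintro ⟨t, rfl⟩
  induction t using List.reverseRecOn with
  | nil => simp at hne
  | append_singleton t e _ =>
    have h := hw.2.2
    rw [← List.append_assoc, List.dropLast_concat] at h
    linarith [hρ.append_le u t, hu.2.1]

/-- The open unit square. -/
def openSquare : Set (Fin 2 → ℝ) := Set.univ.pi fun _ => Set.Ioo (0 : ℝ) 1

lemma closure_openSquare : closure openSquare = Set.Icc 0 1 := by
  rw [openSquare, closure_pi_set]
  simp only [closure_Ioo (zero_ne_one (α := ℝ))]
  rw [Set.pi_univ_Icc]
  rfl

lemma psiWord_injective (G : BoxLikeGIFS V E) (w : List E) : Function.Injective (G.psiWord w) := by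
  intro ξ η h
  ext j
  -- The row `j - G.flipWord w` is the one that reads coordinate `j`.
  have h1 := G.psiWord_sub w ξ η (j - G.flipWord w)
  have h2 : G.idx w (j - G.flipWord w) = j := by simp [idx]
  rw [h, sub_self, h2] at h1
  have hc : G.coef w (j - G.flipWord w) ≠ 0 := abs_pos.1 (G.side_pos w _)
  linarith [(mul_eq_zero.1 h1.symm).resolve_left hc]

lemma ROSC.mapsTo_psi_openSquare (hrosc : G.ROSC) (e : E) :
    Set.MapsTo (G.psi e) openSquare openSquare := fun ξ hξ =>
  (hrosc (G.src e)).1 (Set.mem_biUnion (show e ∈ {e' | G.src e' = G.src e} from rfl) ⟨ξ, hξ, rfl⟩)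

lemma ROSC.mapsTo_psi (hrosc : G.ROSC) (e : E) :
    Set.MapsTo (G.psi e) (Set.Icc 0 1) (Set.Icc 0 1) := by
  rw [← closure_openSquare]
  exact (hrosc.mapsTo_psi_openSquare e).closure (G.continuous_psi e)

lemma ROSC.mapsTo_psiWord_openSquare (hrosc : G.ROSC) (w : List E) :
    Set.MapsTo (G.psiWord w) openSquare openSquare := by
  induction w with
  | nil => exact Set.mapsTo_id _
  | cons e w ih => exact (hrosc.mapsTo_psi_openSquare e).comp ih

/-- The words branch at some letter. There the ROSC separates the images of the open square, and the
common prefix acts injectively. -/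
lemma ROSC.disjoint_psiWord (hrosc : G.ROSC) {v : V} {u w : List E} (hu : G.Adm v u)
    (hw : G.Adm v w) (h : ¬ u <+: w) (h' : ¬ w <+: u) :
    Disjoint (G.psiWord u '' openSquare) (G.psiWord w '' openSquare) := by
  induction u generalizing v w with
  | nil => simp at h
  | cons e u ih =>
    cases w with
    | nil => simp at h'
    | cons e' w =>
      simp only [psiWord, Set.image_comp]
      by_cases he : e = e'
      · subst he
        have hinj : Function.Injective (G.psi e) := by
          rw [← psiWord_singleton]
          exact G.psiWord_injective _
        refine (Set.disjoint_image_iff hinj).2 (ih hu.2 hw.2 ?_ ?_)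
        · simpa using h
        · simpa using h'
      · have hd := (hrosc v).2 (show e ∈ {e | G.src e = v} from hu.1)
          (show e' ∈ {e | G.src e = v} from hw.1) he
        exact Disjoint.mono (Set.image_mono (hrosc.mapsTo_psiWord_openSquare u).image_subset)
          (Set.image_mono (hrosc.mapsTo_psiWord_openSquare w).image_subset) hd

/-! ### Decomposition and support of the self-affine measures -/

section Measure

variable {p : E → ℝ} {μ : V → Measure (Fin 2 → ℝ)}

/-- The weight `p_w` of a word. -/
def weight (p : E → ℝ) (w : List E) : ℝ := (w.map p).prod

@[simp] lemma weight_nil (p : E → ℝ) : weight p [] = 1 := by simp [weight]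

lemma weight_append (p : E → ℝ) (u w : List E) : weight p (u ++ w) = weight p u * weight p w := by
  simp [weight]

/-- The closed square with the same centre as the unit square that exceeds it by `R` on every
side. -/
def bigSquare (R : ℝ) : Set (Fin 2 → ℝ) := Set.Icc (fun _ => -R) (fun _ => 1 + R)

/-- A point is compared with its coordinatewise truncation `η` to the unit square: the image of `η`
stays in the square, and distances contract by `b`. -/
lemma ROSC.mapsTo_bigSquare (hrosc : G.ROSC) {b : ℝ} (hb : ∀ e i, |G.ratio e i| ≤ b) {R : ℝ}
    (hR : 0 ≤ R) (e : E) : Set.MapsTo (G.psi e) (bigSquare R) (bigSquare (b * R)) := by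
  intro ξ hξ
  set η : Fin 2 → ℝ := fun i => max 0 (min 1 (ξ i)) with hη
  have hηm : η ∈ Set.Icc (0 : Fin 2 → ℝ) 1 :=
    ⟨fun i => le_max_left _ _, fun i => max_le zero_le_one (min_le_left _ _)⟩
  have hd : ∀ i, |ξ i - η i| ≤ R := by
    intro i
    have h1 : -R ≤ ξ i := hξ.1 i
    have h2 : ξ i ≤ 1 + R := hξ.2 i
    simp only [hη]
    rw [abs_le]
    rcases le_total 1 (ξ i) with h | h
    · rw [min_eq_left h, max_eq_right zero_le_one]
      constructor <;> linarith
    · rw [min_eq_right h]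
      rcases le_total 0 (ξ i) with h' | h'
      · rw [max_eq_right h']
        constructor <;> linarith
      · rw [max_eq_left h']
        constructor <;> linarith
  have hm := hrosc.mapsTo_psi e hηm
  have hd' : ∀ i, |G.psi e ξ i - G.psi e η i| ≤ b * R := by
    intro i
    rw [psi_apply, psi_apply, add_sub_add_right_eq_sub, ← mul_sub, abs_mul]
    exact mul_le_mul (hb e i) (hd _) (abs_nonneg _) ((abs_nonneg _).trans (hb e i))
  refine ⟨fun i => ?_, fun i => ?_⟩
  · have := (abs_le.1 (hd' i)).1
    have h0 : 0 ≤ G.psi e η i := hm.1 i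
    dsimp only
    linarith
  · have := (abs_le.1 (hd' i)).2
    have h0 : G.psi e η i ≤ 1 := hm.2 i
    dsimp only
    linarith

lemma exists_measure_compl_bigSquare_le [Finite V] [∀ v, IsProbabilityMeasure (μ v)] {ε : ℝ≥0∞}
    (hε : 0 < ε) : ∃ R : ℝ, 0 ≤ R ∧ ∀ v, μ v (bigSquare R)ᶜ ≤ ε := by
  have hanti : Antitone fun n : ℕ => (bigSquare (n : ℝ))ᶜ := by
    intro m n hmn
    refine Set.compl_subset_compl.2 (Set.Icc_subset_Icc (fun i => ?_) (fun i => ?_))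
    · exact neg_le_neg (Nat.cast_le.2 hmn)
    · exact add_le_add_right (Nat.cast_le.2 hmn) 1
  have hempty : ⋂ n : ℕ, (bigSquare (n : ℝ))ᶜ = ∅ := by
    rw [← Set.compl_iUnion, Set.compl_empty_iff, Set.eq_univ_iff_forall]
    intro ξ
    obtain ⟨n, hn⟩ := exists_nat_ge (max |ξ 0| |ξ 1|)
    have hle : ∀ i, |ξ i| ≤ n := by
      intro i
      fin_cases i
      · exact (le_max_left _ _).trans hn
      · exact (le_max_right _ _).trans hn
    refine Set.mem_iUnion.2 ⟨n, fun i => (abs_le.1 (hle i)).1, fun i => ?_⟩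
    have := (abs_le.1 (hle i)).2
    dsimp only
    linarith
  have hlim : ∀ v, ∀ᶠ n : ℕ in atTop, μ v (bigSquare (n : ℝ))ᶜ ≤ ε := by
    intro v
    have h := tendsto_measure_iInter_atTop (μ := μ v)
      (fun n : ℕ => (measurableSet_Icc (a := fun _ : Fin 2 => -(n : ℝ))
        (b := fun _ : Fin 2 => 1 + (n : ℝ))).compl.nullMeasurableSet) hanti
      ⟨0, measure_ne_top _ _⟩
    change Tendsto _ _ (𝓝 (μ v (⋂ n : ℕ, (bigSquare (n : ℝ))ᶜ))) at h
    rw [hempty, measure_empty] at h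
    exact h.eventually_le_const hε
  obtain ⟨n, hn⟩ := (eventually_all.2 hlim).exists
  exact ⟨n, n.cast_nonneg, hn⟩

variable [Fintype E]

lemma IsProbVector.weight_pos (hp : G.IsProbVector p) (w : List E) : 0 < weight p w := by
  induction w with
  | nil => simp
  | cons e w ih =>
    rw [← List.singleton_append, weight_append]
    exact mul_pos (by simpa [weight] using hp.1 e) ih

lemma IsProbVector.sum_outEdges (hp : G.IsProbVector p) (v : V) :
    ∑ e ∈ G.outEdges v, ENNReal.ofReal (p e) = 1 := by
  rw [← ENNReal.ofReal_sum_of_nonneg fun e _ => (hp.1 e).le, outEdges, hp.2 v, ENNReal.ofReal_one]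

lemma IsSelfAffineFamily.apply (hμ : G.IsSelfAffineFamily p μ) (v : V) {A : Set (Fin 2 → ℝ)}
    (hA : MeasurableSet A) : μ v A =
      ∑ e ∈ G.outEdges v, ENNReal.ofReal (p e) * μ (G.tgt e) (G.psi e ⁻¹' A) := by
  conv_lhs => rw [hμ.2 v]
  simp only [Measure.coe_finsetSum, Finset.sum_apply, Measure.smul_apply, smul_eq_mul, outEdges]
  refine Finset.sum_congr rfl fun e _ => ?_
  rw [Measure.map_apply (G.continuous_psi e).measurable hA]

lemma IsSelfAffineFamily.step (hp : G.IsProbVector p) (hμ : G.IsSelfAffineFamily p μ) (v : V)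
    {A : Set (Fin 2 → ℝ)} (hA : MeasurableSet A) (u : List E) :
    ENNReal.ofReal (weight p u) * μ (G.finish v u) (G.psiWord u ⁻¹' A) =
      ∑ e ∈ G.outEdges (G.finish v u), ENNReal.ofReal (weight p (u ++ [e])) *
        μ (G.finish v (u ++ [e])) (G.psiWord (u ++ [e]) ⁻¹' A) := by
  rw [hμ.apply _ ((G.continuous_psiWord u).measurable hA), Finset.mul_sum]
  refine Finset.sum_congr rfl fun e _ => ?_
  rw [weight_append, ENNReal.ofReal_mul (hp.weight_pos u).le, finish_append, psiWord_append,
    psiWord_singleton, finish_singleton, mul_assoc, Set.preimage_comp]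
  simp [weight]

/-- The measure `μ_v` is the sum of the pieces that belong to the stopping words. -/
lemma IsSelfAffineFamily.apply_eq_sum_stopSet [Nonempty E] (hp : G.IsProbVector p)
    (hμ : G.IsSelfAffineFamily p μ) {ρ : List E → ℝ} {a b : ℝ} (hρ : IsScale ρ a b) {δ : ℝ}
    (hδ : 0 < δ) (hδ1 : δ ≤ 1) (v : V) {A : Set (Fin 2 → ℝ)} (hA : MeasurableSet A) :
    μ v A = ∑ w ∈ hρ.stopSet (G := G) hδ v,
      ENNReal.ofReal (weight p w) * μ (G.finish v w) (G.psiWord w ⁻¹' A) := by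
  have := hμ.1
  have h := hρ.eq_sum_stopSet (G := G) hδ v hδ1
    (f := fun u => ENNReal.ofReal (weight p u) * μ (G.finish v u) (G.psiWord u ⁻¹' A))
    (fun u => ENNReal.mul_ne_top ENNReal.ofReal_ne_top (measure_ne_top _ _))
    (fun u _ => hμ.step hp v hA u)
  simpa [psiWord] using h

lemma IsSelfAffineFamily.weight_mul_le (hp : G.IsProbVector p) (hμ : G.IsSelfAffineFamily p μ)
    {v : V} {w : List E} (hw : G.Adm v w) {A : Set (Fin 2 → ℝ)} (hA : MeasurableSet A) :
    ENNReal.ofReal (weight p w) * μ (G.finish v w) (G.psiWord w ⁻¹' A) ≤ μ v A := by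
  induction w using List.reverseRecOn with
  | nil => simp [psiWord]
  | append_singleton u e ih =>
    rw [adm_append, adm_singleton] at hw
    refine le_trans ?_ (ih hw.1)
    rw [hμ.step hp v hA u]
    exact Finset.single_le_sum (f := fun e => ENNReal.ofReal (weight p (u ++ [e])) *
        μ (G.finish v (u ++ [e])) (G.psiWord (u ++ [e]) ⁻¹' A)) (fun _ _ => zero_le)
        (G.mem_outEdges.2 hw.2)

/-- Self-affine measures are carried by the closed unit square. -/
lemma IsSelfAffineFamily.measure_compl_eq_zero [Finite V] [Nonempty E] (hrosc : G.ROSC)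
    (hp : G.IsProbVector p) (hμ : G.IsSelfAffineFamily p μ) (v : V) :
    μ v (Set.Icc 0 1)ᶜ = 0 := by
  have := hμ.1
  obtain ⟨a, b, ha, hb, hab⟩ := G.exists_ratio_bounds
  have hb0 : 0 < b := by
    obtain ⟨e⟩ := ‹Nonempty E›
    exact ha.trans_le ((hab e 0).1.trans (hab e 0).2)
  -- One application of the self-affine identity carries a bound for the mass outside the enlarged
  -- square, valid at all vertices, over to the margin contracted by `b`.
  have hstep : ∀ (ε : ℝ≥0∞) (R : ℝ), 0 ≤ R → (∀ v, μ v (bigSquare R)ᶜ ≤ ε) → ∀ n : ℕ, ∀ v,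
      μ v (bigSquare (b ^ n * R))ᶜ ≤ ε := by
    intro ε R hR h n
    induction n with
    | zero => simpa using h
    | succ n ih =>
      intro v
      have hmeas : MeasurableSet (bigSquare (b ^ (n + 1) * R))ᶜ := measurableSet_Icc.compl
      rw [hμ.apply v hmeas]
      calc ∑ e ∈ G.outEdges v, ENNReal.ofReal (p e) *
            μ (G.tgt e) (G.psi e ⁻¹' (bigSquare (b ^ (n + 1) * R))ᶜ)
          ≤ ∑ e ∈ G.outEdges v, ENNReal.ofReal (p e) * ε := by
            gcongr with e
            refine (measure_mono ?_).trans (ih (G.tgt e))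
            rw [Set.preimage_compl, pow_succ', mul_assoc]
            exact Set.compl_subset_compl.2
              (hrosc.mapsTo_bigSquare (fun e i => (hab e i).2) (by positivity) e)
        _ = ε := by rw [← Finset.sum_mul, hp.sum_outEdges, one_mul]
  have hzero : ∀ R : ℝ, 0 < R → μ v (bigSquare R)ᶜ = 0 := by
    intro R hR
    refine nonpos_iff_eq_zero.1 (le_of_forall_gt_imp_ge_of_dense fun ε hε => ?_)
    -- No compact support is assumed: tightness of the finitely many measures supplies some margin
    -- `R'`, and iteration shrinks it below the given `R`.
    obtain ⟨R', hR', h⟩ := exists_measure_compl_bigSquare_le (μ := μ) hε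
    obtain ⟨n, hn⟩ := exists_pow_lt_of_lt_one (show 0 < R / (R' + 1) by positivity) hb
    have hle : b ^ n * R' ≤ R := by
      rw [lt_div_iff₀ (by positivity)] at hn
      nlinarith [pow_pos hb0 n]
    refine (measure_mono (Set.compl_subset_compl.2 ?_)).trans (hstep ε R' hR' h n v)
    exact Set.Icc_subset_Icc (fun i => neg_le_neg hle) (fun i => add_le_add_right hle 1)
  have hsub : (Set.Icc (0 : Fin 2 → ℝ) 1)ᶜ ⊆ ⋃ n : ℕ, (bigSquare (1 / ((n : ℝ) + 1)))ᶜ := by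
    rw [← Set.compl_iInter]
    refine Set.compl_subset_compl.2 fun ξ hξ => ?_
    rw [Set.mem_iInter] at hξ
    have hlim := tendsto_one_div_add_atTop_nhds_zero_nat (𝕜 := ℝ)
    refine ⟨fun i => ?_, fun i => ?_⟩
    · have := ge_of_tendsto' hlim fun n => show -ξ i ≤ 1 / ((n : ℝ) + 1) by
        have h : -(1 / ((n : ℝ) + 1)) ≤ ξ i := (hξ n).1 i
        linarith
      simpa using this
    · have := ge_of_tendsto' hlim fun n => show ξ i - 1 ≤ 1 / ((n : ℝ) + 1) by
        have h : ξ i ≤ 1 + 1 / ((n : ℝ) + 1) := (hξ n).2 i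
        linarith
      simpa using this
  exact measure_mono_null hsub (measure_iUnion_null fun n => hzero _ (by positivity))

end Measure

end BoxLikeGIFS

/-! ### Moments of a measure that is composed of small pieces -/

lemma tsum_ite_mem_finset {κ : Type*} (T : Finset κ) {_ : ∀ b, Decidable (b ∈ T)} (h : κ → ℝ≥0∞) :
    ∑' b, (if b ∈ T then h b else 0) = ∑ b ∈ T, h b := by
  rw [tsum_eq_sum_of_support (T := T)]
  · exact Finset.sum_congr rfl fun b hb => by simp [hb]
  · exact fun b hb => by_contra fun h0 => hb (by simp [h0])

/-- `ν` is composed of the images under maps `F w` of probability measures, with weights `c w`,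
and each piece has diameter at most `δ`. -/
structure Pieces {Ω Ω' ω : Type*} [MeasurableSpace Ω] [MeasurableSpace Ω'] {n : ℕ} (ν : Measure Ω')
    (F : Ω' → Fin n → ℝ) (W : Finset ω) (c : ω → ℝ≥0∞) (ν' : ω → Measure Ω)
    (F' : ω → Ω → Fin n → ℝ) (K : Set Ω) (δ : ℝ) : Prop where
  prob : ∀ w, IsProbabilityMeasure (ν' w)
  null : ∀ w, ν' w Kᶜ = 0
  apply_eq : ∀ (δ' : ℝ) (k : Fin n → ℤ),
    ν (F ⁻¹' meshCube δ' k) = ∑ w ∈ W, c w * ν' w (F' w ⁻¹' meshCube δ' k)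
  ne_top : ∀ w, c w ≠ ∞
  dist_le : ∀ w ∈ W, ∀ x ∈ K, ∀ y ∈ K, dist (F' w x) (F' w y) ≤ δ
  pos : 0 < δ

namespace Pieces

variable {Ω ω : Type*} {n : ℕ} {W : Finset ω} {F' : ω → Ω → Fin n → ℝ} {δ : ℝ}

open Classical in
/-- The pieces whose image of the base point lies in the cell `l` of the `δ`-mesh. -/
noncomputable def inCell (W : Finset ω) (F' : ω → Ω → Fin n → ℝ) (δ : ℝ) (x₀ : Ω)
    (l : Fin n → ℤ) : Finset ω :=
  {w ∈ W | meshCell δ (F' w x₀) = l}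

lemma tsum_inCell (x₀ : Ω) (y : ω → ℝ≥0∞) :
    ∑' l, ∑ w ∈ inCell W F' δ x₀ l, y w = ∑ w ∈ W, y w := by
  classical
  simp_rw [inCell, Finset.sum_filter]
  rw [Summable.tsum_finsetSum fun _ _ => ENNReal.summable]
  refine Finset.sum_congr rfl fun w _ => ?_
  rw [tsum_eq_single (meshCell δ (F' w x₀)) fun l hl => if_neg hl.symm, if_pos rfl]

variable {Ω' : Type*} [MeasurableSpace Ω] [MeasurableSpace Ω'] {ν : Measure Ω'}
  {F : Ω' → Fin n → ℝ} {c : ω → ℝ≥0∞} {ν' : ω → Measure Ω} {K : Set Ω}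

lemma exists_mem (h : Pieces ν F W c ν' F' K δ) {w : ω} {A : Set Ω} (hA : ν' w A ≠ 0) :
    ∃ x ∈ K, x ∈ A := by
  by_contra! h3
  exact hA (measure_mono_null (fun y hy hyK => h3 y hyK hy) (h.null w))

/-- A piece whose base point falls into cell `l` has diameter at most `δ`, so its full weight lies
in the cubes near `l`. -/
lemma tsum_cells_le (h : Pieces ν F W c ν' F' K δ) {q : ℝ} (hq : 0 ≤ q) {x₀ : Ω} (hx₀ : x₀ ∈ K) :
    ∑' l, qpow q (∑ w ∈ inCell W F' δ x₀ l, c w) ≤ momConst q 1 n n * mom q ν F δ := by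
  classical
  refine tsum_qpow_le_of_rel hq (fun l k => k ∈ nearIndices 2 l)
    (fun l => ⟨nearIndices 2 l, (card_nearIndices _ _).le, fun _ => id⟩)
    (fun k => ⟨nearIndices 2 k, (card_nearIndices _ _).le, fun _ => mem_nearIndices_comm.1⟩)
    fun l => ?_
  refine le_of_le_of_eq ?_ (tsum_ite_mem_finset (nearIndices 2 l) _).symm
  have h1 : ∀ w ∈ inCell W F' δ x₀ l,
      c w ≤ ∑ k ∈ nearIndices 2 l, c w * ν' w (F' w ⁻¹' meshCube δ k) := by
    intro w hw
    have hp := h.prob w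
    rw [inCell, Finset.mem_filter] at hw
    rw [← Finset.mul_sum]
    refine le_mul_of_one_le_right' ?_
    calc (1 : ℝ≥0∞) = ν' w K := by
          rw [← measure_univ (μ := ν' w)]
          exact (measure_congr (by simpa [ae_iff_measure_eq, ae_eq_univ] using h.null w)).symm
      _ ≤ ν' w (⋃ k ∈ nearIndices 2 l, F' w ⁻¹' meshCube δ k) := by
          refine measure_mono fun x hx => ?_
          refine Set.mem_biUnion (x := meshCell δ (F' w x)) ?_ (mem_meshCube_meshCell h.pos _)
          refine mem_nearIndices_of_dist_le (C := 1) h.pos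
            (hw.2 ▸ mem_meshCube_meshCell h.pos (F' w x₀)) (mem_meshCube_meshCell h.pos _) ?_
          simpa using h.dist_le w hw.1 x₀ hx₀ x hx
      _ ≤ _ := measure_biUnion_finset_le _ _
  calc ∑ w ∈ inCell W F' δ x₀ l, c w
      ≤ ∑ w ∈ inCell W F' δ x₀ l, ∑ k ∈ nearIndices 2 l, c w * ν' w (F' w ⁻¹' meshCube δ k) :=
        Finset.sum_le_sum h1
    _ = ∑ k ∈ nearIndices 2 l, ∑ w ∈ inCell W F' δ x₀ l, c w * ν' w (F' w ⁻¹' meshCube δ k) :=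
        Finset.sum_comm
    _ ≤ _ := by
        gcongr with k
        rw [h.apply_eq]
        exact Finset.sum_le_sum_of_subset (Finset.filter_subset _ _)

/-- Conversely, only pieces with base point in a cell near `l` can charge the cube `l`. -/
lemma le_tsum_cells (h : Pieces ν F W c ν' F' K δ) {q : ℝ} (hq : 0 ≤ q) {x₀ : Ω} (hx₀ : x₀ ∈ K) :
    mom q ν F δ ≤ momConst q 1 n n * ∑' l, qpow q (∑ w ∈ inCell W F' δ x₀ l, c w) := by
  classical
  refine tsum_qpow_le_of_rel hq (fun l k => k ∈ nearIndices 2 l)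
    (fun l => ⟨nearIndices 2 l, (card_nearIndices _ _).le, fun _ => id⟩)
    (fun k => ⟨nearIndices 2 k, (card_nearIndices _ _).le, fun _ => mem_nearIndices_comm.1⟩)
    fun l => ?_
  rw [h.apply_eq, ← tsum_inCell (F' := F') (δ := δ) x₀]
  refine ENNReal.tsum_le_tsum fun k => ?_
  split_ifs with hk
  · refine Finset.sum_le_sum fun w _ => ?_
    have hp := h.prob w
    exact mul_le_of_le_one_right' prob_le_one
  · rw [nonpos_iff_eq_zero]
    refine Finset.sum_eq_zero fun w hw => ?_
    rw [inCell, Finset.mem_filter] at hw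
    by_contra h0
    obtain ⟨x, hxK, hx⟩ := h.exists_mem (right_ne_zero_of_mul h0)
    refine hk (mem_nearIndices_of_dist_le (C := 1) h.pos hx
      (hw.2 ▸ mem_meshCube_meshCell h.pos (F' w x₀)) ?_)
    simpa using h.dist_le w hw.1 x hxK x₀ hx₀

/-- A cube of a fine mesh meets pieces from a bounded number of cells only. -/
lemma mem_nearIndices_of_ne_zero (h : Pieces ν F W c ν' F' K δ) {x₀ : Ω} (hx₀ : x₀ ∈ K) {δ' : ℝ}
    (hδ' : 0 < δ') (hle : δ' ≤ δ) {k l : Fin n → ℤ}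
    (h0 : ∑ w ∈ inCell W F' δ x₀ l, c w * ν' w (F' w ⁻¹' meshCube δ' k) ≠ 0) :
    l ∈ nearIndices 3 (meshCell δ fun i => (k i : ℝ) * δ') := by
  obtain ⟨w, hw, hw0⟩ := Finset.exists_ne_zero_of_sum_ne_zero h0
  obtain ⟨x, hxK, hx⟩ := h.exists_mem (right_ne_zero_of_mul hw0)
  rw [inCell, Finset.mem_filter] at hw
  refine mem_nearIndices_of_dist_le (C := 2) h.pos (mem_meshCube_meshCell h.pos _)
    (hw.2 ▸ mem_meshCube_meshCell h.pos (F' w x₀)) ?_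
  have hk : (fun i => (k i : ℝ) * δ') ∈ meshCube δ' k := fun i => ⟨le_rfl, by linarith⟩
  have h1 := dist_le_of_mem_meshCube hδ' hk hx
  have h2 := h.dist_le w hw.1 x hxK x₀ hx₀
  have h3 := dist_triangle (fun i => (k i : ℝ) * δ') (F' w x) (F' w x₀)
  push_cast
  linarith

/-- The mass of a fine cube is split according to the cells of the pieces, boundedly many of which
contribute. Within one cell convexity bounds the fine moment by the `q`-th power of the cell weight
times `T`, and the cell weights reproduce the moment at scale `δ`. -/
lemma mom_le_mul (h : Pieces ν F W c ν' F' K δ) {q : ℝ} (hq : 1 ≤ q) {x₀ : Ω} (hx₀ : x₀ ∈ K)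
    {δ' : ℝ} (hδ' : 0 < δ') (hle : δ' ≤ δ) {T : ℝ≥0∞}
    (hT : ∀ w ∈ W, mom q (ν' w) (F' w) δ' ≤ T) :
    mom q ν F δ' ≤ ((2 * 3 + 1) ^ n : ℕ) ^ q * (momConst q 1 n n * mom q ν F δ * T) := by
  have hq0 : 0 ≤ q := by linarith
  calc mom q ν F δ' ≤ ∑' k, ((2 * 3 + 1) ^ n : ℕ) ^ q * ∑' l,
        qpow q (∑ w ∈ inCell W F' δ x₀ l, c w * ν' w (F' w ⁻¹' meshCube δ' k)) := by
        refine ENNReal.tsum_le_tsum fun k => ?_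
        rw [h.apply_eq, ← tsum_inCell (F' := F') (δ := δ) x₀]
        exact qpow_tsum_le hq0 (card_nearIndices _ _).le
          fun l hl => h.mem_nearIndices_of_ne_zero hx₀ hδ' hle hl
    _ = ((2 * 3 + 1) ^ n : ℕ) ^ q * ∑' l, ∑' k,
        qpow q (∑ w ∈ inCell W F' δ x₀ l, c w * ν' w (F' w ⁻¹' meshCube δ' k)) := by
        rw [ENNReal.tsum_mul_left, ENNReal.tsum_comm]
    _ ≤ ((2 * 3 + 1) ^ n : ℕ) ^ q * ∑' l, qpow q (∑ w ∈ inCell W F' δ x₀ l, c w) * T := by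
        gcongr with l
        exact tsum_qpow_weighted_le hq _ (ENNReal.sum_ne_top.2 fun w _ => h.ne_top w)
          fun w hw => hT w (Finset.mem_of_mem_filter w hw)
    _ ≤ _ := by
        rw [ENNReal.tsum_mul_right]
        gcongr
        exact h.tsum_cells_le hq0 hx₀

/-- The argument of `mom_le_mul` with concavity in place of convexity. -/
lemma mul_le_mom (h : Pieces ν F W c ν' F' K δ) {q : ℝ} (hq : 0 ≤ q) (hq1 : q ≤ 1) {x₀ : Ω}
    (hx₀ : x₀ ∈ K) {δ' : ℝ} (hδ' : 0 < δ') (hle : δ' ≤ δ) {T : ℝ≥0∞}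
    (hT : ∀ w ∈ W, T ≤ mom q (ν' w) (F' w) δ') :
    mom q ν F δ * T ≤ momConst q 1 n n * (((2 * 3 + 1) ^ n : ℕ) * mom q ν F δ') := by
  calc mom q ν F δ * T
      ≤ momConst q 1 n n * (∑' l, qpow q (∑ w ∈ inCell W F' δ x₀ l, c w) * T) := by
        rw [ENNReal.tsum_mul_right, ← mul_assoc]
        gcongr
        exact h.le_tsum_cells hq hx₀
    _ ≤ momConst q 1 n n * ∑' l, ∑' k,
        qpow q (∑ w ∈ inCell W F' δ x₀ l, c w * ν' w (F' w ⁻¹' meshCube δ' k)) := by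
        gcongr with l
        exact le_tsum_qpow_weighted hq hq1 _ (ENNReal.sum_ne_top.2 fun w _ => h.ne_top w)
          fun w hw => hT w (Finset.mem_of_mem_filter w hw)
    _ = momConst q 1 n n * ∑' k, ∑' l,
        qpow q (∑ w ∈ inCell W F' δ x₀ l, c w * ν' w (F' w ⁻¹' meshCube δ' k)) := by
        rw [ENNReal.tsum_comm]
    _ ≤ _ := by
        gcongr
        rw [mom, ← ENNReal.tsum_mul_left]
        refine ENNReal.tsum_le_tsum fun k => ?_
        rw [h.apply_eq, ← tsum_inCell (F' := F') (δ := δ) x₀]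
        exact tsum_qpow_le hq (card_nearIndices _ _).le
          fun l hl => h.mem_nearIndices_of_ne_zero hx₀ hδ' hle hl

end Pieces

/-! ### The spectra of the projections -/

/-- The `i`-th coordinate, as a point of `ℝ¹`. -/
def coordMap (i : Fin 2) : (Fin 2 → ℝ) → Fin 1 → ℝ := fun ξ _ => ξ i

lemma dist_coordMap (i : Fin 2) (ξ η : Fin 2 → ℝ) :
    dist (coordMap i ξ) (coordMap i η) = dist (ξ i) (η i) := dist_pi_const _ _

lemma measurable_coordMap (i : Fin 2) : Measurable (coordMap i) :=
  measurable_pi_lambda _ fun _ => measurable_pi_apply i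

namespace BoxLikeGIFS

variable {V E : Type*} {G : BoxLikeGIFS V E} {p : E → ℝ} {μ : V → Measure (Fin 2 → ℝ)} {q : ℝ}

/-- The `i`-th coordinate of ψ_w is a similarity of ratio `G.side w i` in the coordinate `G.idx w
i`, so it only rescales the mesh. -/
lemma mom_coordMap_psiWord (hq : 0 ≤ q) (ν : Measure (Fin 2 → ℝ)) (w : List E) (i : Fin 2)
    {δ δ' : ℝ} (hδ : 0 < δ) (hδ' : 0 < δ') {C : ℕ} (h1 : δ ≤ C * (G.side w i * δ'))
    (h2 : G.side w i * δ' ≤ C * δ) :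
    mom q ν (coordMap i ∘ G.psiWord w) δ ≤
        momConst q C 1 1 * mom q ν (coordMap (G.idx w i)) δ' ∧
      mom q ν (coordMap (G.idx w i)) δ' ≤
        momConst q C 1 1 * mom q ν (coordMap i ∘ G.psiWord w) δ := by
  have hs := G.side_pos w i
  have ha : ∀ x ∈ (Set.univ : Set (Fin 2 → ℝ)), ∀ y ∈ (Set.univ : Set (Fin 2 → ℝ)),
      dist ((coordMap i ∘ G.psiWord w) x) ((coordMap i ∘ G.psiWord w) y) ≤ δ →
      dist (coordMap (G.idx w i) x) (coordMap (G.idx w i) y) ≤ C * δ' := by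
    intro x _ y _ h
    rw [Function.comp_apply, Function.comp_apply, dist_coordMap, dist_psiWord] at h
    rw [dist_coordMap]
    refine le_of_mul_le_mul_left ?_ hs
    linarith
  have hb : ∀ x ∈ (Set.univ : Set (Fin 2 → ℝ)), ∀ y ∈ (Set.univ : Set (Fin 2 → ℝ)),
      dist (coordMap (G.idx w i) x) (coordMap (G.idx w i) y) ≤ δ' →
      dist ((coordMap i ∘ G.psiWord w) x) ((coordMap i ∘ G.psiWord w) y) ≤ C * δ := by
    intro x _ y _ h
    rw [Function.comp_apply, Function.comp_apply, dist_coordMap, dist_psiWord]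
    rw [dist_coordMap] at h
    exact (mul_le_mul_of_nonneg_left h hs.le).trans h2
  exact ⟨mom_le_of_dist_le hq (by simp) hδ hδ' ha hb, mom_le_of_dist_le hq (by simp) hδ' hδ hb ha⟩

lemma mom_psiWord (hq : 0 ≤ q) (ν : Measure (Fin 2 → ℝ)) (w : List E) {δ : ℝ} (hδ : 0 < δ) {C : ℕ}
    (h1 : ∀ i, 1 ≤ C * G.side w i) (h2 : ∀ i, G.side w i ≤ C) :
    mom q ν id δ ≤ momConst q C 2 2 * mom q ν (G.psiWord w) δ := by
  refine mom_le_of_dist_le hq (K := Set.univ) (by simp) hδ hδ ?_ ?_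
  · intro x _ y _ h
    refine (dist_pi_le_iff (by positivity)).2 fun i => ?_
    rw [dist_psiWord]
    exact mul_le_mul (h2 i) ((dist_le_pi_dist x y _).trans h) dist_nonneg (by positivity)
  · intro x _ y _ h
    refine (dist_pi_le_iff (by positivity)).2 fun j => ?_
    have h3 := (dist_le_pi_dist (G.psiWord w x) (G.psiWord w y) (j - G.flipWord w)).trans h
    have h4 : G.idx w (j - G.flipWord w) = j := by simp [idx]
    rw [dist_psiWord, h4] at h3
    calc dist (x j) (y j) ≤ C * G.side w (j - G.flipWord w) * dist (x j) (y j) :=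
          le_mul_of_one_le_left dist_nonneg (h1 _)
      _ ≤ C * δ := by
          rw [mul_assoc]
          exact mul_le_mul_of_nonneg_left h3 (by positivity)

lemma nonempty_edges [Nonempty V] (hconn : G.StronglyConnected) : Nonempty E := by
  obtain ⟨v⟩ := ‹Nonempty V›
  obtain ⟨w, hw, -⟩ := hconn v v
  obtain ⟨e, -⟩ := List.exists_mem_of_ne_nil w hw
  exact ⟨e⟩

lemma dist_le_one_of_mem {ξ η : Fin 2 → ℝ} (hξ : ξ ∈ Set.Icc (0 : Fin 2 → ℝ) 1)
    (hη : η ∈ Set.Icc (0 : Fin 2 → ℝ) 1) (i : Fin 2) : dist (ξ i) (η i) ≤ 1 := by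
  have := Real.dist_le_of_mem_Icc (x := ξ i) (y := η i) (x' := 0) (y' := 1)
    ⟨hξ.1 _, hξ.2 _⟩ ⟨hη.1 _, hη.2 _⟩
  simpa using this

lemma exists_uniform_bound {ι : Type*} [Finite ι] {P : ι → ℝ≥0∞ → Prop}
    (hmono : ∀ i C C', C ≤ C' → P i C → P i C') (h : ∀ i, ∃ C, C ≠ ∞ ∧ P i C) :
    ∃ C : ℝ≥0∞, C ≠ ∞ ∧ ∀ i, P i C := by
  have := Fintype.ofFinite ι
  choose C hC hP using h
  refine ⟨∑ i, C i, ENNReal.sum_ne_top.2 fun i _ => hC i, fun i => hmono i _ _ ?_ (hP i)⟩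
  exact Finset.single_le_sum (fun _ _ => zero_le) (Finset.mem_univ i)

variable [Fintype E]

lemma weight_mul_mom_le (hq : 0 ≤ q) (hp : G.IsProbVector p) (hμ : G.IsSelfAffineFamily p μ)
    {n : ℕ} {F : (Fin 2 → ℝ) → Fin n → ℝ} (hF : Measurable F) {v : V} {w : List E}
    (hw : G.Adm v w) (δ : ℝ) :
    ENNReal.ofReal (weight p w) ^ q * mom q (μ (G.finish v w)) (F ∘ G.psiWord w) δ ≤
      mom q (μ v) F δ := by
  rw [mom, ← ENNReal.tsum_mul_left]
  refine ENNReal.tsum_le_tsum fun k => ?_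
  rw [← qpow_mul hq (by simpa using hp.weight_pos w), Set.preimage_comp]
  exact qpow_mono hq (hμ.weight_mul_le hp hw (hF (measurableSet_meshCube _ _)))

lemma exists_mom_le_of_weight (hq : 0 ≤ q) (hp : G.IsProbVector p) (w : List E) {B : ℝ≥0∞}
    (hB : B ≠ ∞) : ∃ C : ℝ≥0∞, C ≠ ∞ ∧ ∀ x y z : ℝ≥0∞, x ≤ B * y →
      ENNReal.ofReal (weight p w) ^ q * y ≤ z → x ≤ C * z := by
  have h0 : ENNReal.ofReal (weight p w) ^ q ≠ 0 := by
    have : ENNReal.ofReal (weight p w) ≠ 0 := by simpa using hp.weight_pos w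
    rw [← qpow_of_ne_zero this]
    exact qpow_ne_zero hq this
  have htop : ENNReal.ofReal (weight p w) ^ q ≠ ∞ :=
    ENNReal.rpow_ne_top_of_nonneg hq ENNReal.ofReal_ne_top
  refine ⟨B * (ENNReal.ofReal (weight p w) ^ q)⁻¹,
    ENNReal.mul_ne_top hB (ENNReal.inv_ne_top.2 h0), fun x y z hx hz => hx.trans ?_⟩
  rw [mul_assoc]
  gcongr
  rw [mul_comm, ← div_eq_mul_inv]
  exact (ENNReal.le_div_iff_mul_le (Or.inl h0) (Or.inl htop)).2 (by rwa [mul_comm])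

/-- The measure `μ v` dominates the piece that belongs to `w`. The constant depends on `w` through
its weight and side. -/
lemma exists_mom_coordMap_finish_le (hq : 0 ≤ q) (hp : G.IsProbVector p)
    (hμ : G.IsSelfAffineFamily p μ) (w : List E) (i : Fin 2) :
    ∃ C : ℝ≥0∞, C ≠ ∞ ∧ ∀ v, G.Adm v w → ∀ δ, 0 < δ →
      mom q (μ (G.finish v w)) (coordMap (G.idx w i)) δ ≤ C * mom q (μ v) (coordMap i) δ := by
  have hs := G.side_pos w i
  obtain ⟨N, hN⟩ := exists_nat_ge (max (1 / G.side w i) (G.side w i))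
  have hN1 : 1 ≤ N * G.side w i := (div_le_iff₀ hs).1 ((le_max_left _ _).trans hN)
  have hN2 : G.side w i ≤ N := (le_max_right _ _).trans hN
  obtain ⟨C, hC, h⟩ := exists_mom_le_of_weight hq hp w (momConst_ne_top hq N 1 1)
  refine ⟨C, hC, fun v hw δ hδ => h _ _ _ ?_
    (weight_mul_mom_le hq hp hμ (measurable_coordMap i) hw δ)⟩
  refine (mom_coordMap_psiWord hq _ w i hδ hδ ?_ ?_).2
  · nlinarith
  · nlinarith

lemma exists_mom_finish_le (hq : 0 ≤ q) (hp : G.IsProbVector p)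
    (hμ : G.IsSelfAffineFamily p μ) (w : List E) :
    ∃ C : ℝ≥0∞, C ≠ ∞ ∧ ∀ v, G.Adm v w → ∀ δ, 0 < δ →
      mom q (μ (G.finish v w)) id δ ≤ C * mom q (μ v) id δ := by
  obtain ⟨N, hN⟩ := exists_nat_ge (max (1 / G.short w) (G.long w))
  have hN1 : 1 ≤ N * G.short w := (div_le_iff₀ (G.short_pos w)).1 ((le_max_left _ _).trans hN)
  have hN2 : G.long w ≤ N := (le_max_right _ _).trans hN
  obtain ⟨C, hC, h⟩ := exists_mom_le_of_weight hq hp w (momConst_ne_top hq N 2 2)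
  refine ⟨C, hC, fun v hw δ hδ => h _ _ _ ?_ (weight_mul_mom_le hq hp hμ measurable_id hw δ)⟩
  exact mom_psiWord hq _ w hδ
    (fun i => hN1.trans (mul_le_mul_of_nonneg_left (G.short_le_side w i) (by positivity)))
    fun i => (G.side_le_long w i).trans hN2

variable [Finite V]

/-- The constant must be uniform over words of unbounded length. The comparison involves only the
end pairs of vertex and coordinate, of which there are finitely many, so one connecting word for
each two pairs suffices. -/
lemma exists_mom_coordMap_comparable (hq : 0 ≤ q) (hconn : G.StronglyConnected)
    (hp : G.IsProbVector p) (hμ : G.IsSelfAffineFamily p μ) :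
    ∃ C : ℝ≥0∞, C ≠ ∞ ∧ ∀ v w i, G.Adm v w → ∀ δ, 0 < δ →
      mom q (μ (G.finish v w)) (coordMap (G.idx w i)) δ ≤ C * mom q (μ v) (coordMap i) δ ∧
      mom q (μ v) (coordMap i) δ ≤ C * mom q (μ (G.finish v w)) (coordMap (G.idx w i)) δ := by
  obtain ⟨C, hC, h⟩ := exists_uniform_bound (ι := (V × Fin 2) × (V × Fin 2))
    (P := fun x C => ∀ w, G.Adm x.1.1 w → G.finish x.1.1 w = x.2.1 → G.idx w x.1.2 = x.2.2 →
      ∀ δ, 0 < δ → mom q (μ x.2.1) (coordMap x.2.2) δ ≤ C * mom q (μ x.1.1) (coordMap x.1.2) δ)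
    (fun x C C' hCC h w h1 h2 h3 δ hδ => (h w h1 h2 h3 δ hδ).trans (by gcongr)) (by
      rintro ⟨⟨v, i⟩, ⟨v', i'⟩⟩
      by_cases hex : ∃ w, G.Adm v w ∧ G.finish v w = v' ∧ G.idx w i = i'
      · obtain ⟨w, h1, rfl, rfl⟩ := hex
        obtain ⟨C, hC, h⟩ := exists_mom_coordMap_finish_le hq hp hμ w i
        exact ⟨C, hC, fun _ _ _ _ δ hδ => h v h1 δ hδ⟩
      · exact ⟨0, by simp, fun w h1 h2 h3 => (hex ⟨w, h1, h2, h3⟩).elim⟩)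
  refine ⟨C, hC, fun v w i hw δ hδ => ⟨h ((v, i), (_, _)) w hw rfl rfl δ hδ, ?_⟩⟩
  obtain ⟨u, -, hu⟩ := hconn (G.finish v w) v
  rw [isPath_iff] at hu
  -- The return word `u` alone could end at the wrong coordinate. Together with the initial `w`, the
  -- detour `u ++ w ++ u` uses `u` and `w` twice each, and the parities cancel.
  refine h ((G.finish v w, G.idx w i), (v, i)) (u ++ w ++ u) ?_ ?_ ?_ δ hδ
  · simp [adm_append, hu, hw]
  · simp [finish_append, hu]
  · have h2 : ∀ x y : Fin 2, x + y + (x + y) = 0 := by decide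
    simp only [idx, flipWord, List.map_append, List.sum_append, add_assoc]
    have := h2 (List.map G.flip w).sum (List.map G.flip u).sum
    simp only [add_assoc] at this
    rw [this, add_zero]

lemma exists_mom_comparable (hq : 0 ≤ q) (hconn : G.StronglyConnected)
    (hp : G.IsProbVector p) (hμ : G.IsSelfAffineFamily p μ) :
    ∃ C : ℝ≥0∞, C ≠ ∞ ∧ ∀ v v' δ, 0 < δ → mom q (μ v') id δ ≤ C * mom q (μ v) id δ := by
  obtain ⟨C, hC, h⟩ := exists_uniform_bound (ι := V × V)
    (P := fun x C => ∀ δ, 0 < δ → mom q (μ x.2) id δ ≤ C * mom q (μ x.1) id δ)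
    (fun x C C' hCC h δ hδ => (h δ hδ).trans (by gcongr)) (by
      rintro ⟨v, v'⟩
      obtain ⟨u, -, hu⟩ := hconn v v'
      rw [isPath_iff] at hu
      obtain ⟨C, hC, h⟩ := exists_mom_finish_le hq hp hμ u
      exact ⟨C, hC, fun δ hδ => hu.2 ▸ h v hu.1 δ hδ⟩)
  exact ⟨C, hC, fun v u => h (v, u)⟩

/-- The moments of the projections are submultiplicative in the scale for `q ≥ 1` and
supermultiplicative for `q ≤ 1`, up to a constant. -/
lemma exists_mom_coordMap_mul [Nonempty V] (hq : 0 ≤ q) (hconn : G.StronglyConnected)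
    (hrosc : G.ROSC) (hp : G.IsProbVector p) (hμ : G.IsSelfAffineFamily p μ) :
    ∃ C : ℝ≥0∞, C ≠ ∞ ∧ ∀ v i δ ε, 0 < δ → δ ≤ 1 → 0 < ε → ε ≤ 1 →
      (1 ≤ q → mom q (μ v) (coordMap i) (δ * ε) ≤
        C * (mom q (μ v) (coordMap i) δ * mom q (μ v) (coordMap i) ε)) ∧
      (q ≤ 1 → mom q (μ v) (coordMap i) δ * mom q (μ v) (coordMap i) ε ≤
        C * mom q (μ v) (coordMap i) (δ * ε)) := by
  have hE := nonempty_edges hconn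
  obtain ⟨a, b, ha, hb, hab⟩ := G.exists_ratio_bounds
  obtain ⟨C, hC, hcomp⟩ := exists_mom_coordMap_comparable hq hconn hp hμ
  -- This `N` turns `a * δ ≤ G.side w i`, valid at stopping words, into `δ ≤ N * G.side w i`.
  obtain ⟨N, hN⟩ := exists_nat_ge (max 1 (1 / a))
  have hN1 : (1 : ℝ) ≤ N := (le_max_left _ _).trans hN
  have hN2 : 1 ≤ N * a := (div_le_iff₀ ha).1 ((le_max_right _ _).trans hN)
  set B := momConst q N 1 1 with hB
  set B' := momConst q 1 1 1 with hB'
  set c₁ : ℝ≥0∞ := (((2 * 3 + 1) ^ 1 : ℕ) : ℝ≥0∞) ^ q with hc₁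
  set c₂ : ℝ≥0∞ := (((2 * 3 + 1) ^ 1 : ℕ) : ℝ≥0∞) with hc₂
  have hBtop : B ≠ ∞ := momConst_ne_top hq _ _ _
  have hB'top : B' ≠ ∞ := momConst_ne_top hq _ _ _
  have hc₁top : c₁ ≠ ∞ := ENNReal.rpow_ne_top_of_nonneg hq (ENNReal.natCast_ne_top _)
  have hc₂top : c₂ ≠ ∞ := ENNReal.natCast_ne_top _
  refine ⟨c₁ * B' * B * C + (C * B + 1) * B' * c₂, ?_, ?_⟩
  · exact ENNReal.add_ne_top.2 ⟨by finiteness, by finiteness⟩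
  intro v i δ ε hδ hδ1 hε hε1
  have hρ := G.isScale_side ha hb hab i
  have hpieces : Pieces (μ v) (coordMap i) (hρ.stopSet (G := G) hδ v)
      (fun w => ENNReal.ofReal (weight p w)) (fun w => μ (G.finish v w))
      (fun w => coordMap i ∘ G.psiWord w) (Set.Icc 0 1) δ :=
    { prob := fun w => hμ.1 _
      null := fun w => hμ.measure_compl_eq_zero hrosc hp _
      apply_eq := fun δ' k => by
        rw [hμ.apply_eq_sum_stopSet hp hρ hδ hδ1 v
          (measurable_coordMap i (measurableSet_meshCube δ' k))]
        rfl
      ne_top := fun w => ENNReal.ofReal_ne_top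
      dist_le := fun w hw x hx y hy => by
        rw [hρ.mem_stopSet] at hw
        rw [Function.comp_apply, Function.comp_apply, dist_coordMap, dist_psiWord]
        exact (mul_le_of_le_one_right (G.side_pos w i).le (dist_le_one_of_mem hx hy _)).trans
          hw.2.1.le
      pos := hδ }
  -- A stopping piece has side comparable to `δ`, so at scale `δ * ε` it shows a projection at scale
  -- `ε`, which is comparable to the projection of `μ v` itself, uniformly in `w`.
  have hscale : ∀ w ∈ hρ.stopSet (G := G) hδ v,
      mom q (μ (G.finish v w)) (coordMap i ∘ G.psiWord w) (δ * ε) ≤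
          B * C * mom q (μ v) (coordMap i) ε ∧
        mom q (μ v) (coordMap i) ε ≤
          C * B * mom q (μ (G.finish v w)) (coordMap i ∘ G.psiWord w) (δ * ε) := by
    intro w hw
    rw [hρ.mem_stopSet] at hw
    have h1 : a * δ ≤ G.side w i := hρ.le_of_isStop hδ1 hw
    have h2 : G.side w i < δ := hw.2.1
    have h3 := mom_coordMap_psiWord (G := G) hq (μ (G.finish v w)) w i (δ := δ * ε) (δ' := ε)
      (by positivity) hε (C := N) (by
        have : δ ≤ N * G.side w i := by nlinarith
        nlinarith) (by
        have : G.side w i ≤ N * δ := by nlinarith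
        nlinarith)
    have h4 := hcomp v w i hw.1 ε hε
    constructor
    · refine h3.1.trans ?_
      rw [mul_assoc]
      gcongr
      exact h4.1
    · refine h4.2.trans ?_
      rw [mul_assoc]
      gcongr
      exact h3.2
  have hx₀ : (0 : Fin 2 → ℝ) ∈ Set.Icc (0 : Fin 2 → ℝ) 1 := ⟨le_rfl, zero_le_one⟩
  have hle : δ * ε ≤ δ := mul_le_of_le_one_right hδ.le hε1
  constructor
  · intro h1q
    refine (hpieces.mom_le_mul h1q hx₀ (by positivity) hle fun w hw => (hscale w hw).1).trans ?_
    calc c₁ * (B' * mom q (μ v) (coordMap i) δ * (B * C * mom q (μ v) (coordMap i) ε))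
        = c₁ * B' * B * C * (mom q (μ v) (coordMap i) δ * mom q (μ v) (coordMap i) ε) := by ring
      _ ≤ _ := by
        gcongr
        exact le_self_add
  · intro hq1
    -- The summand `1` makes the division legitimate, as `C * B` is not known to be non-zero.
    have hD0 : C * B + 1 ≠ 0 := by simp
    have hDtop : C * B + 1 ≠ ∞ := by finiteness
    have hT : ∀ w ∈ hρ.stopSet (G := G) hδ v, mom q (μ v) (coordMap i) ε / (C * B + 1) ≤
        mom q (μ (G.finish v w)) (coordMap i ∘ G.psiWord w) (δ * ε) := fun w hw =>
      ENNReal.div_le_of_le_mul' ((hscale w hw).2.trans (by gcongr; exact le_self_add))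
    have h := hpieces.mul_le_mom hq hq1 hx₀ (by positivity) hle hT
    calc mom q (μ v) (coordMap i) δ * mom q (μ v) (coordMap i) ε
        = (C * B + 1) * (mom q (μ v) (coordMap i) δ *
            (mom q (μ v) (coordMap i) ε / (C * B + 1))) := by
          rw [mul_left_comm, ENNReal.mul_div_cancel hD0 hDtop]
      _ ≤ (C * B + 1) * (B' * (c₂ * mom q (μ v) (coordMap i) (δ * ε))) := by gcongr
      _ = (C * B + 1) * B' * c₂ * mom q (μ v) (coordMap i) (δ * ε) := by ring
      _ ≤ _ := by
        gcongr
        exact le_add_self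

lemma scaleRegular_mom {n : ℕ} (hq : 0 ≤ q) {ν : Measure (Fin 2 → ℝ)} [IsProbabilityMeasure ν]
    {K : Set (Fin 2 → ℝ)} (hK : ν Kᶜ = 0) {F : (Fin 2 → ℝ) → Fin n → ℝ} {B : ℝ}
    (hB : ∀ x ∈ K, ∀ y ∈ K, dist (F x) (F y) ≤ B) :
    ScaleRegular fun δ => (mom q ν F δ).toReal := by
  have htop : ∀ δ, 0 < δ → mom q ν F δ ≠ ∞ := fun δ hδ => mom_ne_top hq hK hδ hB
  refine ⟨fun δ hδ => ENNReal.toReal_pos (mom_ne_zero hq F hδ) (htop δ hδ), fun C => ?_⟩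
  refine ⟨(momConst q C n n).toReal, fun δ δ' hδ hδ' h h' => ?_⟩
  rw [← ENNReal.toReal_mul]
  exact ENNReal.toReal_mono (ENNReal.mul_ne_top (momConst_ne_top hq _ _ _) (htop δ' hδ'))
    (mom_le_of_scale hq F hδ hδ' h h')

lemma scaleRegular_coordMap [Nonempty V] (hq : 0 ≤ q) (hconn : G.StronglyConnected)
    (hrosc : G.ROSC) (hp : G.IsProbVector p) (hμ : G.IsSelfAffineFamily p μ) (v : V) (i : Fin 2) :
    ScaleRegular fun δ => (mom q (μ v) (coordMap i) δ).toReal := by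
  have hE := nonempty_edges hconn
  have := hμ.1 v
  refine scaleRegular_mom hq (hμ.measure_compl_eq_zero hrosc hp v) (B := 1) fun x hx y hy => ?_
  rw [dist_coordMap]
  exact dist_le_one_of_mem hx hy i

lemma scaleRegular_id [Nonempty V] (hq : 0 ≤ q) (hconn : G.StronglyConnected)
    (hrosc : G.ROSC) (hp : G.IsProbVector p) (hμ : G.IsSelfAffineFamily p μ) (v : V) :
    ScaleRegular fun δ => (mom q (μ v) id δ).toReal := by
  have hE := nonempty_edges hconn
  have := hμ.1 v
  refine scaleRegular_mom hq (hμ.measure_compl_eq_zero hrosc hp v) (B := 1) fun x hx y hy => ?_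
  exact (dist_pi_le_iff zero_le_one).2 fun i => dist_le_one_of_mem hx hy i

lemma ne_top_of_scaleRegular {f : ℝ → ℝ≥0∞} (h : ScaleRegular fun δ => (f δ).toReal) {δ : ℝ}
    (hδ : 0 < δ) : f δ ≠ ∞ := (ENNReal.toReal_pos_iff.1 (h.1 δ hδ)).2.ne

lemma log_mul_le_of_le {x y z C : ℝ} (hx : 0 < x) (hy : 0 < y) (hz : 0 < z)
    (h : x ≤ C * (y * z)) : Real.log x ≤ Real.log y + Real.log z + |Real.log C| := by
  have hC : 0 < C := pos_of_mul_pos_left (hx.trans_le h) (by positivity)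
  have := Real.log_le_log hx h
  rw [Real.log_mul hC.ne' (by positivity), Real.log_mul hy.ne' hz.ne'] at this
  linarith [le_abs_self (Real.log C)]

lemma log_mul_le_of_mul_le {x y z C : ℝ} (hx : 0 < x) (hy : 0 < y) (hz : 0 < z)
    (h : y * z ≤ C * x) : Real.log y + Real.log z - |Real.log C| ≤ Real.log x := by
  have hC : 0 < C := pos_of_mul_pos_left ((mul_pos hy hz).trans_le h) hx.le
  have := Real.log_le_log (by positivity) h
  rw [Real.log_mul hC.ne' hx.ne', Real.log_mul hy.ne' hz.ne'] at this
  linarith [le_abs_self (Real.log C)]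

/-- The `L^q`-spectra of the projections exist. -/
lemma exists_tendsto_coordMap [Nonempty V] (hq : 0 ≤ q) (hconn : G.StronglyConnected)
    (hrosc : G.ROSC) (hp : G.IsProbVector p) (hμ : G.IsSelfAffineFamily p μ) (v : V) (i : Fin 2) :
    ∃ τ, Tendsto (fun δ : ℝ => Real.log (mom q (μ v) (coordMap i) δ).toReal / (-Real.log δ))
      (𝓝[>] 0) (𝓝 τ) := by
  have hreg := scaleRegular_coordMap hq hconn hrosc hp hμ v i
  obtain ⟨C, hC, hmul⟩ := exists_mom_coordMap_mul hq hconn hrosc hp hμ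
  obtain ⟨B, hB⟩ := hreg.exists_abs_log_sub_le 2
  set D : ℝ → ℝ := fun δ => (mom q (μ v) (coordMap i) δ).toReal with hD
  have hpow : ∀ n : ℕ, (0 : ℝ) < (1 / 2) ^ n := fun n => by positivity
  have hpow1 : ∀ n : ℕ, ((1 : ℝ) / 2) ^ n ≤ 1 := fun n => pow_le_one₀ (by norm_num) (by norm_num)
  have hpos : ∀ n : ℕ, 0 < D ((1 / 2) ^ n) := fun n => hreg.1 _ (hpow n)
  have htop : ∀ δ, 0 < δ → mom q (μ v) (coordMap i) δ ≠ ∞ := fun δ hδ =>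
    ne_top_of_scaleRegular hreg hδ
  obtain ⟨L, hL⟩ := exists_tendsto_div_of_almost_additive
    (x := fun n => Real.log (D ((1 / 2) ^ n))) (C := max B |Real.log C.toReal|) (by
      intro n
      refine (hB _ _ (hpow _) (hpow _) ?_ ?_).trans (le_max_left _ _)
      · have := hpow n
        rw [pow_succ]
        push_cast
        linarith
      · rw [pow_succ]
        push_cast
        linarith) (by
      rcases le_total 1 q with h1 | h1
      · left
        intro m n
        have h := (hmul v i _ _ (hpow m) (hpow1 m) (hpow n) (hpow1 n)).1 h1
        rw [← pow_add] at h
        have h' := ENNReal.toReal_mono (ENNReal.mul_ne_top hC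
          (ENNReal.mul_ne_top (htop _ (hpow m)) (htop _ (hpow n)))) h
        rw [ENNReal.toReal_mul, ENNReal.toReal_mul] at h'
        have h2 := log_mul_le_of_le (hpos (m + n)) (hpos m) (hpos n) h'
        linarith [le_max_right B |Real.log C.toReal|]
      · right
        intro m n
        have h := (hmul v i _ _ (hpow m) (hpow1 m) (hpow n) (hpow1 n)).2 h1
        rw [← pow_add] at h
        have h' := ENNReal.toReal_mono (ENNReal.mul_ne_top hC (htop _ (hpow (m + n)))) h
        rw [ENNReal.toReal_mul, ENNReal.toReal_mul] at h'
        have h2 := log_mul_le_of_mul_le (hpos (m + n)) (hpos m) (hpos n) h'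
        linarith [le_max_right B |Real.log C.toReal|])
  exact ⟨_, hreg.tendsto_of_dyadic hL⟩

/-- The `L^q`-spectrum of the `i`-th projection of `μ_v`. -/
noncomputable def tau (μ : V → Measure (Fin 2 → ℝ)) (q : ℝ) (v : V) (i : Fin 2) : ℝ :=
  lqSpectrum (projMeasure i (μ v)) q

lemma tendsto_tau [Nonempty V] (hq : 0 ≤ q) (hconn : G.StronglyConnected)
    (hrosc : G.ROSC) (hp : G.IsProbVector p) (hμ : G.IsSelfAffineFamily p μ) (v : V) (i : Fin 2) :
    Tendsto (fun δ : ℝ => Real.log (mom q (μ v) (coordMap i) δ).toReal / (-Real.log δ))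
      (𝓝[>] 0) (𝓝 (tau μ q v i)) ∧ HasLqSpectrum (projMeasure i (μ v)) q (tau μ q v i) := by
  have := hμ.1 v
  obtain ⟨τ, hτ⟩ := exists_tendsto_coordMap hq hconn hrosc hp hμ v i
  have h : Tendsto (fun δ : ℝ => Real.log (meshMoment (projMeasure i (μ v)) q δ) / (-Real.log δ))
      (𝓝[>] 0) (𝓝 τ) := by
    refine hτ.congr fun δ => ?_
    rw [← meshMoment_map hq (measurable_coordMap i)]
    rfl
  have h2 : tau μ q v i = τ := lqSpectrum_eq_of_tendsto h
  rw [h2]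
  exact ⟨hτ, hasLqSpectrum_of_tendsto h⟩

/-- The logarithms of comparable moments differ by a bounded amount, which is negligible against
`-log δ`. This is the compatibility that makes powers of the sides multiplicative along paths. -/
lemma tau_finish [Nonempty V] (hq : 0 ≤ q) (hconn : G.StronglyConnected)
    (hrosc : G.ROSC) (hp : G.IsProbVector p) (hμ : G.IsSelfAffineFamily p μ) {v : V} {w : List E}
    (hw : G.Adm v w) (i : Fin 2) : tau μ q (G.finish v w) (G.idx w i) = tau μ q v i := by
  obtain ⟨C, hC, h⟩ := exists_mom_coordMap_comparable hq hconn hp hμ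
  have h1 := (tendsto_tau hq hconn hrosc hp hμ v i).1
  have h2 := (tendsto_tau hq hconn hrosc hp hμ (G.finish v w) (G.idx w i)).1
  have hr1 := scaleRegular_coordMap hq hconn hrosc hp hμ v i
  have hr2 := scaleRegular_coordMap hq hconn hrosc hp hμ (G.finish v w) (G.idx w i)
  refine tendsto_nhds_unique h2 ?_
  have h3 : Tendsto (fun δ : ℝ =>
      (Real.log (mom q (μ (G.finish v w)) (coordMap (G.idx w i)) δ).toReal -
        Real.log (mom q (μ v) (coordMap i) δ).toReal) / (-Real.log δ)) (𝓝[>] 0) (𝓝 0) := by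
    refine squeeze_zero_norm' ?_ (tendsto_neg_log_nhdsGT_zero.const_div_atTop |Real.log C.toReal|)
    filter_upwards [Ioo_mem_nhdsGT (zero_lt_one : (0 : ℝ) < 1)] with δ hδ
    have hlog : 0 < -Real.log δ := by linarith [Real.log_neg hδ.1 hδ.2]
    rw [Real.norm_eq_abs, abs_div, abs_of_pos hlog]
    refine div_le_div_of_nonneg_right ?_ hlog.le
    obtain ⟨ha, hb⟩ := h v w i hw δ hδ.1
    have ha' := ENNReal.toReal_mono (ENNReal.mul_ne_top hC (ne_top_of_scaleRegular hr1 hδ.1)) ha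
    have hb' := ENNReal.toReal_mono (ENNReal.mul_ne_top hC (ne_top_of_scaleRegular hr2 hδ.1)) hb
    rw [ENNReal.toReal_mul] at ha' hb'
    have ha2 := log_mul_le_of_le (hr2.1 δ hδ.1) (hr1.1 δ hδ.1) one_pos (by simpa using ha')
    have hb2 := log_mul_le_of_le (hr1.1 δ hδ.1) (hr2.1 δ hδ.1) one_pos (by simpa using hb')
    rw [Real.log_one] at ha2 hb2
    dsimp only at ha2 hb2
    rw [abs_le]
    constructor <;> linarith
  have h4 := h3.add h1
  rw [zero_add] at h4
  refine h4.congr fun δ => ?_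
  rw [← add_div, sub_add_cancel]

end BoxLikeGIFS

namespace BoxLikeGIFS

variable {V E : Type*} {G : BoxLikeGIFS V E}

/-! ### Sums of weights over words -/

/-- A positive function of words that changes by a bounded factor with every letter. -/
structure IsWordWeight (G : BoxLikeGIFS V E) (f : V → List E → ℝ) (C : ℝ) : Prop where
  pos : ∀ v w, 0 < f v w
  nil : ∀ v, f v [] = 1
  one_le : 1 ≤ C
  snoc_le : ∀ v u e, G.Adm v (u ++ [e]) → f v (u ++ [e]) ≤ C * f v u
  le_snoc : ∀ v u e, G.Adm v (u ++ [e]) → f v u ≤ C * f v (u ++ [e])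

/-- The weight is submultiplicative. -/
def IsSubmul (G : BoxLikeGIFS V E) (f : V → List E → ℝ) : Prop :=
  ∀ v u w, G.Adm v (u ++ w) → f v (u ++ w) ≤ f v u * f (G.finish v u) w

/-- The weight is supermultiplicative. -/
def IsSupermul (G : BoxLikeGIFS V E) (f : V → List E → ℝ) : Prop :=
  ∀ v u w, G.Adm v (u ++ w) → f v u * f (G.finish v u) w ≤ f v (u ++ w)

section

variable [Fintype E]

/-- The sum of the weights of the extensions of `u` by `n` letters. -/
noncomputable def extSum (G : BoxLikeGIFS V E) (f : V → List E → ℝ) (n : ℕ) (v : V)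
    (u : List E) : ℝ :=
  ∑ w ∈ G.paths n (G.finish v u), f v (u ++ w)

lemma extSum_zero (f : V → List E → ℝ) (v : V) (u : List E) : G.extSum f 0 v u = f v u := by
  simp [extSum, paths_zero]

lemma extSum_nil (f : V → List E → ℝ) (n : ℕ) (v : V) :
    G.extSum f n v [] = ∑ w ∈ G.paths n v, f v w := by
  simp [extSum]

lemma sum_extSum_snoc (f : V → List E → ℝ) (n : ℕ) (v : V) (u : List E) :
    ∑ e ∈ G.outEdges (G.finish v u), G.extSum f n v (u ++ [e]) = G.extSum f (n + 1) v u := by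
  simp only [extSum, sum_paths_succ', finish_append, finish_singleton, List.append_assoc,
    List.singleton_append]

lemma IsSubmul.extSum_le {f : V → List E → ℝ} (h : G.IsSubmul f) (n : ℕ) {v : V} {u : List E}
    (hu : G.Adm v u) : G.extSum f n v u ≤ f v u * G.extSum f n (G.finish v u) [] := by
  rw [extSum_nil, extSum, Finset.mul_sum]
  refine Finset.sum_le_sum fun w hw => h v u w (G.adm_append.2 ⟨hu, ?_⟩)
  exact (G.mem_paths.1 hw).2

lemma IsSupermul.le_extSum {f : V → List E → ℝ} (h : G.IsSupermul f) (n : ℕ) {v : V} {u : List E}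
    (hu : G.Adm v u) : f v u * G.extSum f n (G.finish v u) [] ≤ G.extSum f n v u := by
  rw [extSum_nil, extSum, Finset.mul_sum]
  refine Finset.sum_le_sum fun w hw => h v u w (G.adm_append.2 ⟨hu, ?_⟩)
  exact (G.mem_paths.1 hw).2

lemma extSum_add (f : V → List E → ℝ) (m n : ℕ) (v : V) :
    G.extSum f (m + n) v [] = ∑ u ∈ G.paths m v, G.extSum f n v u := by
  rw [extSum_nil, sum_paths_add]
  rfl

lemma outEdges_nonempty (hconn : G.StronglyConnected) (v : V) : (G.outEdges v).Nonempty := by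
  obtain ⟨w, hw, hp⟩ := hconn v v
  cases w with
  | nil => exact (hw rfl).elim
  | cons e w => exact ⟨e, G.mem_outEdges.2 hp.1⟩

namespace IsWordWeight

variable {f : V → List E → ℝ} {C : ℝ}

lemma extSum_succ_le (hf : G.IsWordWeight f C) (n : ℕ) {v : V} {u : List E} (hu : G.Adm v u) :
    G.extSum f (n + 1) v u ≤ C * Fintype.card E * G.extSum f n v u := by
  have hC : 0 ≤ C := zero_le_one.trans hf.one_le
  rw [extSum, sum_paths_succ, extSum, Finset.mul_sum]
  refine Finset.sum_le_sum fun w hw => ?_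
  have hadm : G.Adm v (u ++ w) := G.adm_append.2 ⟨hu, (G.mem_paths.1 hw).2⟩
  refine (Finset.sum_le_card_nsmul _ _ (C * f v (u ++ w)) fun e he => ?_).trans ?_
  · rw [← List.append_assoc]
    refine hf.snoc_le _ _ _ (G.adm_append.2 ⟨hadm, ?_⟩)
    rw [adm_singleton, finish_append]
    exact G.mem_outEdges.1 he
  · rw [nsmul_eq_mul]
    have h1 : ((G.outEdges (G.finish (G.finish v u) w)).card : ℝ) ≤ Fintype.card E := by
      exact_mod_cast Finset.card_le_univ _
    have h2 : 0 ≤ C * f v (u ++ w) := mul_nonneg hC (hf.pos _ _).le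
    calc _ ≤ Fintype.card E * (C * f v (u ++ w)) := mul_le_mul_of_nonneg_right h1 h2
      _ = _ := by ring

lemma extSum_le_succ (hf : G.IsWordWeight f C) (hconn : G.StronglyConnected) (n : ℕ) {v : V}
    {u : List E} (hu : G.Adm v u) : G.extSum f n v u ≤ C * G.extSum f (n + 1) v u := by
  have hC : 0 ≤ C := zero_le_one.trans hf.one_le
  rw [extSum, extSum, sum_paths_succ, Finset.mul_sum]
  refine Finset.sum_le_sum fun w hw => ?_
  have hadm : G.Adm v (u ++ w) := G.adm_append.2 ⟨hu, (G.mem_paths.1 hw).2⟩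
  obtain ⟨e, he⟩ := outEdges_nonempty hconn (G.finish (G.finish v u) w)
  refine (hf.le_snoc v (u ++ w) e (G.adm_append.2 ⟨hadm, ?_⟩)).trans ?_
  · rw [adm_singleton, finish_append]
    exact G.mem_outEdges.1 he
  · refine mul_le_mul_of_nonneg_left ?_ hC
    rw [List.append_assoc]
    exact Finset.single_le_sum (f := fun e => f v (u ++ (w ++ [e])))
      (fun _ _ => (hf.pos _ _).le) he

lemma extSum_nonneg (hf : G.IsWordWeight f C) (n : ℕ) (v : V) (u : List E) :
    0 ≤ G.extSum f n v u := Finset.sum_nonneg fun _ _ => (hf.pos _ _).le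

lemma extSum_pos (hf : G.IsWordWeight f C) (hconn : G.StronglyConnected) (n : ℕ) {v : V}
    {u : List E} (hu : G.Adm v u) : 0 < G.extSum f n v u := by
  have hC : 0 < C := zero_lt_one.trans_le hf.one_le
  induction n with
  | zero =>
    rw [extSum_zero]
    exact hf.pos _ _
  | succ n ih => exact pos_of_mul_pos_right (ih.trans_le (hf.extSum_le_succ hconn n hu)) hC.le

lemma extSum_le_pow (hf : G.IsWordWeight f C) (n : ℕ) {v : V} {u : List E} (hu : G.Adm v u) :
    G.extSum f n v u ≤ (C * Fintype.card E) ^ n * f v u := by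
  have hC : 0 ≤ C := zero_le_one.trans hf.one_le
  induction n with
  | zero => simp [extSum_zero]
  | succ n ih =>
    refine (hf.extSum_succ_le n hu).trans ?_
    rw [pow_succ', mul_assoc (C * _)]
    exact mul_le_mul_of_nonneg_left ih (by positivity)

lemma extSum_add_le (hf : G.IsWordWeight f C) (m n : ℕ) {v : V} {u : List E} (hu : G.Adm v u) :
    G.extSum f (n + m) v u ≤ (C * Fintype.card E) ^ m * G.extSum f n v u := by
  have hC : 0 ≤ C := zero_le_one.trans hf.one_le
  induction m with
  | zero => simp
  | succ m ih =>
    refine (hf.extSum_succ_le (n + m) hu).trans ?_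
    rw [pow_succ', mul_assoc (C * _)]
    exact mul_le_mul_of_nonneg_left ih (by positivity)

/-- For a supermultiplicative weight the sums from different vertices are comparable. -/
lemma exists_comparable [Finite V] (hf : G.IsWordWeight f C) (hconn : G.StronglyConnected)
    (hsup : G.IsSupermul f) :
    ∃ B : ℝ, 0 < B ∧ ∀ n v v', G.extSum f n v' [] ≤ B * G.extSum f n v [] := by
  have := Fintype.ofFinite V
  have hC : 0 ≤ C := zero_le_one.trans hf.one_le
  have h1 : ∀ x : V × V, ∃ B : ℝ, 0 ≤ B ∧ ∀ n, G.extSum f n x.2 [] ≤ B * G.extSum f n x.1 [] := by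
    rintro ⟨v, v'⟩
    obtain ⟨u, -, hu⟩ := hconn v v'
    rw [isPath_iff] at hu
    -- Words from `v'` prefixed by `u` are words from `v` that are longer by `u.length`; shortening
    -- them again costs a factor `C * Fintype.card E` per letter.
    refine ⟨(C * Fintype.card E) ^ u.length / f v u,
      div_nonneg (by positivity) (hf.pos _ _).le, fun n => ?_⟩
    have h2 := hsup.le_extSum n hu.1
    rw [hu.2] at h2
    have h3 : G.extSum f n v u ≤ G.extSum f (n + u.length) v [] := by
      rw [add_comm, extSum_add]
      exact Finset.single_le_sum (f := fun u => G.extSum f n v u)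
        (fun _ _ => hf.extSum_nonneg _ _ _) (G.mem_paths.2 ⟨rfl, hu.1⟩)
    have h4 := hf.extSum_add_le u.length n (G.adm_nil v)
    rw [div_mul_eq_mul_div, le_div_iff₀ (hf.pos _ _), mul_comm]
    exact h2.trans (h3.trans h4)
  choose B hB0 hB using h1
  refine ⟨∑ x, B x + 1, add_pos_of_nonneg_of_pos (Finset.sum_nonneg fun x _ => hB0 x) one_pos,
    fun n v v' => (hB (v, v') n).trans ?_⟩
  refine mul_le_mul_of_nonneg_right ?_ (hf.extSum_nonneg _ _ _)
  have := Finset.single_le_sum (fun x _ => hB0 x) (Finset.mem_univ (v, v'))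
  linarith

end IsWordWeight

end

section

variable [Fintype E] [Fintype V]

/-- The sum of the weights of all admissible words of length `n`. -/
noncomputable def total (G : BoxLikeGIFS V E) (f : V → List E → ℝ) (n : ℕ) : ℝ :=
  ∑ v, G.extSum f n v []

namespace IsWordWeight

variable {f : V → List E → ℝ} {C : ℝ}

lemma extSum_le_total (hf : G.IsWordWeight f C) (n : ℕ) (v : V) :
    G.extSum f n v [] ≤ G.total f n :=
  Finset.single_le_sum (f := fun v => G.extSum f n v []) (fun _ _ => hf.extSum_nonneg _ _ _)
    (Finset.mem_univ v)

lemma total_pos [Nonempty V] (hf : G.IsWordWeight f C) (hconn : G.StronglyConnected) (n : ℕ) :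
    0 < G.total f n :=
  Finset.sum_pos (fun v _ => hf.extSum_pos hconn n (G.adm_nil v)) Finset.univ_nonempty

lemma total_add_le (hf : G.IsWordWeight f C) (hsub : G.IsSubmul f) (m n : ℕ) :
    G.total f (m + n) ≤ G.total f m * G.total f n := by
  rw [total, total, Finset.sum_mul]
  refine Finset.sum_le_sum fun v _ => ?_
  rw [extSum_add, extSum_nil, Finset.sum_mul]
  refine Finset.sum_le_sum fun u hu => (hsub.extSum_le n (G.mem_paths.1 hu).2).trans ?_
  exact mul_le_mul_of_nonneg_left (hf.extSum_le_total n _) (hf.pos _ _).le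

lemma total_le_of_comparable {B : ℝ}
    (hB : ∀ n v v', G.extSum f n v' [] ≤ B * G.extSum f n v []) (n : ℕ) (v : V) :
    G.total f n ≤ Fintype.card V * B * G.extSum f n v [] := by
  have := Finset.sum_le_card_nsmul Finset.univ (fun v' => G.extSum f n v' [])
    (B * G.extSum f n v []) fun v' _ => hB n v v'
  rw [nsmul_eq_mul, Finset.card_univ, ← mul_assoc] at this
  exact this

lemma total_mul_le (hf : G.IsWordWeight f C) (hsup : G.IsSupermul f) {B : ℝ}
    (hB : ∀ n v v', G.extSum f n v' [] ≤ B * G.extSum f n v []) (hB0 : 0 < B) (m n : ℕ) :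
    G.total f m * G.total f n ≤ Fintype.card V * B * G.total f (m + n) := by
  rw [total, Finset.sum_mul, show G.total f (m + n) = ∑ v, G.extSum f (m + n) v [] from rfl,
    Finset.mul_sum]
  refine Finset.sum_le_sum fun v _ => ?_
  rw [extSum_add, extSum_nil, Finset.sum_mul, Finset.mul_sum]
  refine Finset.sum_le_sum fun u hu => ?_
  have hu' := (G.mem_paths.1 hu).2
  calc f v u * G.total f n
      ≤ f v u * (Fintype.card V * B * G.extSum f n (G.finish v u) []) :=
        mul_le_mul_of_nonneg_left (total_le_of_comparable hB n _) (hf.pos _ _).le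
    _ = Fintype.card V * B * (f v u * G.extSum f n (G.finish v u) []) := by ring
    _ ≤ _ := mul_le_mul_of_nonneg_left (hsup.le_extSum n hu') (by positivity)

/-- The exponential growth rate of the sums of weights exists. -/
lemma exists_tendsto_log_total [Nonempty V] (hf : G.IsWordWeight f C) (hconn : G.StronglyConnected)
    (h : G.IsSubmul f ∨ G.IsSupermul f) :
    ∃ L, Tendsto (fun n : ℕ => Real.log (G.total f n) / n) atTop (𝓝 L) := by
  have hE := nonempty_edges hconn
  have hC : 0 < C := zero_lt_one.trans_le hf.one_le
  have hpos := hf.total_pos hconn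
  have hcard : (0 : ℝ) < Fintype.card E := by exact_mod_cast Fintype.card_pos
  have hstep : ∀ n, |Real.log (G.total f (n + 1)) - Real.log (G.total f n)| ≤
      |Real.log (C * Fintype.card E)| + |Real.log C| := by
    intro n
    have h1 : G.total f (n + 1) ≤ C * Fintype.card E * G.total f n := by
      rw [total, total, Finset.mul_sum]
      exact Finset.sum_le_sum fun v _ => hf.extSum_succ_le n (G.adm_nil v)
    have h2 : G.total f n ≤ C * G.total f (n + 1) := by
      rw [total, total, Finset.mul_sum]
      exact Finset.sum_le_sum fun v _ => hf.extSum_le_succ hconn n (G.adm_nil v)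
    have h3 := log_mul_le_of_le (hpos (n + 1)) (hpos n) one_pos (by simpa using h1)
    have h4 := log_mul_le_of_le (hpos n) (hpos (n + 1)) one_pos (by simpa using h2)
    rw [Real.log_one] at h3 h4
    rw [abs_le]
    constructor <;>
      linarith [abs_nonneg (Real.log C), abs_nonneg (Real.log (C * Fintype.card E))]
  rcases h with hsub | hsup
  · refine exists_tendsto_div_of_almost_additive hstep (Or.inl fun m n => ?_)
    have h1 := Real.log_le_log (hpos _) (hf.total_add_le hsub m n)
    rw [Real.log_mul (hpos m).ne' (hpos n).ne'] at h1
    have := (abs_nonneg _).trans (hstep 0)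
    linarith
  · obtain ⟨B, hB0, hB⟩ := hf.exists_comparable hconn hsup
    refine exists_tendsto_div_of_almost_additive
      (C := |Real.log (C * Fintype.card E)| + |Real.log C| + |Real.log (Fintype.card V * B)|)
      (fun n => (hstep n).trans (by linarith [abs_nonneg (Real.log (Fintype.card V * B))]))
      (Or.inr fun m n => ?_)
    have h1 := log_mul_le_of_mul_le (hpos (m + n)) (hpos m) (hpos n)
      (hf.total_mul_le hsup hB hB0 m n)
    linarith [abs_nonneg (Real.log C), abs_nonneg (Real.log (C * Fintype.card E))]

lemma exists_lt_total [Nonempty V] (hf : G.IsWordWeight f C) (hconn : G.StronglyConnected) {L : ℝ}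
    (hL : Tendsto (fun n : ℕ => Real.log (G.total f n) / n) atTop (𝓝 L)) (hL0 : 0 < L) (K : ℝ) :
    ∃ n, 1 ≤ n ∧ K < G.total f n := by
  have hpos := hf.total_pos hconn
  have h1 : Tendsto (fun n : ℕ => Real.log (G.total f n) / n * n) atTop atTop :=
    hL.pos_mul_atTop hL0 tendsto_natCast_atTop_atTop
  obtain ⟨n, hn, hn1⟩ := ((h1.eventually_gt_atTop (Real.log (|K| + 1))).and
    (eventually_ge_atTop 1)).exists
  refine ⟨n, hn1, ?_⟩
  have hn0 : (n : ℝ) ≠ 0 := by exact_mod_cast (by omega : n ≠ 0)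
  rw [div_mul_cancel₀ _ hn0] at hn
  have := (Real.log_lt_log_iff (by positivity) (hpos n)).1 hn
  linarith [le_abs_self K]

variable {ρ : List E → ℝ} {a b : ℝ}

/-- With a negative growth rate the weights of all words have a finite sum, and the stopping words
are some of them. -/
lemma exists_sum_stopSet_le [Nonempty V] [Nonempty E] (hf : G.IsWordWeight f C)
    (hconn : G.StronglyConnected) (hρ : IsScale ρ a b) {L : ℝ}
    (hL : Tendsto (fun n : ℕ => Real.log (G.total f n) / n) atTop (𝓝 L)) (hL0 : L < 0) :
    ∃ B : ℝ, ∀ δ (hδ : 0 < δ) v, ∑ w ∈ hρ.stopSet (G := G) hδ v, f v w ≤ B := by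
  classical
  have hpos := hf.total_pos hconn
  have hsum : Summable (G.total f) := by
    have hr : Real.exp (L / 2) < 1 := by
      rw [← Real.exp_zero]
      exact Real.exp_lt_exp.2 (by linarith)
    refine summable_of_isBigO_nat (summable_geometric_of_lt_one (Real.exp_pos _).le hr) ?_
    refine Asymptotics.IsBigO.of_bound 1 ?_
    filter_upwards [hL.eventually_lt_const (show L < L / 2 by linarith), eventually_ge_atTop 1]
      with n hn hn1
    have hn0 : (0 : ℝ) < n := by exact_mod_cast hn1
    rw [div_lt_iff₀ hn0] at hn
    rw [one_mul, Real.norm_of_nonneg (hpos n).le, Real.norm_of_nonneg (by positivity),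
      ← Real.exp_nat_mul, ← Real.log_le_iff_le_exp (hpos n)]
    linarith
  refine ⟨∑' n, G.total f n, fun δ hδ v => ?_⟩
  set S := hρ.stopSet (G := G) hδ v with hS
  rw [← Finset.sum_fiberwise_of_maps_to (s := S) (t := S.image List.length) (g := List.length)
    fun w hw => Finset.mem_image_of_mem _ hw]
  refine le_trans (Finset.sum_le_sum fun n _ => ?_)
    (hsum.sum_le_tsum (S.image List.length) fun n _ => (hpos n).le)
  refine le_trans ?_ (hf.extSum_le_total n v)
  rw [extSum_nil]
  refine Finset.sum_le_sum_of_subset_of_nonneg (fun w hw => ?_) fun _ _ _ => (hf.pos _ _).le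
  rw [Finset.mem_filter, hS, hρ.mem_stopSet] at hw
  exact G.mem_paths.2 ⟨hw.2, hw.1.1⟩

/-- Take `N` with all `N`-step sums at least `1` and let `H` add up the extension sums over `n < N`.
Passing to the children of `u` replaces the term `f v u` of `H` by the `N`-step extension sum of
`u`, which is at least `f v u` by supermultiplicativity. So `H` can be pushed down to the stopping
words, where it is at most `K * f`. -/
lemma exists_le_sum_stopSet_of_supermul [Nonempty V] [Nonempty E] (hf : G.IsWordWeight f C)
    (hconn : G.StronglyConnected) (hsup : G.IsSupermul f) (hρ : IsScale ρ a b) {L : ℝ}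
    (hL : Tendsto (fun n : ℕ => Real.log (G.total f n) / n) atTop (𝓝 L)) (hL0 : 0 < L) :
    ∃ c : ℝ, 0 < c ∧ ∀ δ (hδ : 0 < δ), δ ≤ 1 → ∀ v,
      c ≤ ∑ w ∈ hρ.stopSet (G := G) hδ v, f v w := by
  have hC : 0 < C := zero_lt_one.trans_le hf.one_le
  have hcardE : (0 : ℝ) < Fintype.card E := by exact_mod_cast Fintype.card_pos
  have hcardV : (0 : ℝ) < Fintype.card V := by exact_mod_cast Fintype.card_pos
  obtain ⟨B, hB0, hB⟩ := hf.exists_comparable hconn hsup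
  obtain ⟨N, hN1, hN⟩ := hf.exists_lt_total hconn hL hL0 (Fintype.card V * B)
  have hZ : ∀ v, 1 ≤ G.extSum f N v [] := by
    intro v
    have h1 := hN.le.trans (total_le_of_comparable hB N v)
    exact le_of_mul_le_mul_left (by rwa [mul_one]) (mul_pos hcardV hB0)
  set H : V → List E → ℝ := fun v u => ∑ n ∈ Finset.range N, G.extSum f n v u with hH
  set K : ℝ := ∑ n ∈ Finset.range N, (C * Fintype.card E) ^ n with hK
  have hK0 : 0 < K :=
    Finset.sum_pos (fun n _ => by positivity) (Finset.nonempty_range_iff.2 (by omega))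
  refine ⟨1 / K, by positivity, fun δ hδ hδ1 v => ?_⟩
  have hstep : ∀ u, G.Adm v u → δ ≤ ρ u →
      H v u ≤ ∑ e ∈ G.outEdges (G.finish v u), H v (u ++ [e]) := by
    intro u hu _
    have h1 : ∑ e ∈ G.outEdges (G.finish v u), H v (u ++ [e]) =
        ∑ n ∈ Finset.range N, G.extSum f (n + 1) v u := by
      rw [Finset.sum_comm]
      exact Finset.sum_congr rfl fun n _ => sum_extSum_snoc f n v u
    have h2 := Finset.sum_range_succ (fun n => G.extSum f n v u) N
    rw [Finset.sum_range_succ', extSum_zero] at h2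
    have h3 := hsup.le_extSum N hu
    have h4 := mul_le_mul_of_nonneg_left (hZ (G.finish v u)) (hf.pos v u).le
    rw [h1]
    linarith
  have h1 := hρ.le_sum_stopSet (G := G) hδ v hδ1 hstep
  have h2 : 1 ≤ H v [] := by
    have : G.extSum f 0 v [] ≤ H v [] :=
      Finset.single_le_sum (f := fun n => G.extSum f n v [])
        (fun n _ => hf.extSum_nonneg _ _ _) (Finset.mem_range.2 (by omega))
    rwa [extSum_zero, hf.nil] at this
  have h3 : ∑ w ∈ hρ.stopSet (G := G) hδ v, H v w ≤ K * ∑ w ∈ hρ.stopSet (G := G) hδ v, f v w := by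
    rw [Finset.mul_sum]
    refine Finset.sum_le_sum fun w hw => ?_
    rw [hK, Finset.sum_mul]
    exact Finset.sum_le_sum fun n _ => hf.extSum_le_pow n ((hρ.mem_stopSet hδ v).1 hw).1
  rw [div_le_iff₀ hK0]
  linarith

/-- If all stopping sums at this scale were below `1`, splitting long words at their stopping
prefixes would bound the `n`-step sums uniformly in `n`, against the positive growth rate. -/
lemma exists_one_le_sum_stopSet_of_submul [Nonempty V] [Nonempty E] (hf : G.IsWordWeight f C)
    (hconn : G.StronglyConnected) (hsub : G.IsSubmul f) (hρ : IsScale ρ a b) {L : ℝ}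
    (hL : Tendsto (fun n : ℕ => Real.log (G.total f n) / n) atTop (𝓝 L)) (hL0 : 0 < L) {δ : ℝ}
    (hδ : 0 < δ) (hδ1 : δ ≤ 1) : ∃ v, 1 ≤ ∑ w ∈ hρ.stopSet (G := G) hδ v, f v w := by
  by_contra! hlt
  obtain ⟨M, hM⟩ := hρ.exists_length_bound hδ
  set B : ℝ := ∑ n ∈ Finset.range (M + 1), G.total f n with hB
  have hpos := hf.total_pos hconn
  have hB0 : 0 ≤ B := Finset.sum_nonneg fun n _ => (hpos n).le
  have key : ∀ n v, G.extSum f n v [] ≤ B := by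
    intro n
    induction n using Nat.strong_induction_on with
    | _ n ih =>
      intro v
      rcases le_or_gt n M with hn | hn
      · refine (hf.extSum_le_total n v).trans ?_
        exact Finset.single_le_sum (f := G.total f) (fun n _ => (hpos n).le)
          (Finset.mem_range.2 (by omega))
      -- Live words are shorter than `M < n`, so the natural subtraction `n - u.length` does not
      -- truncate and drops by exactly one with the next letter.
      · have hstep : ∀ u, G.Adm v u → δ ≤ ρ u → G.extSum f (n - u.length) v u ≤
            ∑ e ∈ G.outEdges (G.finish v u), G.extSum f (n - (u ++ [e]).length) v (u ++ [e]) := by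
          intro u _ hu
          have hl := hM u hu
          have h1 : n - u.length = n - (u.length + 1) + 1 := by omega
          simp only [List.length_append, List.length_singleton]
          rw [sum_extSum_snoc, ← h1]
        have h1 := hρ.le_sum_stopSet (G := G) hδ v hδ1
          (f := fun u => G.extSum f (n - u.length) v u) hstep
        simp only [List.length_nil, Nat.sub_zero] at h1
        refine h1.trans ?_
        calc ∑ w ∈ hρ.stopSet (G := G) hδ v, G.extSum f (n - w.length) v w
            ≤ ∑ w ∈ hρ.stopSet (G := G) hδ v, f v w * B := by
              refine Finset.sum_le_sum fun w hw => ?_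
              rw [hρ.mem_stopSet] at hw
              refine (hsub.extSum_le _ hw.1).trans ?_
              refine mul_le_mul_of_nonneg_left (ih _ ?_ _) (hf.pos _ _).le
              have hne : w ≠ [] := by
                rintro rfl
                have := hw.2.1
                rw [hρ.nil] at this
                linarith
              have := List.length_pos_of_ne_nil hne
              omega
          _ = (∑ w ∈ hρ.stopSet (G := G) hδ v, f v w) * B := by rw [Finset.sum_mul]
          _ ≤ B := mul_le_of_le_one_left hB0 (hlt v).le
  obtain ⟨n, -, hn⟩ := hf.exists_lt_total hconn hL hL0 (Fintype.card V * B)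
  have := Finset.sum_le_card_nsmul Finset.univ (fun v' => G.extSum f n v' []) B fun v' _ => key n v'
  rw [nsmul_eq_mul, Finset.card_univ] at this
  exact absurd this (not_le.2 hn)

lemma exists_le_sum_stopSet [Nonempty V] [Nonempty E] (hf : G.IsWordWeight f C)
    (hconn : G.StronglyConnected) (h : G.IsSubmul f ∨ G.IsSupermul f) (hρ : IsScale ρ a b) {L : ℝ}
    (hL : Tendsto (fun n : ℕ => Real.log (G.total f n) / n) atTop (𝓝 L)) (hL0 : 0 < L) :
    ∃ c : ℝ, 0 < c ∧ ∀ δ (hδ : 0 < δ), δ ≤ 1 → ∃ v,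
      c ≤ ∑ w ∈ hρ.stopSet (G := G) hδ v, f v w := by
  rcases h with h | h
  · exact ⟨1, one_pos, fun δ hδ hδ1 =>
      hf.exists_one_le_sum_stopSet_of_submul hconn h hρ hL hL0 hδ hδ1⟩
  · obtain ⟨c, hc, h⟩ := hf.exists_le_sum_stopSet_of_supermul hconn h hρ hL hL0
    exact ⟨c, hc, fun δ hδ hδ1 => ⟨Classical.arbitrary V, h δ hδ hδ1 _⟩⟩

end IsWordWeight

end

end BoxLikeGIFS

/-! ### The modified singular value function -/

lemma rpow_bounds {a x t T : ℝ} (ha : 0 < a) (hax : a ≤ x) (hx : x ≤ 1) (ht : |t| ≤ T) :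
    a ^ T ≤ x ^ t ∧ x ^ t ≤ a ^ (-T) := by
  have hx0 : 0 < x := ha.trans_le hax
  have ha1 : a ≤ 1 := hax.trans hx
  obtain ⟨h1, h2⟩ := abs_le.1 ht
  constructor
  · calc a ^ T ≤ x ^ T := Real.rpow_le_rpow ha.le hax ((abs_nonneg t).trans ht)
      _ ≤ x ^ t := Real.rpow_le_rpow_of_exponent_ge hx0 hx h2
  · calc x ^ t ≤ x ^ (-T) := Real.rpow_le_rpow_of_exponent_ge hx0 hx h1
      _ ≤ a ^ (-T) := Real.rpow_le_rpow_of_nonpos ha hax (by linarith [(abs_nonneg t).trans ht])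

/-- The two slope bounds make `L` Lipschitz, and the negative upper one forces a sign change and
strict decrease. -/
lemma exists_unique_zero_of_slope_bounds {L : ℝ → ℝ} {x y : ℝ} (hx : x < 0)
    (h : ∀ s s', s ≤ s' → L s' ≤ L s + (s' - s) * x ∧ L s + (s' - s) * y ≤ L s') :
    ∃ γ, L γ = 0 ∧ (∀ s, s < γ → 0 < L s) ∧ ∀ s, γ < s → L s < 0 := by
  have hcont : Continuous L := by
    refine LipschitzWith.continuous (K := (|x| + |y|).toNNReal)
      (LipschitzWith.of_dist_le_mul fun s s' => ?_)
    rw [Real.coe_toNNReal _ (by positivity), Real.dist_eq, Real.dist_eq]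
    have key : ∀ s s', s ≤ s' → |L s' - L s| ≤ (|x| + |y|) * |s' - s| := by
      intro s s' hs
      obtain ⟨h1, h2⟩ := h s s' hs
      have h0 : 0 ≤ s' - s := by linarith
      rw [abs_of_nonneg h0, abs_le]
      constructor <;> nlinarith [neg_abs_le y, le_abs_self x, abs_nonneg x, abs_nonneg y]
    rcases le_total s s' with hs | hs
    · rw [abs_sub_comm (L s), abs_sub_comm s]
      exact key s s' hs
    · exact key s' s hs
  obtain ⟨γ, hγ⟩ : (0 : ℝ) ∈ Set.range L := by
    have habs : |L 0| / x * x = |L 0| := div_mul_cancel₀ _ hx.ne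
    have hdiv : |L 0| / x ≤ 0 := div_nonpos_of_nonneg_of_nonpos (abs_nonneg _) hx.le
    refine mem_range_of_exists_le_of_exists_ge hcont ⟨-(|L 0| / x), ?_⟩ ⟨|L 0| / x, ?_⟩
    · have := (h 0 (-(|L 0| / x)) (by linarith)).1
      have h2 := le_abs_self (L 0)
      linarith
    · have := (h (|L 0| / x) 0 hdiv).1
      have h2 := neg_abs_le (L 0)
      linarith
  refine ⟨γ, hγ, fun s hs => ?_, fun s hs => ?_⟩
  · have := (h s γ hs.le).1
    nlinarith
  · have := (h γ s hs.le).1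
    nlinarith

namespace BoxLikeGIFS

variable {V E : Type*} {G : BoxLikeGIFS V E} {p : E → ℝ} {μ : V → Measure (Fin 2 → ℝ)} {q : ℝ}

/-- The modified singular value function, written so that all factors but the last one are
multiplicative along paths. -/
noncomputable def svf (G : BoxLikeGIFS V E) (p : E → ℝ) (q : ℝ) (t : V → Fin 2 → ℝ) (s : ℝ) (v : V)
    (w : List E) : ℝ :=
  weight p w ^ q * (∏ i, G.side w i ^ t v i) * G.short w ^ (s - ∑ i, t v i)

/-- The exponents `t` are compatible with the action of the words on the coordinates. -/
def IsCompatible (G : BoxLikeGIFS V E) (t : V → Fin 2 → ℝ) : Prop :=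
  ∀ v w i, G.Adm v w → t (G.finish v w) (G.idx w i) = t v i

lemma idx_bijective (w : List E) : Function.Bijective (G.idx w) :=
  Finite.injective_iff_bijective.1 (G.idx_injective w)

lemma IsCompatible.sum_finish {t : V → Fin 2 → ℝ} (ht : G.IsCompatible t) {v : V} {w : List E}
    (hw : G.Adm v w) : ∑ i, t (G.finish v w) i = ∑ i, t v i := by
  rw [← (idx_bijective (G := G) w).sum_comp]
  exact Finset.sum_congr rfl fun i _ => ht v w i hw

lemma IsCompatible.prod_append {t : V → Fin 2 → ℝ} (ht : G.IsCompatible t) {v : V} {u : List E}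
    (hu : G.Adm v u) (w : List E) : ∏ i, G.side (u ++ w) i ^ t v i =
      (∏ i, G.side u i ^ t v i) * ∏ i, G.side w i ^ t (G.finish v u) i := by
  rw [← (idx_bijective (G := G) u).prod_comp fun i => G.side w i ^ t (G.finish v u) i,
    ← Finset.prod_mul_distrib]
  refine Finset.prod_congr rfl fun i _ => ?_
  rw [side_append, Real.mul_rpow (G.side_pos _ _).le (G.side_pos _ _).le, ht v u i hu]

section

variable [Fintype E]

lemma svf_pos (hp : G.IsProbVector p) (t : V → Fin 2 → ℝ) (s : ℝ) (v : V) (w : List E) :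
    0 < G.svf p q t s v w :=
  mul_pos (mul_pos (Real.rpow_pos_of_pos (hp.weight_pos w) _)
    (Finset.prod_pos fun i _ => Real.rpow_pos_of_pos (G.side_pos w i) _))
    (Real.rpow_pos_of_pos (G.short_pos w) _)

/-- The last factor is the whole defect of multiplicativity. Its base is at least `1` by
`short_mul_le`, so the sign of `s - ∑ i, t v i` decides between submultiplicativity and
supermultiplicativity. -/
lemma svf_append (hp : G.IsProbVector p) {t : V → Fin 2 → ℝ} (ht : G.IsCompatible t) (s : ℝ)
    {v : V} {u w : List E} (huw : G.Adm v (u ++ w)) : G.svf p q t s v (u ++ w) =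
      G.svf p q t s v u * G.svf p q t s (G.finish v u) w *
        (G.short (u ++ w) / (G.short u * G.short w)) ^ (s - ∑ i, t v i) := by
  have hu := (G.adm_append.1 huw).1
  have h1 := G.short_pos u
  have h2 := G.short_pos w
  rw [svf, svf, svf, weight_append, Real.mul_rpow (hp.weight_pos u).le (hp.weight_pos w).le,
    ht.prod_append hu, ht.sum_finish hu, Real.div_rpow (G.short_pos _).le (by positivity),
    Real.mul_rpow h1.le h2.le]
  have h3 := Real.rpow_pos_of_pos h1 (s - ∑ i, t v i)
  have h4 := Real.rpow_pos_of_pos h2 (s - ∑ i, t v i)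
  field_simp

lemma isSubmul_svf (hp : G.IsProbVector p) {t : V → Fin 2 → ℝ} (ht : G.IsCompatible t) {s : ℝ}
    (hs : ∀ v, s ≤ ∑ i, t v i) : G.IsSubmul (G.svf p q t s) := by
  intro v u w huw
  rw [svf_append hp ht s huw]
  refine mul_le_of_le_one_right
    (mul_pos (svf_pos hp _ _ _ _) (svf_pos hp _ _ _ _)).le ?_
  refine Real.rpow_le_one_of_one_le_of_nonpos ?_ (by linarith [hs v])
  rw [one_le_div (mul_pos (G.short_pos u) (G.short_pos w))]
  exact G.short_mul_le u w

lemma isSupermul_svf (hp : G.IsProbVector p) {t : V → Fin 2 → ℝ} (ht : G.IsCompatible t) {s : ℝ}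
    (hs : ∀ v, ∑ i, t v i ≤ s) : G.IsSupermul (G.svf p q t s) := by
  intro v u w huw
  rw [svf_append hp ht s huw]
  refine le_mul_of_one_le_right
    (mul_pos (svf_pos hp _ _ _ _) (svf_pos hp _ _ _ _)).le ?_
  refine Real.one_le_rpow ?_ (by linarith [hs v])
  rw [one_le_div (mul_pos (G.short_pos u) (G.short_pos w))]
  exact G.short_mul_le u w

lemma IsProbVector.le_one (hp : G.IsProbVector p) (e : E) : p e ≤ 1 := by
  classical
  rw [← hp.2 (G.src e)]
  exact Finset.single_le_sum (fun e _ => (hp.1 e).le) (by simp)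

/-- One letter multiplies the weight by four powers with bases in `[a, 1]` and exponents of absolute
value at most `T`. -/
lemma exists_isWordWeight_svf [Finite V] [Nonempty E] (hp : G.IsProbVector p)
    {t : V → Fin 2 → ℝ} (ht : G.IsCompatible t) (s : ℝ) :
    ∃ C, G.IsWordWeight (G.svf p q t s) C := by
  have := Fintype.ofFinite V
  obtain ⟨a₀, b, ha₀, hb, hab⟩ := G.exists_ratio_bounds
  obtain ⟨e₀, he₀⟩ := Finite.exists_min p
  set a := min a₀ (p e₀) with ha_def
  have ha : 0 < a := lt_min ha₀ (hp.1 e₀)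
  have hap : ∀ e, a ≤ p e := fun e => (min_le_right _ _).trans (he₀ e)
  have har : ∀ e i, a ≤ |G.ratio e i| := fun e i => (min_le_left _ _).trans (hab e i).1
  have hρ := G.isScale_short ha hb fun e i => ⟨har e i, (hab e i).2⟩
  have ha1 : a ≤ 1 := (hap e₀).trans (hp.le_one e₀)
  set T := |q| + ∑ v, (∑ i, |t v i| + |s - ∑ i, t v i|) with hT
  have hTv : ∀ v, ∑ i, |t v i| + |s - ∑ i, t v i| ≤ ∑ v, (∑ i, |t v i| + |s - ∑ i, t v i|) :=
    fun v => Finset.single_le_sum (f := fun v => ∑ i, |t v i| + |s - ∑ i, t v i|)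
      (fun v _ => by positivity) (Finset.mem_univ v)
  have hqT : |q| ≤ T := le_add_of_nonneg_right (by positivity)
  have htT : ∀ v i, |t v i| ≤ T := fun v i => by
    have := Finset.single_le_sum (f := fun i => |t v i|) (fun i _ => abs_nonneg _)
      (Finset.mem_univ i)
    linarith [hTv v, abs_nonneg q, abs_nonneg (s - ∑ i, t v i)]
  have hsT : ∀ v, |s - ∑ i, t v i| ≤ T := fun v => by
    have : 0 ≤ ∑ i, |t v i| := by positivity
    linarith [hTv v, abs_nonneg q]
  have hfac : ∀ v u e, G.Adm v (u ++ [e]) → ∃ x y z x' : ℝ,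
      G.svf p q t s v (u ++ [e]) = x * (y * z) * x' * G.svf p q t s v u ∧
      (a ^ T ≤ x ∧ x ≤ a ^ (-T)) ∧ (a ^ T ≤ y ∧ y ≤ a ^ (-T)) ∧ (a ^ T ≤ z ∧ z ≤ a ^ (-T)) ∧
      (a ^ T ≤ x' ∧ x' ≤ a ^ (-T)) := by
    intro v u e hue
    have hu := (G.adm_append.1 hue).1
    have hsu := G.short_pos u
    refine ⟨p e ^ q, |G.ratio e 0| ^ t (G.finish v u) 0, |G.ratio e 1| ^ t (G.finish v u) 1,
      (G.short (u ++ [e]) / G.short u) ^ (s - ∑ i, t v i), ?_, ?_, ?_, ?_, ?_⟩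
    · have hw : weight p [e] = p e := by simp [weight]
      rw [svf, svf, weight_append, Real.mul_rpow (hp.weight_pos u).le (hp.weight_pos _).le,
        ht.prod_append hu, Real.div_rpow (G.short_pos _).le hsu.le, hw]
      have h3 := Real.rpow_pos_of_pos hsu (s - ∑ i, t v i)
      simp only [Fin.prod_univ_two, side_singleton]
      field_simp
    · exact rpow_bounds ha (hap e) (hp.le_one e) hqT
    · exact rpow_bounds ha (har e 0) (G.abs_ratio_lt_one e 0).le (htT _ _)
    · exact rpow_bounds ha (har e 1) (G.abs_ratio_lt_one e 1).le (htT _ _)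
    · refine rpow_bounds ha ?_ ?_ (hsT v)
      · rw [le_div_iff₀ hsu]
        exact hρ.le_snoc u e
      · rw [div_le_one hsu]
        exact (hρ.snoc_lt u e).le
  have haT : 0 < a ^ T := Real.rpow_pos_of_pos ha T
  have haT' : a ^ (-T) = (a ^ T)⁻¹ := Real.rpow_neg ha.le T
  have hA0 : 0 < a ^ (-T) := Real.rpow_pos_of_pos ha _
  have hTnn : 0 ≤ T := (abs_nonneg q).trans hqT
  refine ⟨a ^ (-T) * (a ^ (-T) * a ^ (-T)) * a ^ (-T), svf_pos hp t s, fun v => ?_, ?_, ?_, ?_⟩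
  · simp [svf, short]
  · have h1 : 1 ≤ a ^ (-T) := Real.one_le_rpow_of_pos_of_le_one_of_nonpos ha ha1 (by linarith)
    exact one_le_mul_of_one_le_of_one_le
      (one_le_mul_of_one_le_of_one_le h1 (one_le_mul_of_one_le_of_one_le h1 h1)) h1
  · intro v u e hue
    obtain ⟨x, y, z, x', h, hx, hy, hz, hx'⟩ := hfac v u e hue
    have hpos := svf_pos (q := q) hp t s v u
    have hx0 := haT.trans_le hx.1
    have hy0 := haT.trans_le hy.1
    have hz0 := haT.trans_le hz.1
    have hx'0 := haT.trans_le hx'.1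
    rw [h]
    gcongr
    · exact hx.2
    · exact hy.2
    · exact hz.2
    · exact hx'.2
  · intro v u e hue
    obtain ⟨x, y, z, x', h, hx, hy, hz, hx'⟩ := hfac v u e hue
    have hpos := svf_pos (q := q) hp t s v u
    have h1 : a ^ T * (a ^ T * a ^ T) * a ^ T ≤ x * (y * z) * x' := by
      have hx0 := haT.trans_le hx.1
      have hy0 := haT.trans_le hy.1
      have hz0 := haT.trans_le hz.1
      gcongr
      · exact hx.1
      · exact hy.1
      · exact hz.1
      · exact hx'.1
    rw [h, haT']
    calc G.svf p q t s v u = (a ^ T)⁻¹ * ((a ^ T)⁻¹ * (a ^ T)⁻¹) * (a ^ T)⁻¹ *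
          (a ^ T * (a ^ T * a ^ T) * a ^ T * G.svf p q t s v u) := by field_simp
      _ ≤ _ := by gcongr

end

end BoxLikeGIFS

namespace BoxLikeGIFS

variable {V E : Type*} {G : BoxLikeGIFS V E} {p : E → ℝ} {μ : V → Measure (Fin 2 → ℝ)} {q : ℝ}

/-! ### The pressure -/

/-- Writing the exponent of α₂ as the spectrum belonging to the short side plus `s - ∑ i, tau μ q v
i` removes the case distinction between long and short sides; compatibility moves the spectra from
the terminal to the initial vertex. -/
lemma phi_eq_svf (ht : G.IsCompatible (tau μ q)) (s : ℝ) {v : V} {w : List E} (hw : G.Adm v w) :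
    G.phi p μ s q w (G.finish v w) = G.svf p q (tau μ q) s v w := by
  have h1 : G.tauWord μ q w (G.finish v w) = tau μ q v (G.longDir w) := by
    rw [← ht v w _ hw, ← projIndex_eq]
    rfl
  have hs := G.short_pos w
  have h2 : s - tau μ q v (G.longDir w) =
      tau μ q v (G.longDir w + 1) + (s - ∑ i, tau μ q v i) := by
    have : ∑ i, tau μ q v i = tau μ q v (G.longDir w) + tau μ q v (G.longDir w + 1) := by
      rw [Fin.sum_univ_two]
      rcases Fin.exists_fin_two.1 ⟨G.longDir w, rfl⟩ with h | h
      · rw [h]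
        rfl
      · rw [h, add_comm]
        rfl
    linarith
  have h3 : ∏ i, G.side w i ^ tau μ q v i =
      G.long w ^ tau μ q v (G.longDir w) * G.short w ^ tau μ q v (G.longDir w + 1) := by
    rw [← side_longDir, ← side_longDir_add_one, Fin.prod_univ_two]
    rcases Fin.exists_fin_two.1 ⟨G.longDir w, rfl⟩ with h | h
    · rw [h]
      rfl
    · rw [h, mul_comm]
      rfl
  rw [phi, h1, (G.alpha_eq w).1, (G.alpha_eq w).2, h2, Real.rpow_add hs, svf, h3, weight]
  ring

section

variable [Fintype E]

lemma svMatrix_eq (ht : G.IsCompatible (tau μ q)) (s : ℝ) (k : ℕ) (v v' : V) :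
    G.svMatrix p μ s q k v v' = open Classical in
      ∑ w ∈ G.paths k v with G.finish v w = v', G.svf p q (tau μ q) s v w := by
  classical
  rw [svMatrix, Matrix.of_apply]
  refine Finset.sum_bij (fun w _ => List.ofFn w) ?_ ?_ ?_ ?_
  · intro w hw
    rw [Finset.mem_filter, isPath_iff] at hw
    rw [Finset.mem_filter, mem_paths]
    exact ⟨⟨List.length_ofFn, hw.2.1⟩, hw.2.2⟩
  · intro w _ w' _ h
    exact List.ofFn_injective h
  · intro w hw
    rw [Finset.mem_filter, mem_paths] at hw
    obtain ⟨⟨rfl, h1⟩, h2⟩ := hw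
    refine ⟨w.get, ?_, List.ofFn_get w⟩
    rw [Finset.mem_filter, List.ofFn_get, isPath_iff]
    exact ⟨Finset.mem_univ _, h1, h2⟩
  · intro w hw
    rw [Finset.mem_filter, isPath_iff] at hw
    rw [← phi_eq_svf ht s hw.2.1, hw.2.2]

/-- Words permute the coordinates, so `∑ i, t v i` is the same at all vertices of a strongly
connected graph and a single comparison with `s` settles all of them. -/
lemma isSubmul_or_isSupermul_svf [Nonempty V] (hconn : G.StronglyConnected)
    (hp : G.IsProbVector p) {t : V → Fin 2 → ℝ} (ht : G.IsCompatible t) (s : ℝ) :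
    G.IsSubmul (G.svf p q t s) ∨ G.IsSupermul (G.svf p q t s) := by
  have hκ : ∀ v v', ∑ i, t v' i = ∑ i, t v i := by
    intro v v'
    obtain ⟨w, -, hw⟩ := hconn v v'
    rw [isPath_iff] at hw
    rw [← hw.2, ht.sum_finish hw.1]
  have v₀ : V := Classical.arbitrary V
  rcases le_total s (∑ i, t v₀ i) with h | h
  · exact Or.inl (isSubmul_svf hp ht fun v => by rwa [hκ v₀ v])
  · exact Or.inr (isSupermul_svf hp ht fun v => by rwa [hκ v₀ v])

variable [Fintype V]

lemma pressureSeq_eq (hp : G.IsProbVector p) (ht : G.IsCompatible (tau μ q)) (s : ℝ) (k : ℕ) :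
    G.pressureSeq p μ s q k = G.total (G.svf p q (tau μ q) s) k ^ (1 / (k : ℝ)) := by
  classical
  rw [pressureSeq, total]
  congr 1
  refine Finset.sum_congr rfl fun v _ => ?_
  rw [extSum_nil, ← Finset.sum_fiberwise_of_maps_to (s := G.paths k v) (t := Finset.univ)
    (g := G.finish v) fun w _ => Finset.mem_univ _]
  refine Finset.sum_congr rfl fun v' _ => ?_
  rw [svMatrix_eq ht, abs_of_nonneg]
  exact Finset.sum_nonneg fun w _ => (svf_pos hp _ _ _ _).le

lemma tendsto_pressureSeq [Nonempty V] (hconn : G.StronglyConnected) (hp : G.IsProbVector p)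
    (ht : G.IsCompatible (tau μ q)) {s L : ℝ}
    (hL : Tendsto (fun n : ℕ => Real.log (G.total (G.svf p q (tau μ q) s) n) / n) atTop (𝓝 L)) :
    Tendsto (G.pressureSeq p μ s q) atTop (𝓝 (Real.exp L)) := by
  have hE := nonempty_edges hconn
  obtain ⟨C, hC⟩ := exists_isWordWeight_svf (q := q) hp ht s
  refine ((Real.continuous_exp.tendsto L).comp hL).congr fun n => ?_
  rw [pressureSeq_eq hp ht, Real.rpow_def_of_pos (hC.total_pos hconn n), Function.comp_apply]
  congr 1
  ring

/-- The logarithm of the pressure exists, is positive for small and negative for large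
arguments, and has exactly one zero. -/
lemma exists_log_pressure [Nonempty V] (hconn : G.StronglyConnected) (hp : G.IsProbVector p)
    {t : V → Fin 2 → ℝ} (ht : G.IsCompatible t) :
    ∃ (L : ℝ → ℝ) (γ : ℝ), (∀ s, Tendsto (fun n : ℕ => Real.log (G.total (G.svf p q t s) n) / n)
      atTop (𝓝 (L s))) ∧ L γ = 0 ∧ (∀ s, s < γ → 0 < L s) ∧ ∀ s, γ < s → L s < 0 := by
  have hE := nonempty_edges hconn
  obtain ⟨a, b, ha, hb, hab⟩ := G.exists_ratio_bounds
  have hρ := G.isScale_short ha hb hab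
  have hb0 : 0 < b := hρ.b_nonneg
  have hex : ∀ s, ∃ L, Tendsto (fun n : ℕ => Real.log (G.total (G.svf p q t s) n) / n)
      atTop (𝓝 L) := by
    intro s
    obtain ⟨C, hC⟩ := exists_isWordWeight_svf (q := q) hp ht s
    exact hC.exists_tendsto_log_total hconn (isSubmul_or_isSupermul_svf hconn hp ht s)
  choose L hL using hex
  have hpos : ∀ s n, 0 < G.total (G.svf p q t s) n := fun s n => by
    obtain ⟨C, hC⟩ := exists_isWordWeight_svf (q := q) hp ht s
    exact hC.total_pos hconn n
  -- Passing from `s` to `s'` multiplies the weight of a word by the power `s' - s` of its shorter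
  -- side, which lies between `a ^ n` and `b ^ n` for length `n`.
  have hbound : ∀ s s', s ≤ s' → ∀ n : ℕ,
      G.total (G.svf p q t s') n ≤ (b ^ n) ^ (s' - s) * G.total (G.svf p q t s) n ∧
      (a ^ n) ^ (s' - s) * G.total (G.svf p q t s) n ≤ G.total (G.svf p q t s') n := by
    intro s s' hs n
    have h0 : 0 ≤ s' - s := by linarith
    have hsplit : ∀ v w, G.svf p q t s' v w = G.short w ^ (s' - s) * G.svf p q t s v w := by
      intro v w
      have : s' - ∑ i, t v i = (s' - s) + (s - ∑ i, t v i) := by ring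
      rw [svf, svf, this, Real.rpow_add (G.short_pos w)]
      ring
    simp only [total, extSum_nil, Finset.mul_sum]
    constructor
    · refine Finset.sum_le_sum fun v _ => Finset.sum_le_sum fun w hw => ?_
      rw [hsplit]
      refine mul_le_mul_of_nonneg_right ?_ (svf_pos hp _ _ _ _).le
      rw [← (G.mem_paths.1 hw).1]
      exact Real.rpow_le_rpow (G.short_pos w).le (hρ.le_pow w) h0
    · refine Finset.sum_le_sum fun v _ => Finset.sum_le_sum fun w hw => ?_
      rw [hsplit]
      refine mul_le_mul_of_nonneg_right ?_ (svf_pos hp _ _ _ _).le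
      rw [← (G.mem_paths.1 hw).1]
      exact Real.rpow_le_rpow (by positivity) (hρ.pow_le w) h0
  obtain ⟨γ, hγ⟩ := exists_unique_zero_of_slope_bounds (L := L) (Real.log_neg hb0 hb)
    (y := Real.log a) (by
      intro s s' hs
      have hlog : ∀ x : ℝ, 0 < x → ∀ n : ℕ, 1 ≤ n →
          Real.log ((x ^ n) ^ (s' - s) * G.total (G.svf p q t s) n) / n =
            Real.log (G.total (G.svf p q t s) n) / n + (s' - s) * Real.log x := by
        intro x hx n hn
        have hn0 : (n : ℝ) ≠ 0 := by exact_mod_cast (by omega : n ≠ 0)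
        rw [Real.log_mul (Real.rpow_pos_of_pos (by positivity) _).ne' (hpos s n).ne',
          Real.log_rpow (by positivity), Real.log_pow]
        field_simp
        ring
      constructor
      · refine le_of_tendsto_of_tendsto (hL s') ((hL s).add_const ((s' - s) * Real.log b)) ?_
        filter_upwards [eventually_ge_atTop 1] with n hn
        rw [← hlog b hb0 n hn]
        exact div_le_div_of_nonneg_right (Real.log_le_log (hpos s' n) (hbound s s' hs n).1)
          n.cast_nonneg
      · refine le_of_tendsto_of_tendsto ((hL s).add_const ((s' - s) * Real.log a)) (hL s') ?_
        filter_upwards [eventually_ge_atTop 1] with n hn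
        rw [← hlog a ha n hn]
        refine div_le_div_of_nonneg_right (Real.log_le_log ?_ (hbound s s' hs n).2) n.cast_nonneg
        exact mul_pos (Real.rpow_pos_of_pos (by positivity) _) (hpos s n))
  exact ⟨L, γ, hL, hγ⟩

end

end BoxLikeGIFS

/-! ### Moments in the plane -/

/-- The window `[m, m + l]` lies in the segment close to `y`, and the first lattice point strictly
beyond `m` comes before `m + l` because the mesh is `l / 2`. -/
lemma exists_lattice_point_of_pos {o c l u : ℝ} (hl : 0 < l) (hc : l ≤ c) (hu0 : 0 ≤ u)
    (hu1 : u ≤ 1) : ∃ z : ℤ, ∃ x : ℝ, 0 < x ∧ x < 1 ∧ o + c * x = z * (l / 2) ∧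
      |z * (l / 2) - (o + c * u)| ≤ l := by
  have hc0 : 0 < c := hl.trans_le hc
  set y := o + c * u with hy
  set m := max o (y - l) with hm
  have hmo : o ≤ m := le_max_left _ _
  have hml : y - l ≤ m := le_max_right _ _
  have hy1 : o ≤ y := by nlinarith
  have hy2 : y ≤ o + c := by nlinarith
  have hmy : m ≤ y := max_le hy1 (by linarith)
  have hmc : m + l ≤ o + c := by
    rcases max_choice o (y - l) with h | h <;> rw [hm, h] <;> linarith
  have h1 := Int.floor_le (m / (l / 2))
  have h2 := Int.lt_floor_add_one (m / (l / 2))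
  rw [le_div_iff₀ (by linarith)] at h1
  rw [div_lt_iff₀ (by linarith)] at h2
  refine ⟨⌊m / (l / 2)⌋ + 1, ((⌊m / (l / 2)⌋ + 1 : ℤ) * (l / 2) - o) / c, ?_, ?_, ?_, ?_⟩
  · refine div_pos ?_ hc0
    push_cast
    linarith
  · rw [div_lt_one hc0]
    push_cast
    linarith
  · rw [mul_div_cancel₀ _ hc0.ne']
    ring
  · rw [abs_le]
    push_cast
    constructor <;> linarith

/-- A segment of length at least `l` contains a point of the lattice `(l / 2) ℤ` in its interior
close to any given point of it. -/
lemma exists_lattice_point {o c l u : ℝ} (hl : 0 < l) (hc : l ≤ |c|) (hu0 : 0 ≤ u)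
    (hu1 : u ≤ 1) : ∃ z : ℤ, ∃ x : ℝ, 0 < x ∧ x < 1 ∧ o + c * x = z * (l / 2) ∧
      |z * (l / 2) - (o + c * u)| ≤ l := by
  rcases le_total 0 c with h | h
  · rw [abs_of_nonneg h] at hc
    exact exists_lattice_point_of_pos hl hc hu0 hu1
  · rw [abs_of_nonpos h] at hc
    obtain ⟨z, x, h0, h1, h2, h3⟩ := exists_lattice_point_of_pos (o := o + c) hl hc
      (u := 1 - u) (by linarith) (by linarith)
    refine ⟨z, 1 - x, by linarith, by linarith, by linarith, ?_⟩
    convert h3 using 2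
    ring

namespace BoxLikeGIFS

variable {V E : Type*} {G : BoxLikeGIFS V E} {p : E → ℝ} {μ : V → Measure (Fin 2 → ℝ)} {q : ℝ}

lemma psiWord_apply (w : List E) (ξ : Fin 2 → ℝ) (i : Fin 2) :
    G.psiWord w ξ i = G.psiWord w 0 i + G.coef w i * ξ (G.idx w i) := by
  have := G.psiWord_sub w ξ 0 i
  simp only [Pi.zero_apply, sub_zero] at this
  linarith

lemma exists_lattice_point_psiWord (w : List E) {l : ℝ} (hl : 0 < l) (hw : l ≤ G.short w)
    {ξ : Fin 2 → ℝ} (hξ : ξ ∈ Set.Icc (0 : Fin 2 → ℝ) 1) :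
    ∃ z : Fin 2 → ℤ, (fun i => z i * (l / 2)) ∈ G.psiWord w '' openSquare ∧
      dist (fun i => (z i : ℝ) * (l / 2)) (G.psiWord w ξ) ≤ l := by
  have h : ∀ i, ∃ z : ℤ, ∃ x : ℝ, 0 < x ∧ x < 1 ∧
      G.psiWord w 0 i + G.coef w i * x = z * (l / 2) ∧
      |z * (l / 2) - (G.psiWord w 0 i + G.coef w i * ξ (G.idx w i))| ≤ l := fun i =>
    exists_lattice_point hl (hw.trans (G.short_le_side w i)) (hξ.1 _) (hξ.2 _)
  choose z x h0 h1 h2 h3 using h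
  refine ⟨z, ⟨fun j => x (j - G.flipWord w), fun j _ => ⟨h0 _, h1 _⟩, ?_⟩, ?_⟩
  · ext i
    rw [psiWord_apply, ← h2]
    simp [idx]
  · refine (dist_pi_le_iff hl.le).2 fun i => ?_
    rw [Real.dist_eq, psiWord_apply w ξ]
    exact h3 i

lemma side_le_one {a b : ℝ} (hρ : ∀ i, IsScale (fun w => G.side w i) a b) (w : List E) (i : Fin 2) :
    G.side w i ≤ 1 := by
  have := (hρ i).append_le [] w
  rwa [List.nil_append, (hρ i).nil] at this

/-- On a stopping rectangle the measure looks like its projection to the longer side. -/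
lemma mom_psiWord_comparable (hq : 0 ≤ q) {ν : Measure (Fin 2 → ℝ)}
    (hν : ν (Set.Icc 0 1)ᶜ = 0) {w : List E} {δ : ℝ} (hδ : 0 < δ) {C : ℕ} (hC : 1 ≤ C)
    (h1 : δ ≤ C * G.short w) (h2 : G.short w ≤ δ) :
    mom q ν (G.psiWord w) δ ≤
      momConst q C 2 1 * mom q ν (coordMap (G.projIndex w)) (G.short w / G.long w) ∧
    mom q ν (coordMap (G.projIndex w)) (G.short w / G.long w) ≤
      momConst q C 1 2 * mom q ν (G.psiWord w) δ := by
  have hs := G.short_pos w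
  have hl : 0 < G.long w := hs.trans_le (G.short_le_long w)
  have hC' : (1 : ℝ) ≤ C := by exact_mod_cast hC
  have hδC : δ ≤ C * δ := le_mul_of_one_le_left hδ.le hC'
  have ha : ∀ x ∈ Set.Icc (0 : Fin 2 → ℝ) 1, ∀ y ∈ Set.Icc (0 : Fin 2 → ℝ) 1,
      dist (G.psiWord w x) (G.psiWord w y) ≤ δ →
      dist (coordMap (G.projIndex w) x) (coordMap (G.projIndex w) y) ≤
        C * (G.short w / G.long w) := by
    intro x _ y _ h
    have h3 := (dist_le_pi_dist (G.psiWord w x) (G.psiWord w y) (G.longDir w)).trans h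
    rw [dist_psiWord, side_longDir, ← projIndex_eq] at h3
    rw [dist_coordMap, ← mul_div_assoc, le_div_iff₀ hl, mul_comm]
    exact h3.trans h1
  have hb : ∀ x ∈ Set.Icc (0 : Fin 2 → ℝ) 1, ∀ y ∈ Set.Icc (0 : Fin 2 → ℝ) 1,
      dist (coordMap (G.projIndex w) x) (coordMap (G.projIndex w) y) ≤ G.short w / G.long w →
      dist (G.psiWord w x) (G.psiWord w y) ≤ C * δ := by
    intro x hx y hy h
    rw [dist_coordMap, le_div_iff₀ hl, mul_comm] at h
    refine (dist_pi_le_iff (by positivity)).2 fun i => ?_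
    rw [dist_psiWord]
    refine le_trans ?_ (h2.trans hδC)
    by_cases hi : i = G.longDir w
    · rw [hi, side_longDir, ← projIndex_eq]
      exact h
    · have hi' : i = G.longDir w + 1 := by
        have : ∀ x y : Fin 2, x ≠ y → x = y + 1 := by decide
        exact this _ _ hi
      have h5 := dist_le_one_of_mem hx hy (G.idx w i)
      have h6 : G.side w i = G.short w := by rw [hi', side_longDir_add_one]
      rw [h6]
      exact mul_le_of_le_one_right hs.le h5
  exact ⟨mom_le_of_dist_le hq hν hδ (by positivity) ha hb,
    mom_le_of_dist_le hq hν (by positivity) hδ hb ha⟩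

variable [Fintype E] [Nonempty E] {a b : ℝ}

/-- A cube of the `δ`-mesh meets a bounded number of the rectangles of the stopping words. -/
lemma exists_card_meeting_le (hrosc : G.ROSC) (hρ : IsScale G.short a b) :
    ∃ N : ℕ, ∀ δ (hδ : 0 < δ), δ ≤ 1 → ∀ v (k : Fin 2 → ℤ), ∃ T ⊆ hρ.stopSet (G := G) hδ v,
      T.card ≤ N ∧ ∀ w ∈ hρ.stopSet (G := G) hδ v, ∀ ξ ∈ Set.Icc (0 : Fin 2 → ℝ) 1,
        G.psiWord w ξ ∈ meshCube δ k → w ∈ T := by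
  classical
  have ha := hρ.pos
  -- The chosen lattice point is within `a * δ + δ` of the corner of the cube, which is `2 + 2 / a`
  -- steps of the lattice of mesh `a * δ / 2`.
  obtain ⟨C, hC⟩ := exists_nat_ge (2 + 2 / a)
  refine ⟨(2 * (C + 1) + 1) ^ 2, fun δ hδ hδ1 v k => ?_⟩
  refine ⟨{w ∈ hρ.stopSet (G := G) hδ v | ∃ ξ ∈ Set.Icc (0 : Fin 2 → ℝ) 1,
    G.psiWord w ξ ∈ meshCube δ k}, Finset.filter_subset _ _, ?_,
    fun w hw ξ hξ h => Finset.mem_filter.2 ⟨hw, ξ, hξ, h⟩⟩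
  have hl : 0 < a * δ := by positivity
  have hex : ∀ w, G.IsStop G.short δ v w → ∀ ξ ∈ Set.Icc (0 : Fin 2 → ℝ) 1,
      G.psiWord w ξ ∈ meshCube δ k → ∃ z : Fin 2 → ℤ,
        (fun i => z i * (a * δ / 2)) ∈ G.psiWord w '' openSquare ∧
        z ∈ nearIndices (C + 1) (meshCell (a * δ / 2) fun i => (k i : ℝ) * δ) := by
    intro w hw ξ hξ h
    obtain ⟨z, hz, hd⟩ := exists_lattice_point_psiWord w hl (hρ.le_of_isStop hδ1 hw) hξ
    refine ⟨z, hz, mem_nearIndices_of_dist_le (half_pos hl) (mem_meshCube_meshCell (half_pos hl) _)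
      (y := fun i => (z i : ℝ) * (a * δ / 2)) (fun i => ⟨le_rfl, by linarith⟩) ?_⟩
    have hk : (fun i => (k i : ℝ) * δ) ∈ meshCube δ k := fun i => ⟨le_rfl, by linarith⟩
    have h1 := dist_le_of_mem_meshCube hδ hk h
    have h2 := dist_triangle_right (fun i => (k i : ℝ) * δ) (fun i => (z i : ℝ) * (a * δ / 2))
      (G.psiWord w ξ)
    have h3 : (2 + 2 / a) * (a * δ / 2) = a * δ + δ := by field_simp
    have h4 := mul_le_mul_of_nonneg_right hC (half_pos hl).le
    linarith
  choose! z hz hzn using hex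
  rw [← card_nearIndices (C + 1) (meshCell (a * δ / 2) fun i => (k i : ℝ) * δ)]
  have hchoose : ∀ w, ∃ ξ : Fin 2 → ℝ, w ∈ ({w ∈ hρ.stopSet (G := G) hδ v |
      ∃ ξ ∈ Set.Icc (0 : Fin 2 → ℝ) 1, G.psiWord w ξ ∈ meshCube δ k} : Finset (List E)) →
      G.IsStop G.short δ v w ∧ ξ ∈ Set.Icc (0 : Fin 2 → ℝ) 1 ∧ G.psiWord w ξ ∈ meshCube δ k := by
    intro w
    by_cases hw : w ∈ ({w ∈ hρ.stopSet (G := G) hδ v |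
      ∃ ξ ∈ Set.Icc (0 : Fin 2 → ℝ) 1, G.psiWord w ξ ∈ meshCube δ k} : Finset (List E))
    · obtain ⟨hs, ξ, hξ, h⟩ := Finset.mem_filter.1 hw
      exact ⟨ξ, fun _ => ⟨(hρ.mem_stopSet hδ v).1 hs, hξ, h⟩⟩
    · exact ⟨0, fun h => (hw h).elim⟩
  choose ξ hξ using hchoose
  -- Disjoint open rectangles contain different lattice points, so there are no more rectangles than
  -- lattice points near the cube.
  refine Finset.card_le_card_of_injOn (fun w => z w (ξ w)) (fun w hw => ?_) ?_
  · obtain ⟨h1, h2, h3⟩ := hξ w hw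
    exact hzn w h1 _ h2 h3
  · intro w hw w' hw' heq
    obtain ⟨h1, h2, h3⟩ := hξ w hw
    obtain ⟨h1', h2', h3'⟩ := hξ w' hw'
    by_contra hne
    have hdisj := hrosc.disjoint_psiWord h1.1 h1'.1 (h1.not_prefix hρ h1' hne)
      (h1'.not_prefix hρ h1 (Ne.symm hne))
    have hm := hz w h1 _ h2 h3
    have hmw := hz w' h1' _ h2' h3'
    dsimp only at heq
    rw [heq] at hm
    exact Set.disjoint_left.1 hdisj hm hmw

/-- The moments of `μ_v` are comparable to the sums over the stopping words of the moments of the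
pieces. -/
lemma exists_mom_comparable_sum_stopSet [Finite V] (hq : 0 ≤ q) (hrosc : G.ROSC)
    (hp : G.IsProbVector p) (hμ : G.IsSelfAffineFamily p μ) (hρ : IsScale G.short a b) :
    ∃ B : ℝ≥0∞, B ≠ ∞ ∧ ∀ δ (hδ : 0 < δ), δ ≤ 1 → ∀ v,
      mom q (μ v) id δ ≤ B * ∑ w ∈ hρ.stopSet (G := G) hδ v,
        ENNReal.ofReal (weight p w) ^ q * mom q (μ (G.finish v w)) (G.psiWord w) δ ∧
      ∑ w ∈ hρ.stopSet (G := G) hδ v,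
        ENNReal.ofReal (weight p w) ^ q * mom q (μ (G.finish v w)) (G.psiWord w) δ ≤
          B * mom q (μ v) id δ := by
  obtain ⟨N, hN⟩ := exists_card_meeting_le hrosc hρ
  refine ⟨(N : ℝ≥0∞) ^ q + N, ?_, fun δ hδ hδ1 v => ?_⟩
  · exact ENNReal.add_ne_top.2 ⟨ENNReal.rpow_ne_top_of_nonneg hq (ENNReal.natCast_ne_top _),
      ENNReal.natCast_ne_top _⟩
  set S := hρ.stopSet (G := G) hδ v
  set y : List E → (Fin 2 → ℤ) → ℝ≥0∞ := fun w k =>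
    ENNReal.ofReal (weight p w) * μ (G.finish v w) (G.psiWord w ⁻¹' meshCube δ k) with hy
  have hμy : ∀ k, μ v (id ⁻¹' meshCube δ k) = ∑ w ∈ S, y w k := fun k =>
    hμ.apply_eq_sum_stopSet hp hρ hδ hδ1 v (measurableSet_meshCube δ k)
  have hsum : ∑ w ∈ S, ENNReal.ofReal (weight p w) ^ q *
      mom q (μ (G.finish v w)) (G.psiWord w) δ = ∑' k, ∑ w ∈ S, qpow q (y w k) := by
    rw [Summable.tsum_finsetSum fun _ _ => ENNReal.summable]
    refine Finset.sum_congr rfl fun w _ => ?_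
    rw [mom, ← ENNReal.tsum_mul_left]
    refine tsum_congr fun k => ?_
    rw [hy, qpow_mul hq (by simpa using hp.weight_pos w)]
  have hT : ∀ k, ∃ T ⊆ S, T.card ≤ N ∧ ∀ w ∈ S, w ∉ T → y w k = 0 := by
    intro k
    obtain ⟨T, hTS, hTN, hT⟩ := hN δ hδ hδ1 v k
    refine ⟨T, hTS, hTN, fun w hw hwT => ?_⟩
    rw [hy]
    dsimp only
    have h0 : μ (G.finish v w) (G.psiWord w ⁻¹' meshCube δ k) = 0 :=
      measure_mono_null (fun ξ hξ hξK => hwT (hT w hw ξ hξK hξ))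
        (hμ.measure_compl_eq_zero hrosc hp _)
    rw [h0, mul_zero]
  rw [hsum, mom, ← ENNReal.tsum_mul_left, ← ENNReal.tsum_mul_left]
  constructor
  · refine ENNReal.tsum_le_tsum fun k => ?_
    obtain ⟨T, hTS, hTN, hT⟩ := hT k
    rw [hμy, ← Finset.sum_subset hTS hT]
    refine (qpow_sum_le hq T _ hTN).trans ?_
    gcongr
    exact le_self_add
  · refine ENNReal.tsum_le_tsum fun k => ?_
    obtain ⟨T, hTS, hTN, hT⟩ := hT k
    rw [hμy, ← Finset.sum_subset hTS hT, ← Finset.sum_subset hTS fun w hw hwT => by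
      rw [hT w hw hwT, qpow_zero_right]]
    refine (sum_qpow_le hq T _ hTN).trans ?_
    gcongr
    exact le_add_self

end BoxLikeGIFS

/-! ### From the moments in the plane to the zero of the pressure -/

lemma abs_log_toReal_sub_le {x y B B' : ℝ≥0∞} (hx0 : x ≠ 0) (hx : x ≠ ∞) (hy0 : y ≠ 0)
    (hy : y ≠ ∞) (hB : B ≠ ∞) (hB' : B' ≠ ∞) (h : x ≤ B * y) (h' : y ≤ B' * x) :
    |Real.log x.toReal - Real.log y.toReal| ≤ |Real.log B.toReal| + |Real.log B'.toReal| := by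
  have hx1 := ENNReal.toReal_pos hx0 hx
  have hy1 := ENNReal.toReal_pos hy0 hy
  have h1 := ENNReal.toReal_mono (ENNReal.mul_ne_top hB hy) h
  have h2 := ENNReal.toReal_mono (ENNReal.mul_ne_top hB' hx) h'
  rw [ENNReal.toReal_mul] at h1 h2
  have h3 := BoxLikeGIFS.log_mul_le_of_le hx1 hy1 one_pos (by simpa using h1)
  have h4 := BoxLikeGIFS.log_mul_le_of_le hy1 hx1 one_pos (by simpa using h2)
  rw [Real.log_one] at h3 h4
  have := abs_nonneg (Real.log B.toReal)
  have := abs_nonneg (Real.log B'.toReal)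
  rw [abs_le]
  constructor <;> linarith

lemma le_exp_mul_of_abs_log_sub_le {x y K : ℝ} (hx : 0 < x) (hy : 0 < y)
    (h : |Real.log x - Real.log y| ≤ K) : x ≤ Real.exp K * y ∧ y ≤ Real.exp K * x := by
  have key : ∀ {x y : ℝ}, 0 < x → 0 < y → Real.log x - Real.log y ≤ K → x ≤ Real.exp K * y := by
    intro x y hx hy h
    rw [← Real.exp_log hx, ← Real.exp_log hy, ← Real.exp_add, Real.exp_le_exp]
    simpa [Real.exp_log hx, Real.exp_log hy] using (by linarith : Real.log x ≤ K + Real.log y)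
  rw [abs_le] at h
  exact ⟨key hx hy h.2, key hy hx (by linarith)⟩

namespace BoxLikeGIFS

variable {V E : Type*} {G : BoxLikeGIFS V E} {p : E → ℝ} {μ : V → Measure (Fin 2 → ℝ)} {q : ℝ}
  [Fintype E]

lemma log_svf (hp : G.IsProbVector p) (ht : G.IsCompatible (tau μ q)) (s : ℝ) {v : V} {w : List E}
    (hw : G.Adm v w) : Real.log (G.svf p q (tau μ q) s v w) =
      q * Real.log (weight p w) + tau μ q v (G.longDir w) * Real.log (G.long w) +
        (s - tau μ q v (G.longDir w)) * Real.log (G.short w) := by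
  have h1 : G.tauWord μ q w (G.finish v w) = tau μ q v (G.longDir w) := by
    rw [← ht v w _ hw, ← projIndex_eq]
    rfl
  have hs := G.short_pos w
  have hl : 0 < G.long w := hs.trans_le (G.short_le_long w)
  have hpw := hp.weight_pos w
  rw [← phi_eq_svf ht s hw, phi, h1, (G.alpha_eq w).1, (G.alpha_eq w).2, ← weight,
    Real.log_mul (by positivity) (by positivity), Real.log_mul (by positivity) (by positivity),
    Real.log_rpow hpw, Real.log_rpow hl, Real.log_rpow hs]

lemma mom_psiWord_ne_zero (hq : 0 ≤ q) (hμ : G.IsSelfAffineFamily p μ) (v : V) (w : List E)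
    {δ : ℝ} (hδ : 0 < δ) : mom q (μ v) (G.psiWord w) δ ≠ 0 := by
  have := hμ.1 v
  exact mom_ne_zero hq _ hδ

section

variable [Finite V] [Nonempty V] [Nonempty E] {a b : ℝ}

/-- The contribution of a stopping word to the moment of `μ_v` is, up to a factor that is
subexponential in `-log δ`, the modified singular value function divided by `δ ^ s`. -/
lemma exists_abs_log_mom_stopSet_le (hq : 0 ≤ q) (hconn : G.StronglyConnected) (hrosc : G.ROSC)
    (hp : G.IsProbVector p) (hμ : G.IsSelfAffineFamily p μ) (hρ : IsScale G.short a b)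
    (hside : ∀ w i, G.side w i ≤ 1) (s : ℝ) {η : ℝ} (hη : 0 < η) :
    ∃ c : ℝ, ∀ δ, 0 < δ → δ ≤ 1 → ∀ v w, G.IsStop G.short δ v w →
      (ENNReal.ofReal (weight p w) ^ q * mom q (μ (G.finish v w)) (G.psiWord w) δ) ≠ ∞ ∧
      0 < (ENNReal.ofReal (weight p w) ^ q * mom q (μ (G.finish v w)) (G.psiWord w) δ).toReal ∧
      |Real.log (ENNReal.ofReal (weight p w) ^ q *
          mom q (μ (G.finish v w)) (G.psiWord w) δ).toReal -
        Real.log (Real.exp (-(s * Real.log δ)) * G.svf p q (tau μ q) s v w)| ≤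
          c + η * (-Real.log δ) := by
  have ht : G.IsCompatible (tau μ q) := fun v w i hw => tau_finish hq hconn hrosc hp hμ hw i
  have hex := fun x : V × Fin 2 => (scaleRegular_coordMap hq hconn hrosc hp hμ x.1
    x.2).exists_abs_log_add_le (tendsto_tau hq hconn hrosc hp hμ x.1 x.2).1 hη
  choose c hc using hex
  obtain ⟨x₀, hx₀⟩ := Finite.exists_max c
  have ha := hρ.pos
  have ha1 : a ≤ 1 := by
    have h1 := hρ.le_snoc [] (Classical.arbitrary E)
    have h2 := hρ.snoc_le [] (Classical.arbitrary E)
    rw [hρ.nil] at h1 h2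
    linarith [hρ.lt_one]
  obtain ⟨C, hC⟩ := exists_nat_ge (1 / a)
  have hC1 : 1 ≤ C := by
    have : (1 : ℝ) ≤ C := ((one_le_div ha).2 ha1).trans hC
    exact_mod_cast this
  set M := |Real.log (momConst q C 2 1).toReal| + |Real.log (momConst q C 1 2).toReal|
  -- The errors come from replacing the piece by its projection (`M`), from the spectrum of that
  -- projection (`c x₀`), and from passing from `ε` to `δ` and from `G.short w` to `δ`, where `a * δ
  -- ≤ G.short w`.
  refine ⟨M + c x₀ + η * (-Real.log a) + |s| * (-Real.log a), fun δ hδ hδ1 v w hw => ?_⟩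
  have hs := G.short_pos w
  have hl : 0 < G.long w := hs.trans_le (G.short_le_long w)
  have hl1 : G.long w ≤ 1 := by
    rw [← side_longDir]
    exact hside w _
  have hpw := hp.weight_pos w
  have h1 : a * δ ≤ G.short w := hρ.le_of_isStop hδ1 hw
  have h2 : G.short w ≤ δ := hw.2.1.le
  have hδC : δ ≤ C * G.short w := by
    calc δ = 1 / a * (a * δ) := by field_simp
      _ ≤ C * G.short w := by gcongr
  have hprob := hμ.1 (G.finish v w)
  set ε := G.short w / G.long w with hε
  have hε0 : 0 < ε := by positivity
  have hε1 : ε ≤ 1 := (div_le_one hl).2 (G.short_le_long w)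
  obtain ⟨hm1, hm2⟩ := mom_psiWord_comparable hq (hμ.measure_compl_eq_zero hrosc hp (G.finish v w))
    hδ hC1 hδC h2
  have hreg := scaleRegular_coordMap hq hconn hrosc hp hμ (G.finish v w) (G.projIndex w)
  have hΔ := ne_top_of_scaleRegular hreg hε0
  have hΨ : mom q (μ (G.finish v w)) (G.psiWord w) δ ≠ ∞ :=
    ne_top_of_le_ne_top (ENNReal.mul_ne_top (momConst_ne_top hq _ _ _) hΔ) hm1
  have hΨ0 := mom_psiWord_ne_zero hq hμ (G.finish v w) w hδ
  have hlog1 := abs_log_toReal_sub_le hΨ0 hΨ (mom_ne_zero hq _ hε0) hΔ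
    (momConst_ne_top hq _ _ _) (momConst_ne_top hq _ _ _) hm1 hm2
  have hlog2 := hc (G.finish v w, G.projIndex w) ε hε0 hε1
  have hτ : tau μ q (G.finish v w) (G.projIndex w) = tau μ q v (G.longDir w) := by
    rw [projIndex_eq, ht v w _ hw.1]
  dsimp only at hlog2
  rw [hτ] at hlog2
  have hle := hx₀ (G.finish v w, G.projIndex w)
  have hlε : Real.log ε = Real.log (G.short w) - Real.log (G.long w) :=
    Real.log_div hs.ne' hl.ne'
  have hls1 : Real.log a + Real.log δ ≤ Real.log (G.short w) := by
    rw [← Real.log_mul ha.ne' hδ.ne']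
    exact Real.log_le_log (by positivity) h1
  have hls2 := Real.log_le_log hs h2
  have hll := Real.log_nonpos hl.le hl1
  have hla := Real.log_nonpos ha.le ha1
  have hsab : |s * (Real.log (G.short w) - Real.log δ)| ≤ |s| * (-Real.log a) := by
    rw [abs_mul]
    refine mul_le_mul_of_nonneg_left ?_ (abs_nonneg s)
    rw [abs_le]
    constructor <;> linarith
  have hηε : η * (-Real.log ε) ≤ η * (-Real.log a) + η * (-Real.log δ) := by
    rw [← mul_add]
    refine mul_le_mul_of_nonneg_left ?_ hη.le
    linarith
  have htR : (ENNReal.ofReal (weight p w) ^ q).toReal = weight p w ^ q := by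
    rw [← ENNReal.toReal_rpow, ENNReal.toReal_ofReal hpw.le]
  have hΨpos := ENNReal.toReal_pos hΨ0 hΨ
  refine ⟨ENNReal.mul_ne_top (ENNReal.rpow_ne_top_of_nonneg hq ENNReal.ofReal_ne_top) hΨ, ?_, ?_⟩
  · rw [ENNReal.toReal_mul, htR]
    positivity
  · rw [ENNReal.toReal_mul, htR, Real.log_mul (by positivity) hΨpos.ne', Real.log_rpow hpw,
      Real.log_mul (Real.exp_pos _).ne' (svf_pos hp _ _ _ _).ne', Real.log_exp,
      log_svf hp ht s hw.1]
    rw [hlε] at hlog2 hηε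
    rw [abs_le] at hlog1 hlog2 hsab ⊢
    constructor <;> linarith

/-- The moments of `μ_v` in terms of sums of the modified singular value function. -/
lemma exists_mom_le_sum_svf (hq : 0 ≤ q) (hconn : G.StronglyConnected) (hrosc : G.ROSC)
    (hp : G.IsProbVector p) (hμ : G.IsSelfAffineFamily p μ) (hρ : IsScale G.short a b)
    (hside : ∀ w i, G.side w i ≤ 1) (s : ℝ) {η : ℝ} (hη : 0 < η) :
    ∃ c : ℝ, ∀ δ (hδ : 0 < δ), δ ≤ 1 → ∀ v,
      0 < ∑ w ∈ hρ.stopSet (G := G) hδ v, G.svf p q (tau μ q) s v w ∧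
      |Real.log (mom q (μ v) id δ).toReal + s * Real.log δ -
        Real.log (∑ w ∈ hρ.stopSet (G := G) hδ v, G.svf p q (tau μ q) s v w)| ≤
          c + η * (-Real.log δ) := by
  obtain ⟨c, hc⟩ := exists_abs_log_mom_stopSet_le hq hconn hrosc hp hμ hρ hside s hη
  obtain ⟨B, hB, hcomp⟩ := exists_mom_comparable_sum_stopSet hq hrosc hp hμ hρ
  refine ⟨|Real.log B.toReal| + |Real.log B.toReal| + c, fun δ hδ hδ1 v => ?_⟩
  have hreg := scaleRegular_id hq hconn hrosc hp hμ v
  have hm := ne_top_of_scaleRegular hreg hδ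
  have hprob := hμ.1 v
  have hm0 : mom q (μ v) id δ ≠ 0 := mom_ne_zero hq _ hδ
  obtain ⟨h1, h2⟩ := hcomp δ hδ hδ1 v
  have hmem := fun w (hw : w ∈ hρ.stopSet (G := G) hδ v) =>
    hc δ hδ hδ1 v w ((hρ.mem_stopSet hδ v).1 hw)
  set S := hρ.stopSet (G := G) hδ v
  set Y : List E → ℝ≥0∞ := fun w =>
    ENNReal.ofReal (weight p w) ^ q * mom q (μ (G.finish v w)) (G.psiWord w) δ
  have hY : ∑ w ∈ S, Y w ≠ ∞ := ENNReal.sum_ne_top.2 fun w hw => (hmem w hw).1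
  have hY0 : ∑ w ∈ S, Y w ≠ 0 := by
    intro h
    rw [h, mul_zero] at h1
    exact hm0 (le_antisymm h1 zero_le)
  have hne : S.Nonempty := by
    rw [Finset.nonempty_iff_ne_empty]
    intro h
    rw [h, Finset.sum_empty] at hY0
    exact hY0 rfl
  have hpos : 0 < ∑ w ∈ S, G.svf p q (tau μ q) s v w :=
    Finset.sum_pos (fun w _ => svf_pos hp _ _ _ _) hne
  refine ⟨hpos, ?_⟩
  have hlog := abs_log_toReal_sub_le hm0 hm hY0 hY hB hB h1 h2
  have hYR : (∑ w ∈ S, Y w).toReal = ∑ w ∈ S, (Y w).toReal :=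
    ENNReal.toReal_sum fun w hw => (hmem w hw).1
  have hYpos : 0 < ∑ w ∈ S, (Y w).toReal := Finset.sum_pos (fun w hw => (hmem w hw).2.1) hne
  set K := c + η * (-Real.log δ) with hK
  have hexp : ∀ w ∈ S, (Y w).toReal ≤ Real.exp K * (Real.exp (-(s * Real.log δ)) *
      G.svf p q (tau μ q) s v w) ∧ Real.exp (-(s * Real.log δ)) * G.svf p q (tau μ q) s v w ≤
        Real.exp K * (Y w).toReal := fun w hw =>
    le_exp_mul_of_abs_log_sub_le (hmem w hw).2.1
      (mul_pos (Real.exp_pos _) (svf_pos hp _ _ _ _)) (hmem w hw).2.2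
  have hU := Finset.sum_le_sum fun w hw => (hexp w hw).1
  have hL := Finset.sum_le_sum fun w hw => (hexp w hw).2
  simp only [← Finset.mul_sum] at hU hL
  have hU' := Real.log_le_log hYpos hU
  have hL' := Real.log_le_log (by positivity) hL
  rw [Real.log_mul (Real.exp_pos _).ne' (by positivity), Real.log_exp,
    Real.log_mul (Real.exp_pos _).ne' hpos.ne', Real.log_exp] at hU'
  rw [Real.log_mul (Real.exp_pos _).ne' hpos.ne', Real.log_exp,
    Real.log_mul (Real.exp_pos _).ne' hYpos.ne', Real.log_exp] at hL'
  rw [hYR] at hlog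
  rw [abs_le] at hlog ⊢
  constructor <;> linarith

end

variable [Fintype V] [Nonempty V]

/-- The zero of the logarithmic pressure is the growth exponent of the moments of `μ_v`. -/
lemma tendsto_log_mom (hq : 0 ≤ q) (hconn : G.StronglyConnected) (hrosc : G.ROSC)
    (hp : G.IsProbVector p) (hμ : G.IsSelfAffineFamily p μ) {L : ℝ → ℝ} {γ : ℝ}
    (hL : ∀ s, Tendsto (fun n : ℕ => Real.log (G.total (G.svf p q (tau μ q) s) n) / n)
      atTop (𝓝 (L s))) (hpos : ∀ s, s < γ → 0 < L s) (hneg : ∀ s, γ < s → L s < 0) (v : V) :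
    Tendsto (fun δ : ℝ => Real.log (mom q (μ v) id δ).toReal / (-Real.log δ)) (𝓝[>] 0) (𝓝 γ) := by
  have hE := nonempty_edges hconn
  have ht : G.IsCompatible (tau μ q) := fun v w i hw => tau_finish hq hconn hrosc hp hμ hw i
  obtain ⟨a, b, ha, hb, hab⟩ := G.exists_ratio_bounds
  have hρ := G.isScale_short ha hb hab
  have hside : ∀ w i, G.side w i ≤ 1 := side_le_one fun i => G.isScale_side ha hb hab i
  refine tendsto_log_div_of_abs_le fun η hη => ?_
  -- Half of `η` moves `s` off `γ` to either side, and the other half pays for the subexponential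
  -- error.
  have hη2 := half_pos hη
  obtain ⟨c₁, hc₁⟩ := exists_mom_le_sum_svf hq hconn hrosc hp hμ hρ hside (γ + η / 2) hη2
  obtain ⟨c₂, hc₂⟩ := exists_mom_le_sum_svf hq hconn hrosc hp hμ hρ hside (γ - η / 2) hη2
  obtain ⟨C₁, hC₁⟩ := exists_isWordWeight_svf (q := q) hp ht (γ + η / 2)
  obtain ⟨C₂, hC₂⟩ := exists_isWordWeight_svf (q := q) hp ht (γ - η / 2)
  obtain ⟨B, hB⟩ := hC₁.exists_sum_stopSet_le hconn hρ (hL _) (hneg _ (by linarith))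
  obtain ⟨d, hd, hd'⟩ := hC₂.exists_le_sum_stopSet hconn
    (isSubmul_or_isSupermul_svf hconn hp ht _) hρ (hL _) (hpos _ (by linarith))
  obtain ⟨A, hA, hA'⟩ := exists_mom_comparable hq hconn hp hμ
  refine ⟨max (c₁ + Real.log B) (c₂ - Real.log d + (|Real.log A.toReal| + |Real.log A.toReal|)),
    fun δ hδ hδ1 => ?_⟩
  -- The lower bound holds at a vertex that may vary with `δ`; `hcomp` transfers it to `v`.
  obtain ⟨v', hv'⟩ := hd' δ hδ hδ1
  have hreg := fun v => ne_top_of_scaleRegular (scaleRegular_id hq hconn hrosc hp hμ v) hδ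
  have hne : ∀ v, mom q (μ v) id δ ≠ 0 := fun v => by
    have := hμ.1 v
    exact mom_ne_zero hq _ hδ
  have hcomp := abs_log_toReal_sub_le (hne v') (hreg v') (hne v) (hreg v) hA hA
    (hA' v v' δ hδ) (hA' v' v δ hδ)
  obtain ⟨hS₁, h₁⟩ := hc₁ δ hδ hδ1 v
  obtain ⟨hS₂, h₂⟩ := hc₂ δ hδ hδ1 v'
  have hlB := Real.log_le_log hS₁ (hB δ hδ v)
  have hld := Real.log_le_log hd hv'
  have hm₁ := le_max_left (c₁ + Real.log B)
    (c₂ - Real.log d + (|Real.log A.toReal| + |Real.log A.toReal|))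
  have hm₂ := le_max_right (c₁ + Real.log B)
    (c₂ - Real.log d + (|Real.log A.toReal| + |Real.log A.toReal|))
  rw [abs_le] at h₁ h₂ hcomp ⊢
  constructor <;> linarith

end BoxLikeGIFS

/-- For all `q ≥ 0`: the `L^q`-spectra of the projections and the limits defining the pressure
exist, `P(·, q) = 1` has a unique root `γ`, and the `L^q`-spectrum of every `μ_v` exists and
equals `γ`. -/
theorem theorem2p2 {V E : Type*} [Fintype V] [Nonempty V] [Fintype E] (G : BoxLikeGIFS V E)
    (hconn : G.StronglyConnected) (hrosc : G.ROSC)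
    (p : E → ℝ) (hp : G.IsProbVector p)
    (μ : V → Measure (Fin 2 → ℝ)) (hμ : G.IsSelfAffineFamily p μ)
    (q : ℝ) (hq : 0 ≤ q) :
    (∀ (v : V) (i : Fin 2), HasLqSpectrum (projMeasure i (μ v)) q
      (lqSpectrum (projMeasure i (μ v)) q)) ∧
    (∀ s : ℝ, Tendsto (G.pressureSeq p μ s q) atTop (𝓝 (G.pressure p μ s q))) ∧
    ∃ γ : ℝ, (∀ s : ℝ, G.pressure p μ s q = 1 ↔ s = γ) ∧ ∀ v : V, HasLqSpectrum (μ v) q γ := by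
  have ht : G.IsCompatible (BoxLikeGIFS.tau μ q) := fun v w i hw =>
    BoxLikeGIFS.tau_finish hq hconn hrosc hp hμ hw i
  obtain ⟨L, γ, hL, hγ, hpos, hneg⟩ := BoxLikeGIFS.exists_log_pressure (q := q) hconn hp ht
  have hlim := fun s => BoxLikeGIFS.tendsto_pressureSeq hconn hp ht (hL s)
  have hP : ∀ s, G.pressure p μ s q = Real.exp (L s) := fun s => (hlim s).limUnder_eq
  refine ⟨fun v i => (BoxLikeGIFS.tendsto_tau hq hconn hrosc hp hμ v i).2,
    fun s => by rw [hP]; exact hlim s, γ, fun s => ?_, fun v => ?_⟩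
  · rw [hP, Real.exp_eq_one_iff]
    refine ⟨fun h => ?_, fun h => h ▸ hγ⟩
    rcases lt_trichotomy s γ with hs | hs | hs
    · exact absurd h (hpos s hs).ne'
    · exact hs
    · exact absurd h (hneg s hs).ne
  · have := hμ.1 v
    refine hasLqSpectrum_of_tendsto
      ((BoxLikeGIFS.tendsto_log_mom hq hconn hrosc hp hμ hL hpos hneg v).congr fun δ => ?_)
    rw [← meshMoment_map hq measurable_id, Measure.map_id]
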